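/- Let $\mathbb{k}$ be a field of characteristic zero. \textbf{Analytic functors.} A \emph{species} $F$ is a functor from finite sets and bijections to $\mathbb{k}$-vector spaces (equivalently, a sequence of right $S_n$-modules $F(n)=F(\{1,\dots,n\})$, where $\sigma$ acts on the right by $F(\sigma^{-1})$). Its value on a vector space $V$ is $F(V)=\bigoplus_{n\ge 0}F(n)\otimes_{\mathbb{k}S_n}V^{\otimes n}$. A \emph{twisted Lie algebra} $\mathfrak{g}$ is a Lie algebra in the symmetric monoidal category of species with the Cauchy product $(F\cdot G)(I)=\bigoplus_{I=I_0\sqcup I_1}F(I_0)\otimes G(I_1)$; for each $V$ its value $\mathfrak{g}(V)$ is a Lie algebra. For a Lie algebra $L$, $H_n(L,\mathbb{k})$ denotes the homology of the Chevalley--Eilenberg complex $(\Lambda^\bullet(L),d)$, $$d(x_1\wedge\cdots\wedge x_n)=\sum_{1\le i<j\le n}(-1)^{i+j-1}[x_i,x_j]\wedge x_1\wedge\cdots\wedge\hat x_i\wedge\cdots\wedge\hat x_j\wedge\cdots\wedge x_n .$$ For a twisted Lie algebra $\mathfrak{g}$, the homology $H_n(\mathfrak{g},\mathbb{k})$ is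 the species defined by the same formula, with exterior powers taken with respect to the Cauchy product. \textbf{The Tits--Allison--Gao construction.} For a (non-unital) Jordan algebra $J$ over $\mathbb{k}$, put $D_{a,b}=[L_a,L_b]$, where $L_a$ is multiplication by $a$, $\mathcal{B}(J)=\Lambda^2(J)/(ab\wedge c+bc\wedge a+ca\wedge b : a,b,c\in J)$, and $\mathsf{TAG}(J)=\mathfrak{sl}_2\otimes J\oplus\mathcal{B}(J)$ with the Lie bracket $$[x\otimes a,y\otimes b]=[x,y]\otimes ab+\tfrac12\operatorname{tr}(\operatorname{ad}x\operatorname{ad}y)\,a\wedge b,\qquad [a\wedge b,x\otimes c]=x\otimes D_{a,b}(c),$$ $$[a\wedge b,c\wedge d]=D_{a,b}(c)\wedge d+c\wedge D_{a,b}(d).$$ The Lie algebra $\mathfrak{sl}_2$ acts on $\mathsf{TAG}(J)$ by derivations through the adjoint action on the factor $\mathfrak{sl}_2$ and trivially on $\mathcal{B}(J)$. Let $\mathrm{Jord}(V)$ be the free Jordan algebra generated by a vector space $V$. Let $\mathcal{TAG}$ be the twisted Lie algebra whose value on a finite set $I$ consists of the elements of $\mathsf{TAG}(\mathrm{Jord}(x_i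 : i\in I))$ of degree exactly one in each generator $x_i$, and whose bracket is induced by that of $\mathsf{TAG}$; $\mathfrak{sl}_2$ acts on it by derivations. \textbf{Proposition.} (1) For every vector space $V$ over $\mathbb{k}$ and every $n\ge 0$ there is an isomorphism of vector spaces $$H_n(\mathsf{TAG}(\mathrm{Jord}(V)),\mathbb{k})\cong H_n(\mathcal{TAG},\mathbb{k})(V),$$ natural in $V$ and compatible with the actions of $\mathfrak{sl}_2$. (2) More generally, Chevalley--Eilenberg homology commutes with the evaluation of analytic functors: for every twisted Lie algebra $\mathfrak{g}$ over $\mathbb{k}$, every $V$ and every $n\ge 0$ there is an isomorphism $H_n(\mathfrak{g}(V),\mathbb{k})\cong H_n(\mathfrak{g},\mathbb{k})(V)$, natural in $V$. -/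

import Mathlib

universe u v w

set_option linter.unusedSectionVars false

noncomputable section

open scoped TensorProduct DirectSum

/-! ## Free Jordan algebras -/

/-- The relations defining the free Jordan algebra on a vector space `V`: linearity of the
generators, commutativity and the Jordan identity, closed under the operations. -/
inductive FreeJordan.Rel (k : Type u) [Field k] (V : Type v) [AddCommGroup V] [Module k V] :
    FreeNonUnitalNonAssocAlgebra k V → FreeNonUnitalNonAssocAlgebra k V → Prop
  | of_add (v w : V) : Rel k V (FreeNonUnitalNonAssocAlgebra.of k (v + w))
      (FreeNonUnitalNonAssocAlgebra.of k v + FreeNonUnitalNonAssocAlgebra.of k w)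
  | of_smul (t : k) (v : V) : Rel k V (FreeNonUnitalNonAssocAlgebra.of k (t • v))
      (t • FreeNonUnitalNonAssocAlgebra.of k v)
  | comm (a b : FreeNonUnitalNonAssocAlgebra k V) : Rel k V (a * b) (b * a)
  | jordan (a b : FreeNonUnitalNonAssocAlgebra k V) :
      Rel k V (a * b * (a * a)) (a * (b * (a * a)))
  | smul (t : k) {a b : FreeNonUnitalNonAssocAlgebra k V} : Rel k V a b → Rel k V (t • a) (t • b)
  | add_right {a b : FreeNonUnitalNonAssocAlgebra k V} (c : FreeNonUnitalNonAssocAlgebra k V) :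
      Rel k V a b → Rel k V (a + c) (b + c)
  | mul_left (a : FreeNonUnitalNonAssocAlgebra k V) {b c : FreeNonUnitalNonAssocAlgebra k V} :
      Rel k V b c → Rel k V (a * b) (a * c)
  | mul_right {a b : FreeNonUnitalNonAssocAlgebra k V} (c : FreeNonUnitalNonAssocAlgebra k V) :
      Rel k V a b → Rel k V (a * c) (b * c)

/-- The free (non-unital) Jordan algebra generated by the vector space `V`. -/
def FreeJordan (k : Type u) [Field k] (V : Type v) [AddCommGroup V] [Module k V] : Type (max u v) :=
  Quot (FreeJordan.Rel k V)

namespace FreeJordan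

variable {k : Type u} [Field k] {V : Type v} [AddCommGroup V] [Module k V]

theorem Rel.addLeft (a : FreeNonUnitalNonAssocAlgebra k V)
    {b c : FreeNonUnitalNonAssocAlgebra k V} (h : Rel k V b c) : Rel k V (a + b) (a + c) := by
  rw [add_comm _ b, add_comm _ c]; exact h.add_right _

theorem Rel.neg {a b : FreeNonUnitalNonAssocAlgebra k V} (h : Rel k V a b) :
    Rel k V (-a) (-b) := by
  simpa only [neg_one_smul] using h.smul (-1)

instance : SMul k (FreeJordan k V) where smul t := Quot.map (t • ·) (fun _ _ => Rel.smul t)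

instance : Zero (FreeJordan k V) where zero := Quot.mk _ 0

instance : Add (FreeJordan k V) where
  add := Quot.map₂ (· + ·) (fun _ _ _ => Rel.addLeft _) fun _ _ _ => Rel.add_right _

instance : Neg (FreeJordan k V) where neg := Quot.map Neg.neg fun _ _ => Rel.neg

instance : Mul (FreeJordan k V) where
  mul := Quot.map₂ (· * ·) (fun _ _ _ => Rel.mul_left _) fun _ _ _ => Rel.mul_right _

instance : AddCommGroup (FreeJordan k V) where
  add_assoc := by rintro ⟨a⟩ ⟨b⟩ ⟨c⟩; exact congrArg (Quot.mk _) (add_assoc a b c)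
  zero_add := by rintro ⟨a⟩; exact congrArg (Quot.mk _) (zero_add a)
  add_zero := by rintro ⟨a⟩; exact congrArg (Quot.mk _) (add_zero a)
  nsmul := nsmulRec
  zsmul := zsmulRec
  neg_add_cancel := by rintro ⟨a⟩; exact congrArg (Quot.mk _) (neg_add_cancel a)
  add_comm := by rintro ⟨a⟩ ⟨b⟩; exact congrArg (Quot.mk _) (add_comm a b)

instance : NonUnitalNonAssocCommRing (FreeJordan k V) where
  left_distrib := by rintro ⟨a⟩ ⟨b⟩ ⟨c⟩; exact congrArg (Quot.mk _) (mul_add a b c)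
  right_distrib := by rintro ⟨a⟩ ⟨b⟩ ⟨c⟩; exact congrArg (Quot.mk _) (add_mul a b c)
  zero_mul := by rintro ⟨a⟩; exact congrArg (Quot.mk _) (zero_mul a)
  mul_zero := by rintro ⟨a⟩; exact congrArg (Quot.mk _) (mul_zero a)
  mul_comm := by rintro ⟨a⟩ ⟨b⟩; exact Quot.sound (Rel.comm a b)

instance : IsCommJordan (FreeJordan k V) where
  lmul_comm_rmul_rmul := by rintro ⟨a⟩ ⟨b⟩; exact Quot.sound (Rel.jordan a b)

instance : Module k (FreeJordan k V) where
  one_smul := by rintro ⟨a⟩; exact congrArg (Quot.mk _) (one_smul k a)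
  mul_smul s t := by rintro ⟨a⟩; exact congrArg (Quot.mk _) (mul_smul s t a)
  smul_zero t := congrArg (Quot.mk _) (smul_zero t)
  smul_add t := by rintro ⟨a⟩ ⟨b⟩; exact congrArg (Quot.mk _) (smul_add t a b)
  add_smul s t := by rintro ⟨a⟩; exact congrArg (Quot.mk _) (add_smul s t a)
  zero_smul := by rintro ⟨a⟩; exact congrArg (Quot.mk _) (zero_smul k a)

instance : IsScalarTower k (FreeJordan k V) (FreeJordan k V) where
  smul_assoc t := by rintro ⟨a⟩ ⟨b⟩; exact congrArg (Quot.mk _) (smul_mul_assoc t a b)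

instance : SMulCommClass k (FreeJordan k V) (FreeJordan k V) where
  smul_comm t := by rintro ⟨a⟩ ⟨b⟩; exact congrArg (Quot.mk _) (mul_smul_comm t a b).symm

/-- The inclusion of the generators. -/
def of : V →ₗ[k] FreeJordan k V where
  toFun v := Quot.mk _ (FreeNonUnitalNonAssocAlgebra.of k v)
  map_add' v w := Quot.sound (Rel.of_add v w)
  map_smul' t v := Quot.sound (Rel.of_smul t v)

section lift

variable {J : Type w} [NonUnitalNonAssocCommRing J] [IsCommJordan J] [Module k J]
  [IsScalarTower k J J] [SMulCommClass k J J]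

/-- The universal property: a linear map from `V` to a Jordan algebra extends to `FreeJordan k V`. -/
def lift (f : V →ₗ[k] J) : FreeJordan k V →ₙₐ[k] J where
  toFun := Quot.lift (FreeNonUnitalNonAssocAlgebra.lift k (fun v => f v)) (by
    intro a b h
    induction h with
    | of_add v w => simp
    | of_smul t v => simp
    | comm a b => simp [mul_comm]
    | jordan a b => simp [IsCommJordan.lmul_comm_rmul_rmul]
    | smul t _ ih => rw [map_smul, map_smul, ih]
    | add_right c _ ih => rw [map_add, map_add, ih]
    | mul_left a _ ih => rw [map_mul, map_mul, ih]
    | mul_right c _ ih => rw [map_mul, map_mul, ih])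
  map_smul' t := by
    rintro ⟨a⟩; exact map_smul (FreeNonUnitalNonAssocAlgebra.lift k (fun v => f v)) t a
  map_zero' := map_zero (FreeNonUnitalNonAssocAlgebra.lift k (fun v => f v))
  map_add' := by
    rintro ⟨a⟩ ⟨b⟩; exact map_add (FreeNonUnitalNonAssocAlgebra.lift k (fun v => f v)) a b
  map_mul' := by
    rintro ⟨a⟩ ⟨b⟩; exact map_mul (FreeNonUnitalNonAssocAlgebra.lift k (fun v => f v)) a b

@[simp] theorem lift_of (f : V →ₗ[k] J) (v : V) : lift f (of v) = f v :=
  FreeNonUnitalNonAssocAlgebra.lift_of_apply k _ v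

theorem hom_ext {F G : FreeJordan k V →ₙₐ[k] J} (h : ∀ v, F (of v) = G (of v)) : F = G := by
  let q : FreeNonUnitalNonAssocAlgebra k V →ₙₐ[k] FreeJordan k V :=
    { toFun := Quot.mk _
      map_smul' := fun _ _ => rfl
      map_zero' := rfl
      map_add' := fun _ _ => rfl
      map_mul' := fun _ _ => rfl }
  have : F.comp q = G.comp q := FreeNonUnitalNonAssocAlgebra.hom_ext k (fun v => h v)
  ext ⟨a⟩
  exact DFunLike.congr_fun this a

end lift

/-- Functoriality of the free Jordan algebra in the vector space of generators. -/
def map {W : Type w} [AddCommGroup W] [Module k W] (f : V →ₗ[k] W) :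
    FreeJordan k V →ₙₐ[k] FreeJordan k W :=
  lift (of ∘ₗ f)

@[simp] theorem map_of {W : Type w} [AddCommGroup W] [Module k W] (f : V →ₗ[k] W) (v : V) :
    map f (of v) = of (f v) := lift_of _ v

theorem map_id : map (LinearMap.id : V →ₗ[k] V) = NonUnitalAlgHom.id k (FreeJordan k V) :=
  hom_ext fun v => by simp

theorem map_map {W : Type w} [AddCommGroup W] [Module k W] {X : Type*} [AddCommGroup X]
    [Module k X] (f : V →ₗ[k] W) (g : W →ₗ[k] X) (x : FreeJordan k V) :
    map g (map f x) = map (g ∘ₗ f) x := by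
  have : (map g).comp (map f) = map (g ∘ₗ f) := hom_ext fun v => by simp
  exact DFunLike.congr_fun this x

end FreeJordan

/-! ## The Tits-Allison-Gao Lie algebra of a Jordan algebra -/

theorem eq_zero_of_eq_neg_self (k : Type u) [Field k] [CharZero k] {M : Type v} [AddCommGroup M]
    [Module k M] {x : M} (h : x = -x) : x = 0 := by
  have h2 : (2 : k) • x = 0 := by
    rw [two_smul]; nth_rewrite 1 [h]; exact neg_add_cancel x
  exact (smul_eq_zero.mp h2).resolve_left two_ne_zero

namespace JordanAlg

section D

variable (k : Type u) [Field k] {J : Type v} [NonUnitalNonAssocCommRing J]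
  [Module k J] [IsScalarTower k J J] [SMulCommClass k J J]

/-- The operator `D_{a,b} = [L_a, L_b]`, bilinear in `a` and `b`. -/
def D : J →ₗ[k] J →ₗ[k] Module.End k J :=
  LinearMap.mk₂ k (fun a b => LinearMap.mul k J a ∘ₗ LinearMap.mul k J b -
      LinearMap.mul k J b ∘ₗ LinearMap.mul k J a)
    (by intros; ext; simp [mul_add]; abel)
    (by intros; ext; simp [smul_sub])
    (by intros; ext; simp [mul_add]; abel)
    (by intros; ext; simp [smul_sub])

@[simp] theorem D_apply (a b c : J) : D k a b c = a * (b * c) - b * (a * c) := rfl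

/-- The derivations of `J`. -/
def Der (J : Type v) [NonUnitalNonAssocCommRing J] [Module k J] [IsScalarTower k J J]
    [SMulCommClass k J J] : Submodule k (Module.End k J) where
  carrier := {δ | ∀ a b : J, δ (a * b) = δ a * b + a * δ b}
  add_mem' := by
    intro δ ε hδ hε a b
    simp only [LinearMap.add_apply, hδ a b, hε a b, add_mul, mul_add]; abel
  zero_mem' := by intro a b; simp
  smul_mem' := by
    intro t δ hδ a b
    simp only [LinearMap.smul_apply, hδ a b, smul_add, smul_mul_assoc, mul_smul_comm]

variable [CharZero k] [IsCommJordan J]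

theorem linearized (k : Type u) [Field k] [CharZero k] {J : Type v} [NonUnitalNonAssocCommRing J]
    [Module k J] [IsCommJordan J] (x a b c : J) : a * (x * (b * c)) + b * (x * (c * a)) + c * (x * (a * b)) =
    (b * c) * (x * a) + (c * a) * (x * b) + (a * b) * (x * c) := by
  have h := DFunLike.congr_fun (two_nsmul_lie_lmul_lmul_add_add_eq_zero a b c) x
  have h2 : (2 : k) • ((a * (b * c * x) - b * c * (a * x)) + (b * (c * a * x) - c * a * (b * x))
      + (c * (a * b * x) - a * b * (c * x))) = 0 := by
    rw [two_smul, ← two_nsmul]; exact h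
  have h3 := (smul_eq_zero.mp h2).resolve_left two_ne_zero
  rw [← sub_eq_zero, ← h3]
  simp only [mul_comm x]
  abel

theorem D_cyclic (a b c : J) : D k (a * b) c + D k (b * c) a + D k (c * a) b = 0 := by
  ext x
  have h := linearized k x a b c
  rw [← sub_eq_zero] at h
  simp only [LinearMap.add_apply, D_apply, LinearMap.zero_apply]
  rw [← neg_eq_zero, ← h]
  simp only [mul_comm x]
  abel

theorem D_mem (a b : J) : D k a b ∈ Der k J := by
  intro c d
  have h1 := linearized k b a c d
  have h2 := linearized k a b c d
  have h3 : a * (b * (c * d)) + c * (b * (d * a)) + d * (b * (a * c)) -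
      (b * (a * (c * d)) + c * (a * (d * b)) + d * (a * (b * c))) = 0 := by
    rw [h1, h2, mul_comm b a, mul_comm d a, mul_comm d b, mul_comm (b * d), mul_comm (a * d)]
    abel
  rw [mul_comm d a, mul_comm d b] at h3
  simp only [D_apply, sub_mul, mul_sub]
  rw [← sub_eq_zero, ← h3, mul_comm (a * (b * c)) d, mul_comm (b * (a * c)) d]
  abel

end D

section B

/-- The relations `ab ∧ c + bc ∧ a + ca ∧ b` in the exterior square of `J`. -/
def BRel (k : Type u) [Field k] (J : Type v) [NonUnitalNonAssocCommRing J] [Module k J] :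
    Submodule k (⋀[k]^2 J) :=
  Submodule.span k (Set.range fun p : J × J × J =>
    exteriorPower.ιMulti k 2 ![p.1 * p.2.1, p.2.2] +
    exteriorPower.ιMulti k 2 ![p.2.1 * p.2.2, p.1] +
    exteriorPower.ιMulti k 2 ![p.2.2 * p.1, p.2.1])

/-- `B(J) = Λ²(J) / (ab ∧ c + bc ∧ a + ca ∧ b)`. -/
def B (k : Type u) [Field k] (J : Type v) [NonUnitalNonAssocCommRing J] [Module k J] : Type _ :=
  (⋀[k]^2 J) ⧸ BRel k J

variable (k : Type u) [Field k] {J : Type v} [NonUnitalNonAssocCommRing J]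
  [Module k J]

instance : AddCommGroup (B k J) := inferInstanceAs (AddCommGroup ((⋀[k]^2 J) ⧸ BRel k J))

instance : Module k (B k J) := inferInstanceAs (Module k ((⋀[k]^2 J) ⧸ BRel k J))

/-- The quotient map `Λ²(J) → B(J)`. -/
def BMk : ⋀[k]^2 J →ₗ[k] B k J := (BRel k J).mkQ

theorem update_pair_zero {α : Type*} (x y a : α) : Function.update ![x, y] 0 a = ![a, y] := by
  ext i; fin_cases i <;> rfl

theorem update_pair_one {α : Type*} (x y a : α) : Function.update ![x, y] 1 a = ![x, a] := by
  ext i; fin_cases i <;> rfl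

/-- The class of `a ∧ b` in `B(J)`. -/
def wedge : J →ₗ[k] J →ₗ[k] B k J :=
  LinearMap.mk₂ k (fun a b => BMk k (exteriorPower.ιMulti k 2 ![a, b]))
    (by
      intro a b c
      have := (exteriorPower.ιMulti k 2 (M := J)).map_update_add ![0, c] 0 a b
      simp only [update_pair_zero] at this
      rw [this, map_add])
    (by
      intro t a c
      have := (exteriorPower.ιMulti k 2 (M := J)).map_update_smul ![0, c] 0 t a
      simp only [update_pair_zero] at this
      rw [this, map_smul])
    (by
      intro c a b
      have := (exteriorPower.ιMulti k 2 (M := J)).map_update_add ![c, 0] 1 a b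
      simp only [update_pair_one] at this
      rw [this, map_add])
    (by
      intro t c a
      have := (exteriorPower.ιMulti k 2 (M := J)).map_update_smul ![c, 0] 1 t a
      simp only [update_pair_one] at this
      rw [this, map_smul])

theorem wedge_self (a : J) : wedge k a a = 0 := by
  have : exteriorPower.ιMulti k 2 ![a, a] = 0 :=
    (exteriorPower.ιMulti k 2).map_eq_zero_of_eq ![a, a] (i := 0) (j := 1) rfl (by decide)
  change BMk k _ = 0
  rw [this, map_zero]

theorem wedge_swap (a b : J) : wedge k b a = -wedge k a b := by
  have h := wedge_self k (a + b)
  simp only [map_add, LinearMap.add_apply, wedge_self, zero_add, add_zero] at h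
  exact eq_neg_of_add_eq_zero_left h

theorem wedge_cyclic (a b c : J) :
    wedge k (a * b) c + wedge k (b * c) a + wedge k (c * a) b = 0 :=
  (Submodule.Quotient.mk_eq_zero _).mpr (Submodule.subset_span ⟨(a, b, c), rfl⟩)

theorem B_induction {p : B k J → Prop} (hw : ∀ a b, p (wedge k a b))
    (hadd : ∀ x y, p x → p y → p (x + y)) (hsmul : ∀ (t : k) x, p x → p (t • x)) (x : B k J) :
    p x := by
  obtain ⟨y, rfl⟩ := (BRel k J).mkQ_surjective x
  have hy : y ∈ Submodule.span k (Set.range (exteriorPower.ιMulti k 2 (M := J))) := by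
    rw [exteriorPower.ιMulti_span]; trivial
  induction hy using Submodule.span_induction with
  | mem x hx =>
    obtain ⟨f, rfl⟩ := hx
    have : f = ![f 0, f 1] := by ext i; fin_cases i <;> rfl
    rw [this]; exact hw _ _
  | zero => have := hsmul 0 _ (hw 0 0); rwa [zero_smul] at this
  | add x y _ _ hx hy => rw [map_add]; exact hadd _ _ hx hy
  | smul t x _ hx => rw [map_smul]; exact hsmul _ _ hx

/-- The universal property of `B(J)`. -/
def BLift {N : Type w} [AddCommGroup N] [Module k N] (f : J →ₗ[k] J →ₗ[k] N)
    (halt : ∀ a, f a a = 0) (hcyc : ∀ a b c, f (a * b) c + f (b * c) a + f (c * a) b = 0) :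
    B k J →ₗ[k] N :=
  (BRel k J).liftQ (exteriorPower.alternatingMapLinearEquiv
    { toFun := fun x => f (x 0) (x 1)
      map_update_add' := by
        intro _ x i a b
        fin_cases i <;> simp [Function.update_of_ne]
      map_update_smul' := by
        intro _ x i t a
        fin_cases i <;> simp [Function.update_of_ne]
      map_eq_zero_of_eq' := by
        intro x i j h hij
        fin_cases i <;> fin_cases j <;> simp_all })
    (by
      rw [BRel, Submodule.span_le]
      rintro _ ⟨⟨a, b, c⟩, rfl⟩
      simp only [SetLike.mem_coe, LinearMap.mem_ker, map_add,
        exteriorPower.alternatingMapLinearEquiv_apply_ιMulti]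
      exact hcyc a b c)

@[simp] theorem BLift_wedge {N : Type w} [AddCommGroup N] [Module k N] (f : J →ₗ[k] J →ₗ[k] N)
    (halt : ∀ a, f a a = 0) (hcyc : ∀ a b c, f (a * b) c + f (b * c) a + f (c * a) b = 0)
    (a b : J) : BLift k f halt hcyc (wedge k a b) = f a b :=
  exteriorPower.alternatingMapLinearEquiv_apply_ιMulti _ _

/-- Functoriality of `B(J)`. -/
def BMap {J' : Type w} [NonUnitalNonAssocCommRing J'] [Module k J'] (φ : J →ₙₐ[k] J') :
    B k J →ₗ[k] B k J' :=
  BLift k ((wedge k).compl₁₂ (φ : J →ₗ[k] J') (φ : J →ₗ[k] J'))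
    (fun a => wedge_self k _)
    (fun a b c => by simpa using wedge_cyclic k (φ a) (φ b) (φ c))

@[simp] theorem BMap_wedge {J' : Type w} [NonUnitalNonAssocCommRing J'] [Module k J']
    (φ : J →ₙₐ[k] J') (a b : J) : BMap k φ (wedge k a b) = wedge k (φ a) (φ b) :=
  BLift_wedge k _ _ _ a b

variable [IsScalarTower k J J] [SMulCommClass k J J]

/-- The bilinear map `(a, b) ↦ δ a ∧ b + a ∧ δ b`. -/
def derBForm (δ : Module.End k J) : J →ₗ[k] J →ₗ[k] B k J :=
  LinearMap.mk₂ k (fun a b => wedge k (δ a) b + wedge k a (δ b))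
    (by intro a b c; simp only [map_add, LinearMap.add_apply]; abel)
    (by intro t a c; simp only [map_smul, LinearMap.smul_apply, smul_add])
    (by intro a b c; simp only [map_add]; abel)
    (by intro t a c; simp only [map_smul, smul_add])

theorem derBForm_apply (δ : Module.End k J) (a b : J) :
    derBForm k δ a b = wedge k (δ a) b + wedge k a (δ b) := rfl

theorem derBForm_cyclic (δ : Module.End k J) (h : δ ∈ Der k J) (a b c : J) :
    derBForm k δ (a * b) c + derBForm k δ (b * c) a + derBForm k δ (c * a) b = 0 := by
  have h1 := wedge_cyclic k (δ a) b c
  have h2 := wedge_cyclic k a (δ b) c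
  have h3 := wedge_cyclic k a b (δ c)
  have h : ∀ a b, δ (a * b) = δ a * b + a * δ b := h
  have h4 := congrArg₂ (· + ·) h1 (congrArg₂ (· + ·) h2 h3)
  simp only [add_zero] at h4
  rw [← h4]
  simp only [derBForm_apply, h, map_add, LinearMap.add_apply]
  abel

/-- The action of a derivation of `J` on `B(J)`: `δ (a ∧ b) = δ a ∧ b + a ∧ δ b`. -/
def derB₁ (δ : Der k J) : Module.End k (B k J) :=
  BLift k (derBForm k δ.1) (fun a => by rw [derBForm_apply, wedge_swap k a, neg_add_cancel])
    (derBForm_cyclic k δ.1 δ.2)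

@[simp] theorem derB₁_wedge (δ : Der k J) (a b : J) :
    derB₁ k δ (wedge k a b) = wedge k (δ.1 a) b + wedge k a (δ.1 b) :=
  BLift_wedge k _ _ _ a b

/-- The action of derivations of `J` on `B(J)`. -/
def derB : Der k J →ₗ[k] Module.End k (B k J) where
  toFun δ := derB₁ k δ
  map_add' δ ε := by
    ext x
    induction x using B_induction with
    | hw a b =>
      rw [LinearMap.add_apply, derB₁_wedge, derB₁_wedge, derB₁_wedge]
      simp only [Submodule.coe_add, LinearMap.add_apply, map_add]
      abel
    | hadd x y hx hy => rw [map_add, map_add, hx, hy]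
    | hsmul t x hx => rw [map_smul, map_smul, hx]
  map_smul' t δ := by
    ext x
    induction x using B_induction with
    | hw a b =>
      rw [LinearMap.smul_apply, derB₁_wedge, derB₁_wedge]
      simp only [Submodule.coe_smul, LinearMap.smul_apply, map_smul, smul_add,
        RingHom.id_apply]
    | hadd x y hx hy => rw [map_add, map_add, hx, hy]
    | hsmul t x hx => rw [map_smul, map_smul, hx]

@[simp] theorem derB_wedge (δ : Der k J) (a b : J) :
    derB k δ (wedge k a b) = wedge k (δ.1 a) b + wedge k a (δ.1 b) :=
  derB₁_wedge k δ a b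

variable [CharZero k] [IsCommJordan J]

/-- The action of `B(J)` on `J` by inner derivations: `a ∧ b` acts as `D_{a,b}`. -/
def DB : B k J →ₗ[k] Der k J :=
  LinearMap.codRestrict (Der k J)
    (BLift k (D k) (fun a => by ext; simp) (fun a b c => D_cyclic k a b c))
    (fun x => by
      induction x using B_induction with
      | hw a b => rw [BLift_wedge]; exact D_mem k a b
      | hadd x y hx hy => rw [map_add]; exact add_mem hx hy
      | hsmul t x hx => rw [map_smul]; exact Submodule.smul_mem _ _ hx)

@[simp] theorem DB_wedge (a b : J) : (DB k (wedge k a b) : Module.End k J) = D k a b := by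
  simp [DB]

/-- The bracket of `B(J)`: `[a ∧ b, c ∧ d] = D_{a,b}(c) ∧ d + c ∧ D_{a,b}(d)`. -/
def bracketB : B k J →ₗ[k] B k J →ₗ[k] B k J := derB k ∘ₗ DB k

end B

end JordanAlg

open JordanAlg

/-- The Lie algebra `𝔰𝔩₂` over `k`. -/
abbrev Sl2 (k : Type u) [Field k] : Type u := LieAlgebra.SpecialLinear.sl (Fin 2) k

namespace Sl2

variable (k : Type u) [Field k]

/-- The invariant form `2 tr(xy)` on `𝔰𝔩₂`; it is one half of the Killing form
`tr(ad x ∘ ad y) = 4 tr(xy)`. -/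
def form : Sl2 k →ₗ[k] Sl2 k →ₗ[k] k :=
  LinearMap.mk₂ k (fun x y => 2 * Matrix.trace (x.1 * y.1))
    (by intros; simp [add_mul, mul_add]) (by intros; simp; ring)
    (by intros; simp [mul_add]) (by intros; simp; ring)

variable {k}

theorem form_apply (x y : Sl2 k) : form k x y = 2 * Matrix.trace (x.1 * y.1) := rfl

theorem form_comm (x y : Sl2 k) : form k x y = form k y x := by
  rw [form_apply, form_apply, Matrix.trace_mul_comm]

theorem one_one (x : Sl2 k) : x.1 1 1 = -x.1 0 0 := by
  have h : Matrix.trace x.1 = 0 := LinearMap.mem_ker.mp x.2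
  rw [Matrix.trace_fin_two] at h
  exact eq_neg_of_add_eq_zero_right h

theorem form_lie (x y z : Sl2 k) : form k ⁅x, y⁆ z + form k y ⁅x, z⁆ = 0 := by
  simp only [form_apply, LieSubalgebra.coe_bracket, Ring.lie_def, Matrix.trace_fin_two,
    Matrix.mul_apply, Fin.sum_univ_two, Matrix.sub_apply, one_one]
  ring

theorem lie_lie_form (x y z : Sl2 k) : ⁅x, ⁅y, z⁆⁆ = form k x y • z - form k x z • y := by
  apply Subtype.ext
  ext i j
  fin_cases i <;> fin_cases j <;>
  simp [form_apply, LieSubalgebra.coe_bracket, Ring.lie_def, Matrix.trace_fin_two,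
    Matrix.mul_apply, Fin.sum_univ_two, Matrix.sub_apply, one_one] <;> ring

end Sl2

/-- The vector space `TAG(J) = 𝔰𝔩₂ ⊗ J ⊕ B(J)`. -/
def TAG (k : Type u) [Field k] (J : Type v) [NonUnitalNonAssocCommRing J] [Module k J] :
    Type (max u v) :=
  (Sl2 k ⊗[k] J) × B k J

namespace TAG

section brackets

variable (k : Type u) [Field k] {J : Type v} [NonUnitalNonAssocCommRing J] [Module k J]

instance : AddCommGroup (TAG k J) := inferInstanceAs (AddCommGroup ((Sl2 k ⊗[k] J) × B k J))

instance : Module k (TAG k J) := inferInstanceAs (Module k ((Sl2 k ⊗[k] J) × B k J))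

/-- `(x ⊗ a, y ⊗ b) ↦ 2 tr(xy) a ∧ b`. -/
def formWedge : (Sl2 k ⊗[k] J) →ₗ[k] (Sl2 k ⊗[k] J) →ₗ[k] B k J :=
  (TensorProduct.map₂ (Sl2.form k) (wedge k)).compr₂ (TensorProduct.lid k (B k J)).toLinearMap

variable {k} in
@[simp] theorem formWedge_tmul (x y : Sl2 k) (a b : J) :
    formWedge k (x ⊗ₜ a) (y ⊗ₜ b) = Sl2.form k x y • wedge k a b := by
  simp [formWedge]

variable [IsScalarTower k J J] [SMulCommClass k J J]

/-- `(x ⊗ a, y ⊗ b) ↦ [x, y] ⊗ ab`. -/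
def lieMul : (Sl2 k ⊗[k] J) →ₗ[k] (Sl2 k ⊗[k] J) →ₗ[k] (Sl2 k ⊗[k] J) :=
  TensorProduct.map₂ (LieModule.toEnd k (Sl2 k) (Sl2 k) : Sl2 k →ₗ[k] Module.End k (Sl2 k))
    (LinearMap.mul k J)

variable {k} in
@[simp] theorem lieMul_tmul (x y : Sl2 k) (a b : J) :
    lieMul k (x ⊗ₜ a) (y ⊗ₜ b) = ⁅x, y⁆ ⊗ₜ (a * b) := by
  simp [lieMul]

variable [CharZero k] [IsCommJordan J]

/-- `(b, x ⊗ c) ↦ x ⊗ b(c)`, where `a ∧ b` in `B(J)` acts on `J` as `D_{a,b}`. -/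
def act : B k J →ₗ[k] Module.End k (Sl2 k ⊗[k] J) :=
  LinearMap.lTensorHom (Sl2 k) ∘ₗ (Der k J).subtype ∘ₗ DB k

variable {k} in
@[simp] theorem act_tmul (b : B k J) (x : Sl2 k) (c : J) :
    act k b (x ⊗ₜ c) = x ⊗ₜ ((DB k b).1 c) := by
  simp [act]

/-- The bracket of `TAG(J)`:
`[x ⊗ a, y ⊗ b] = [x, y] ⊗ ab + 2 tr(xy) a ∧ b`, `[a ∧ b, x ⊗ c] = x ⊗ D_{a,b}(c)`,
`[a ∧ b, c ∧ d] = D_{a,b}(c) ∧ d + c ∧ D_{a,b}(d)`. -/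
instance : Bracket (TAG k J) (TAG k J) where
  bracket p q := (lieMul k p.1 q.1 + act k p.2 q.1 - act k q.2 p.1,
    formWedge k p.1 q.1 + bracketB k p.2 q.2)

end brackets

section Lie

variable {k : Type u} [Field k] [CharZero k] {J : Type v} [NonUnitalNonAssocCommRing J]
  [IsCommJordan J] [Module k J] [IsScalarTower k J J] [SMulCommClass k J J]

theorem lie_def (p q : TAG k J) : ⁅p, q⁆ = ((lieMul k p.1 q.1 + act k p.2 q.1 - act k q.2 p.1,
    formWedge k p.1 q.1 + bracketB k p.2 q.2) : (Sl2 k ⊗[k] J) × B k J) := rfl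

@[simp] theorem bracketB_wedge (x : B k J) (a b : J) : bracketB k x (wedge k a b) =
    wedge k ((DB k x).1 a) b + wedge k a ((DB k x).1 b) := by
  simp [bracketB]

theorem DB_derB (δ : Der k J) (x : B k J) : (DB k (derB k δ x)).1 = ⁅δ.1, (DB k x).1⁆ := by
  induction x using B_induction with
  | hw a b =>
    ext c
    have h : ∀ a b, δ.1 (a * b) = δ.1 a * b + a * δ.1 b := δ.2
    simp only [derB_wedge, map_add, Submodule.coe_add, DB_wedge, LinearMap.add_apply, D_apply,
      Ring.lie_def, LinearMap.sub_apply, Module.End.mul_apply, h, map_sub, mul_add]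
    abel
  | hadd x y hx hy => simp only [map_add, Submodule.coe_add, hx, hy, Ring.lie_def, mul_add, add_mul]; abel
  | hsmul t x hx => simp only [map_smul, Submodule.coe_smul, hx, Ring.lie_def, smul_sub, mul_smul_comm,
      smul_mul_assoc]

theorem DB_bracketB (x y : B k J) : (DB k (bracketB k x y)).1 = ⁅(DB k x).1, (DB k y).1⁆ :=
  DB_derB _ _

theorem bracketB_skew (x y : B k J) : bracketB k x y = -bracketB k y x := by
  induction x using B_induction with
  | hadd x y hx hy => simp only [map_add, LinearMap.add_apply, hx, hy]; abel
  | hsmul t x hx => simp only [map_smul, LinearMap.smul_apply, hx, smul_neg]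
  | hw a b =>
    induction y using B_induction with
    | hadd x y hx hy => simp only [map_add, LinearMap.add_apply, hx, hy]; abel
    | hsmul t x hx => simp only [map_smul, LinearMap.smul_apply, hx, smul_neg]
    | hw c d =>
      have h1 := wedge_cyclic k a (b * c) d
      have h2 := wedge_cyclic k a (b * d) c
      have h3 := wedge_cyclic k b (a * c) d
      have h4 := wedge_cyclic k b (a * d) c
      simp only [bracketB_wedge, DB_wedge, D_apply, map_sub, LinearMap.sub_apply]
      rw [← sub_eq_zero]
      have h5 : (wedge k (a * (b * c)) d + wedge k ((b * c) * d) a + wedge k (d * a) (b * c))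
        - (wedge k (a * (b * d)) c + wedge k ((b * d) * c) a + wedge k (c * a) (b * d))
        - (wedge k (b * (a * c)) d + wedge k ((a * c) * d) b + wedge k (d * b) (a * c))
        + (wedge k (b * (a * d)) c + wedge k ((a * d) * c) b + wedge k (c * b) (a * d)) = 0 := by
        rw [h1, h2, h3, h4]; simp
      rw [← h5]
      simp only [mul_comm d a, mul_comm c a, mul_comm d b, mul_comm c b, mul_comm (b * c) d,
        mul_comm (b * d) c, mul_comm (a * c) d, mul_comm (a * d) c,
        wedge_swap k (a * (b * d)) c, wedge_swap k (b * (a * d)) c,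
        wedge_swap k (c * (b * d)) a, wedge_swap k (d * (b * c)) a,
        wedge_swap k (a * c) (b * d), wedge_swap k (a * d) (b * c)]
      abel

theorem bracketB_lie (x y z : B k J) : bracketB k x (bracketB k y z) =
    bracketB k (bracketB k x y) z + bracketB k y (bracketB k x z) := by
  induction z using B_induction with
  | hadd x y hx hy => simp only [map_add, hx, hy]; abel
  | hsmul t x hx => simp only [map_smul, hx, smul_add]
  | hw a b =>
    simp only [bracketB_wedge, map_add, DB_bracketB, Ring.lie_def, LinearMap.sub_apply,
      Module.End.mul_apply, map_sub, LinearMap.sub_apply]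
    abel

theorem act_bracketB (x y : B k J) (t : Sl2 k ⊗[k] J) :
    act k (bracketB k x y) t = act k x (act k y t) - act k y (act k x t) := by
  induction t using TensorProduct.induction_on with
  | zero => simp
  | add a b ha hb => simp only [map_add, ha, hb]; abel
  | tmul s c => simp only [act_tmul, DB_bracketB, Ring.lie_def, LinearMap.sub_apply,
      Module.End.mul_apply, TensorProduct.tmul_sub]

theorem DB_mul (x : B k J) (a b : J) : (DB k x).1 (a * b) = (DB k x).1 a * b + a * (DB k x).1 b :=
  (DB k x).2 a b

theorem act_lieMul (x : B k J) (t s : Sl2 k ⊗[k] J) :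
    act k x (lieMul k t s) = lieMul k (act k x t) s + lieMul k t (act k x s) := by
  induction t using TensorProduct.induction_on with
  | zero => simp
  | add a b ha hb => simp only [map_add, LinearMap.add_apply, ha, hb]; abel
  | tmul p a =>
    induction s using TensorProduct.induction_on with
    | zero => simp
    | add a b ha hb => simp only [map_add, ha, hb]; abel
    | tmul q b => simp only [act_tmul, lieMul_tmul, DB_mul, TensorProduct.tmul_add]

theorem bracketB_formWedge (x : B k J) (t s : Sl2 k ⊗[k] J) :
    bracketB k x (formWedge k t s) = formWedge k (act k x t) s + formWedge k t (act k x s) := by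
  induction t using TensorProduct.induction_on with
  | zero => simp
  | add a b ha hb => simp only [map_add, LinearMap.add_apply, ha, hb]; abel
  | tmul p a =>
    induction s using TensorProduct.induction_on with
    | zero => simp
    | add a b ha hb => simp only [map_add, ha, hb]; abel
    | tmul q b => simp only [act_tmul, formWedge_tmul, map_smul, bracketB_wedge, smul_add]

theorem lieMul_skew (t s : Sl2 k ⊗[k] J) : lieMul k t s = -lieMul k s t := by
  induction t using TensorProduct.induction_on with
  | zero => simp
  | add a b ha hb => simp only [map_add, LinearMap.add_apply, ha, hb]; abel
  | tmul p a =>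
    induction s using TensorProduct.induction_on with
    | zero => simp
    | add a b ha hb => simp only [map_add, LinearMap.add_apply, ha, hb]; abel
    | tmul q b => rw [lieMul_tmul, lieMul_tmul, ← lie_skew, TensorProduct.neg_tmul, mul_comm]

theorem formWedge_skew (t s : Sl2 k ⊗[k] J) : formWedge k t s = -formWedge k s t := by
  induction t using TensorProduct.induction_on with
  | zero => simp
  | add a b ha hb => simp only [map_add, LinearMap.add_apply, ha, hb]; abel
  | tmul p a =>
    induction s using TensorProduct.induction_on with
    | zero => simp
    | add a b ha hb => simp only [map_add, LinearMap.add_apply, ha, hb]; abel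
    | tmul q b => rw [formWedge_tmul, formWedge_tmul, Sl2.form_comm, wedge_swap, smul_neg]

theorem lieMul_jacobi (t s r : Sl2 k ⊗[k] J) :
    lieMul k t (lieMul k s r) - act k (formWedge k s r) t =
    lieMul k (lieMul k t s) r + act k (formWedge k t s) r + lieMul k s (lieMul k t r) -
      act k (formWedge k t r) s := by
  induction t using TensorProduct.induction_on with
  | zero => simp
  | add a b ha hb =>
    have := congrArg₂ (· + ·) ha hb
    simp only [map_add, LinearMap.add_apply]
    rw [← sub_eq_zero] at this ⊢
    rw [← this]; abel
  | tmul p a =>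
    induction s using TensorProduct.induction_on with
    | zero => simp
    | add a b ha hb =>
      have := congrArg₂ (· + ·) ha hb
      simp only [map_add, LinearMap.add_apply]
      rw [← sub_eq_zero] at this ⊢
      rw [← this]; abel
    | tmul q b =>
      induction r using TensorProduct.induction_on with
      | zero => simp
      | add a b ha hb =>
        have := congrArg₂ (· + ·) ha hb
        simp only [map_add, LinearMap.add_apply]
        rw [← sub_eq_zero] at this ⊢
        rw [← this]; abel
      | tmul r c =>
        simp only [lieMul_tmul, formWedge_tmul, map_smul, LinearMap.smul_apply, act_tmul,
          DB_wedge, D_apply, TensorProduct.tmul_sub, Sl2.lie_lie_form]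
        rw [← lie_skew ⁅p, q⁆ r, Sl2.lie_lie_form]
        simp only [TensorProduct.sub_tmul, TensorProduct.neg_tmul, ← TensorProduct.smul_tmul',
          Sl2.form_comm r, Sl2.form_comm q p, mul_comm _ a, mul_comm c, smul_sub]
        abel

theorem formWedge_jacobi (t s r : Sl2 k ⊗[k] J) :
    formWedge k t (lieMul k s r) = formWedge k (lieMul k t s) r + formWedge k s (lieMul k t r) := by
  induction t using TensorProduct.induction_on with
  | zero => simp
  | add a b ha hb => simp only [map_add, LinearMap.add_apply, ha, hb]; abel
  | tmul p a =>
    induction s using TensorProduct.induction_on with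
    | zero => simp
    | add a b ha hb => simp only [map_add, LinearMap.add_apply, ha, hb]; abel
    | tmul q b =>
      induction r using TensorProduct.induction_on with
      | zero => simp
      | add a b ha hb => simp only [map_add, ha, hb]; abel
      | tmul r c =>
        simp only [lieMul_tmul, formWedge_tmul]
        have h1 := Sl2.form_lie q p r
        have h2 := Sl2.form_lie p q r
        rw [← lie_skew, map_neg, LinearMap.neg_apply] at h1
        have h3 : Sl2.form k p ⁅q, r⁆ = Sl2.form k ⁅p, q⁆ r := by linear_combination h1
        have h4 : Sl2.form k q ⁅p, r⁆ = -Sl2.form k ⁅p, q⁆ r := by linear_combination h2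
        have h5 := wedge_cyclic k a b c
        have h6 : wedge k a (b * c) = wedge k (a * b) c - wedge k b (a * c) := by
          rw [wedge_swap k (b * c) a, wedge_swap k (a * c) b, mul_comm a c, ← sub_eq_zero,
            ← neg_eq_zero, ← h5]
          abel
        rw [h3, h4, h6, smul_sub, neg_smul, sub_eq_add_neg]

theorem fst_add (p q : TAG k J) : (p + q).1 = p.1 + q.1 := rfl

theorem snd_add (p q : TAG k J) : (p + q).2 = p.2 + q.2 := rfl

theorem fst_smul (t : k) (p : TAG k J) : (t • p).1 = t • p.1 := rfl

theorem snd_smul (t : k) (p : TAG k J) : (t • p).2 = t • p.2 := rfl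

theorem fst_lie (p q : TAG k J) :
    ⁅p, q⁆.1 = lieMul k p.1 q.1 + act k p.2 q.1 - act k q.2 p.1 := rfl

theorem snd_lie (p q : TAG k J) : ⁅p, q⁆.2 = formWedge k p.1 q.1 + bracketB k p.2 q.2 := rfl

@[ext] theorem ext {p q : TAG k J} (h1 : p.1 = q.1) (h2 : p.2 = q.2) : p = q := Prod.ext h1 h2

instance : LieRing (TAG k J) where
  add_lie p q r := by
    ext
    · simp only [fst_lie, fst_add, snd_add, map_add, LinearMap.add_apply]; abel
    · simp only [snd_lie, fst_add, snd_add, map_add, LinearMap.add_apply]; abel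
  lie_add p q r := by
    ext
    · simp only [fst_lie, fst_add, snd_add, map_add, LinearMap.add_apply]; abel
    · simp only [snd_lie, fst_add, snd_add, map_add]; abel
  lie_self p := by
    ext
    · rw [fst_lie, add_sub_cancel_right]
      exact eq_zero_of_eq_neg_self k (lieMul_skew _ _)
    · rw [snd_lie, eq_zero_of_eq_neg_self k (formWedge_skew p.1 p.1),
        eq_zero_of_eq_neg_self k (bracketB_skew p.2 p.2)]
      exact add_zero _
  leibniz_lie p q r := by
    ext
    · simp only [fst_lie, fst_add, snd_lie, map_add, map_sub, LinearMap.add_apply,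
        LinearMap.sub_apply, act_lieMul, act_bracketB]
      have h := lieMul_jacobi p.1 q.1 r.1
      rw [← sub_eq_zero] at h ⊢
      rw [← h, lieMul_skew q.1 (act k r.2 p.1)]
      abel
    · simp only [fst_lie, snd_add, snd_lie, map_add, map_sub, LinearMap.add_apply,
        LinearMap.sub_apply, bracketB_skew (formWedge k p.1 q.1) r.2, bracketB_formWedge]
      rw [formWedge_jacobi p.1 q.1 r.1, bracketB_lie p.2 q.2 r.2,
        formWedge_skew q.1 (act k r.2 p.1)]
      abel

instance : LieAlgebra k (TAG k J) where
  lie_smul t p q := by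
    ext
    · simp only [fst_lie, fst_smul, snd_smul, map_smul, LinearMap.smul_apply, smul_add, smul_sub]
    · simp only [snd_lie, fst_smul, snd_smul, map_smul, smul_add]

/-- Functoriality of `TAG(J)` in the Jordan algebra `J`. -/
def map {J' : Type w} [NonUnitalNonAssocCommRing J'] [IsCommJordan J'] [Module k J']
    [IsScalarTower k J' J'] [SMulCommClass k J' J'] (φ : J →ₙₐ[k] J') : TAG k J →ₗ⁅k⁆ TAG k J' where
  toFun p := ((φ : J →ₗ[k] J').lTensor (Sl2 k) p.1, BMap k φ p.2)
  map_add' p q := by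
    ext
    · exact map_add ((φ : J →ₗ[k] J').lTensor (Sl2 k)) p.1 q.1
    · exact map_add (BMap k φ) p.2 q.2
  map_smul' t p := by
    ext
    · exact map_smul ((φ : J →ₗ[k] J').lTensor (Sl2 k)) t p.1
    · exact map_smul (BMap k φ) t p.2
  map_lie' {p q} := by
    have hD : ∀ (b : B k J) (c : J), φ ((DB k b).1 c) = (DB k (BMap k φ b)).1 (φ c) := by
      intro b c
      induction b using B_induction with
      | hadd x y hx hy => simp only [map_add, Submodule.coe_add, LinearMap.add_apply, hx, hy]
      | hsmul t x hx => simp only [map_smul, Submodule.coe_smul, LinearMap.smul_apply, hx]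
      | hw a b => simp
    have hact : ∀ (b : B k J) (t : Sl2 k ⊗[k] J), (φ : J →ₗ[k] J').lTensor (Sl2 k) (act k b t) =
        act k (BMap k φ b) ((φ : J →ₗ[k] J').lTensor (Sl2 k) t) := by
      intro b t
      induction t using TensorProduct.induction_on with
      | zero => simp
      | add a b ha hb => simp only [map_add, ha, hb]
      | tmul s c => simpa using congrArg (s ⊗ₜ[k] ·) (hD b c)
    have hmul : ∀ t s : Sl2 k ⊗[k] J, (φ : J →ₗ[k] J').lTensor (Sl2 k) (lieMul k t s) =
        lieMul k ((φ : J →ₗ[k] J').lTensor (Sl2 k) t) ((φ : J →ₗ[k] J').lTensor (Sl2 k) s) := by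
      intro t s
      induction t using TensorProduct.induction_on with
      | zero => simp
      | add a b ha hb => simp only [map_add, LinearMap.add_apply, ha, hb]
      | tmul p a =>
        induction s using TensorProduct.induction_on with
        | zero => simp
        | add a b ha hb => simp only [map_add, ha, hb]
        | tmul q b => simp
    have hform : ∀ t s : Sl2 k ⊗[k] J, BMap k φ (formWedge k t s) =
        formWedge k ((φ : J →ₗ[k] J').lTensor (Sl2 k) t)
          ((φ : J →ₗ[k] J').lTensor (Sl2 k) s) := by
      intro t s
      induction t using TensorProduct.induction_on with
      | zero => simp
      | add a b ha hb => simp only [map_add, LinearMap.add_apply, ha, hb]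
      | tmul p a =>
        induction s using TensorProduct.induction_on with
        | zero => simp
        | add a b ha hb => simp only [map_add, ha, hb]
        | tmul q b => simp
    have hB : ∀ x y : B k J, BMap k φ (bracketB k x y) =
        bracketB k (BMap k φ x) (BMap k φ y) := by
      intro x y
      induction y using B_induction with
      | hadd x y hx hy => simp only [map_add, hx, hy]
      | hsmul t x hx => simp only [map_smul, hx]
      | hw a b => simp [hD]
    ext
    · simp only [fst_lie, map_add, map_sub, hact, hmul]; rfl
    · simp only [snd_lie, map_add, hform, hB]; rfl

/-- The operator `s · (x ⊗ a) = [s, x] ⊗ a`, `s · (a ∧ b) = 0` on `TAG(J)`, for `s` in `𝔰𝔩₂`. -/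
def slMap (s : Sl2 k) : TAG k J →ₗ[k] TAG k J where
  toFun p := ((LieModule.toEnd k (Sl2 k) (Sl2 k) s).rTensor J p.1, 0)
  map_add' p q := by
    ext
    · exact map_add ((LieModule.toEnd k (Sl2 k) (Sl2 k) s).rTensor J) p.1 q.1
    · exact (add_zero (0 : B k J)).symm
  map_smul' t p := by
    ext
    · exact map_smul ((LieModule.toEnd k (Sl2 k) (Sl2 k) s).rTensor J) t p.1
    · exact (smul_zero t).symm

theorem fst_slMap (s : Sl2 k) (p : TAG k J) :
    (slMap s p).1 = (LieModule.toEnd k (Sl2 k) (Sl2 k) s).rTensor J p.1 := rfl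

theorem snd_slMap (s : Sl2 k) (p : TAG k J) : (slMap s p).2 = 0 := rfl

theorem slMap_lie (s : Sl2 k) (p q : TAG k J) :
    slMap s ⁅p, q⁆ = ⁅slMap s p, q⁆ + ⁅p, slMap s q⁆ := by
  have hact : ∀ (b : B k J) (t : Sl2 k ⊗[k] J),
      (LieModule.toEnd k (Sl2 k) (Sl2 k) s).rTensor J (act k b t) =
      act k b ((LieModule.toEnd k (Sl2 k) (Sl2 k) s).rTensor J t) := by
    intro b t
    induction t using TensorProduct.induction_on with
    | zero => simp
    | add a b ha hb => simp only [map_add, ha, hb]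
    | tmul s c => simp
  have hmul : ∀ t r : Sl2 k ⊗[k] J,
      (LieModule.toEnd k (Sl2 k) (Sl2 k) s).rTensor J (lieMul k t r) =
      lieMul k ((LieModule.toEnd k (Sl2 k) (Sl2 k) s).rTensor J t) r +
      lieMul k t ((LieModule.toEnd k (Sl2 k) (Sl2 k) s).rTensor J r) := by
    intro t r
    induction t using TensorProduct.induction_on with
    | zero => simp
    | add a b ha hb => simp only [map_add, LinearMap.add_apply, ha, hb]; abel
    | tmul p a =>
      induction r using TensorProduct.induction_on with
      | zero => simp
      | add a b ha hb => simp only [map_add, ha, hb]; abel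
      | tmul q b => simp [← TensorProduct.add_tmul]
  have hform : ∀ t r : Sl2 k ⊗[k] J,
      formWedge k ((LieModule.toEnd k (Sl2 k) (Sl2 k) s).rTensor J t) r +
      formWedge k t ((LieModule.toEnd k (Sl2 k) (Sl2 k) s).rTensor J r) = 0 := by
    intro t r
    induction t using TensorProduct.induction_on with
    | zero => simp
    | add a b ha hb =>
      simp only [map_add, LinearMap.add_apply]
      rw [← add_zero (0 : B k J)]
      nth_rewrite 1 [← ha]
      rw [← hb]
      abel
    | tmul p a =>
      induction r using TensorProduct.induction_on with
      | zero => simp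
      | add a b ha hb =>
        simp only [map_add]
        rw [← add_zero (0 : B k J)]
        nth_rewrite 1 [← ha]
        rw [← hb]
        abel
      | tmul q b => simp [← add_smul, Sl2.form_lie]
  ext
  · simp only [fst_add, fst_lie, fst_slMap, snd_slMap, map_add, map_sub, hact, hmul, map_zero,
      LinearMap.zero_apply]
    abel
  · simp only [snd_add, snd_lie, fst_slMap, snd_slMap, map_zero, LinearMap.zero_apply, add_zero,
      hform]

/-- The action of `𝔰𝔩₂` on `TAG(J)` by derivations, making `TAG(J)` a Lie algebra in the
category of `𝔰𝔩₂`-modules. -/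
def slAction (s : Sl2 k) : LieDerivation k (TAG k J) (TAG k J) where
  toLinearMap := slMap s
  leibniz' p q := by rw [slMap_lie, ← lie_skew q, sub_neg_eq_add, add_comm]

end Lie

end TAG

/-! ## Analytic functors -/

/-- The coefficients of an analytic functor: a linear species, that is, a functor from finite sets
and bijections to vector spaces. It amounts to the sequence of the right `S_n`-modules
`obj (Fin n)`, where `σ` acts on the right by `map σ⁻¹`. -/
structure Species (k : Type u) [Field k] where
  obj : (I : Type) → [Finite I] → Type w
  [addCommGroup : (I : Type) → [Finite I] → AddCommGroup (obj I)]
  [module : (I : Type) → [Finite I] → Module k (obj I)]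
  map : {I J : Type} → [Finite I] → [Finite J] → (I ≃ J) → obj I →ₗ[k] obj J
  map_refl : ∀ (I : Type) [Finite I] (x : obj I), map (Equiv.refl I) x = x
  map_trans : ∀ {I J K : Type} [Finite I] [Finite J] [Finite K] (e : I ≃ J) (f : J ≃ K)
    (x : obj I), map (e.trans f) x = map f (map e x)

namespace Species

variable {k : Type u} [Field k]

instance (F : Species.{u, w} k) (I : Type) [Finite I] : AddCommGroup (F.obj I) := F.addCommGroup I

instance (F : Species.{u, w} k) (I : Type) [Finite I] : Module k (F.obj I) := F.module I

/-- Morphisms of species. -/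
structure Hom (F : Species.{u, w} k) (G : Species.{u, v} k) where
  app : (I : Type) → [Finite I] → F.obj I →ₗ[k] G.obj I
  naturality : ∀ {I J : Type} [Finite I] [Finite J] (e : I ≃ J) (x : F.obj I),
    app J (F.map e x) = G.map e (app I x)

section Eval

variable (F : Species.{u, w} k) (V : Type v) [AddCommGroup V] [Module k V]

/-- The relations `x σ ⊗ t = x ⊗ σ t` in `F(n) ⊗ V^{⊗ n}`, where `x σ = map σ⁻¹ x` and
`σ (v_1 ⊗ ⋯ ⊗ v_n)` is the permuted tensor with `i`-th factor `v_{σ⁻¹ i}`. -/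
def evalRel (n : ℕ) : Submodule k (F.obj (Fin n) ⊗[k] (⨂[k] _ : Fin n, V)) :=
  Submodule.span k (Set.range
    fun p : Equiv.Perm (Fin n) × F.obj (Fin n) × (⨂[k] _ : Fin n, V) =>
      F.map p.1.symm p.2.1 ⊗ₜ[k] p.2.2 -
        p.2.1 ⊗ₜ[k] PiTensorProduct.reindex k (fun _ => V) p.1 p.2.2)

/-- `F(n) ⊗_{k S_n} V^{⊗ n}`. -/
def EvalDeg (n : ℕ) : Type (max u v w) :=
  (F.obj (Fin n) ⊗[k] (⨂[k] _ : Fin n, V)) ⧸ F.evalRel V n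

instance (n : ℕ) : AddCommGroup (F.EvalDeg V n) :=
  inferInstanceAs (AddCommGroup ((F.obj (Fin n) ⊗[k] (⨂[k] _ : Fin n, V)) ⧸ F.evalRel V n))

instance (n : ℕ) : Module k (F.EvalDeg V n) :=
  inferInstanceAs (Module k ((F.obj (Fin n) ⊗[k] (⨂[k] _ : Fin n, V)) ⧸ F.evalRel V n))

/-- The value `F(V) = ⨁ₙ F(n) ⊗_{k S_n} V^{⊗ n}` of the analytic functor on `V`. -/
def Eval : Type (max u v w) := ⨁ n : ℕ, F.EvalDeg V n

instance : AddCommGroup (F.Eval V) := inferInstanceAs (AddCommGroup (⨁ n : ℕ, F.EvalDeg V n))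

instance : Module k (F.Eval V) := inferInstanceAs (Module k (⨁ n : ℕ, F.EvalDeg V n))

/-- The quotient map `F(n) ⊗ V^{⊗ n} → F(n) ⊗_{k S_n} V^{⊗ n}`. -/
def evalMk (n : ℕ) : F.obj (Fin n) ⊗[k] (⨂[k] _ : Fin n, V) →ₗ[k] F.EvalDeg V n :=
  (F.evalRel V n).mkQ

/-- The inclusion of a homogeneous component in `F(V)`. -/
def evalIn (n : ℕ) : F.EvalDeg V n →ₗ[k] F.Eval V := DirectSum.lof k ℕ (F.EvalDeg V) n

theorem evalMk_surjective (n : ℕ) : Function.Surjective (F.evalMk V n) :=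
  (F.evalRel V n).mkQ_surjective

theorem evalMk_symm (n : ℕ) (σ : Equiv.Perm (Fin n)) (x : F.obj (Fin n))
    (t : ⨂[k] _ : Fin n, V) : F.evalMk V n (F.map σ.symm x ⊗ₜ[k] t) =
      F.evalMk V n (x ⊗ₜ[k] PiTensorProduct.reindex k (fun _ => V) σ t) :=
  (Submodule.Quotient.eq _).mpr (Submodule.subset_span ⟨⟨σ, x, t⟩, rfl⟩)

variable {N : Type*} [AddCommGroup N] [Module k N]

/-- Maps out of `F(n) ⊗_{k S_n} V^{⊗ n}`. -/
def evalDegLift (n : ℕ) (f : F.obj (Fin n) ⊗[k] (⨂[k] _ : Fin n, V) →ₗ[k] N)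
    (h : ∀ (σ : Equiv.Perm (Fin n)) (x : F.obj (Fin n)) (t : ⨂[k] _ : Fin n, V),
      f (F.map σ.symm x ⊗ₜ[k] t) = f (x ⊗ₜ[k] PiTensorProduct.reindex k (fun _ => V) σ t)) :
    F.EvalDeg V n →ₗ[k] N :=
  Submodule.liftQ (F.evalRel V n) f (by
    rw [evalRel, Submodule.span_le]
    rintro _ ⟨⟨σ, x, t⟩, rfl⟩
    rw [SetLike.mem_coe, LinearMap.mem_ker, map_sub, sub_eq_zero]
    exact h σ x t)

theorem evalDegLift_mk (n : ℕ) (f : F.obj (Fin n) ⊗[k] (⨂[k] _ : Fin n, V) →ₗ[k] N)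
    (h : ∀ (σ : Equiv.Perm (Fin n)) (x : F.obj (Fin n)) (t : ⨂[k] _ : Fin n, V),
      f (F.map σ.symm x ⊗ₜ[k] t) = f (x ⊗ₜ[k] PiTensorProduct.reindex k (fun _ => V) σ t))
    (a : F.obj (Fin n) ⊗[k] (⨂[k] _ : Fin n, V)) :
    F.evalDegLift V n f h (F.evalMk V n a) = f a := rfl

/-- Maps out of `F(V)`. -/
def evalLift (f : ∀ n, F.EvalDeg V n →ₗ[k] N) : F.Eval V →ₗ[k] N :=
  DirectSum.toModule k ℕ N f

theorem evalLift_in (f : ∀ n, F.EvalDeg V n →ₗ[k] N) (n : ℕ) (a : F.EvalDeg V n) :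
    F.evalLift V f (F.evalIn V n a) = f n a :=
  DirectSum.toModule_lof k n a

variable {V} {W : Type v} [AddCommGroup W] [Module k W]

/-- Functoriality of `F(V)` in `V`. -/
def evalMap (f : V →ₗ[k] W) : F.Eval V →ₗ[k] F.Eval W :=
  F.evalLift V fun n => F.evalIn W n ∘ₗ F.evalDegLift V n
    (F.evalMk W n ∘ₗ (PiTensorProduct.map fun _ : Fin n => f).lTensor (F.obj (Fin n))) (by
      intro σ x t
      simp only [LinearMap.comp_apply, LinearMap.lTensor_tmul]
      rw [F.evalMk_symm, ← PiTensorProduct.map_reindex (fun _ : Fin n => f) σ t])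

variable {F} {G : Species.{u, w} k} (V) in
/-- Functoriality of `F(V)` in `F`. -/
def Hom.eval (η : Hom F G) : F.Eval V →ₗ[k] G.Eval V :=
  F.evalLift V fun n => G.evalIn V n ∘ₗ F.evalDegLift V n
    (G.evalMk V n ∘ₗ (η.app (Fin n)).rTensor (⨂[k] _ : Fin n, V)) (by
      intro σ x t
      simp only [LinearMap.comp_apply, LinearMap.rTensor_tmul]
      rw [η.naturality, G.evalMk_symm])

variable (V)

/-- The class in `F(V)` of an element of `F(I) ⊗ V^{⊗ I}`, for any finite set `I`. -/
def evT (I : Type) [Finite I] : F.obj I ⊗[k] (⨂[k] _ : I, V) →ₗ[k] F.Eval V :=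
  F.evalIn V (Nat.card I) ∘ₗ F.evalMk V (Nat.card I) ∘ₗ
    TensorProduct.map (F.map (Finite.equivFin I))
      (PiTensorProduct.reindex k (fun _ => V) (Finite.equivFin I)).toLinearMap

theorem reindex_comp {I J K : Type} (e : I ≃ J) (f : J ≃ K) (t : ⨂[k] _ : I, V) :
    PiTensorProduct.reindex k (fun _ => V) f (PiTensorProduct.reindex k (fun _ => V) e t) =
      PiTensorProduct.reindex k (fun _ => V) (e.trans f) t :=
  PiTensorProduct.reindex_reindex e f t

theorem evalMk_map (n : ℕ) (σ : Equiv.Perm (Fin n)) (x : F.obj (Fin n)) (t : ⨂[k] _ : Fin n, V) :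
    F.evalMk V n (F.map σ x ⊗ₜ[k] PiTensorProduct.reindex k (fun _ => V) σ t) =
      F.evalMk V n (x ⊗ₜ[k] t) := by
  rw [← F.evalMk_symm, ← F.map_trans, Equiv.self_trans_symm, F.map_refl]

theorem evT_eq {I : Type} [Finite I] (n : ℕ) (e : I ≃ Fin n) (x : F.obj I) (t : ⨂[k] _ : I, V) :
    F.evT V I (x ⊗ₜ t) = F.evalIn V n (F.evalMk V n
      (F.map e x ⊗ₜ[k] PiTensorProduct.reindex k (fun _ => V) e t)) := by
  obtain rfl : n = Nat.card I := (Nat.card_eq_of_equiv_fin e).symm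
  simp only [evT, LinearMap.comp_apply, TensorProduct.map_tmul, LinearEquiv.coe_coe]
  congr 1
  rw [← F.evalMk_map V _ ((Finite.equivFin I).symm.trans e), ← F.map_trans]
  rw [reindex_comp]
  simp [← Equiv.trans_assoc]

theorem evT_map {I J : Type} [Finite I] [Finite J] (e : I ≃ J) (x : F.obj I)
    (t : ⨂[k] _ : I, V) : F.evT V J (F.map e x ⊗ₜ PiTensorProduct.reindex k (fun _ => V) e t) =
      F.evT V I (x ⊗ₜ t) := by
  rw [F.evT_eq V _ (Finite.equivFin J), F.evT_eq V _ (e.trans (Finite.equivFin J)), F.map_trans]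
  rw [reindex_comp]

theorem evT_fin (n : ℕ) (x : F.obj (Fin n)) (t : ⨂[k] _ : Fin n, V) : F.evT V (Fin n) (x ⊗ₜ t) =
    F.evalIn V n (F.evalMk V n (x ⊗ₜ[k] t)) := by
  rw [F.evT_eq V n (Equiv.refl _), F.map_refl, PiTensorProduct.reindex_refl]
  rfl

variable {V}

/-- The class in `F(V)` of an element of `F(I)` with the entries labelled by `v : I → V`. -/
def ev {I : Type} [Finite I] (x : F.obj I) (v : I → V) : F.Eval V :=
  F.evT V I (x ⊗ₜ PiTensorProduct.tprod k v)

theorem ev_map {I J : Type} [Finite I] [Finite J] (e : I ≃ J) (x : F.obj I) (v : J → V) :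
    F.ev (F.map e x) v = F.ev x (v ∘ e) := by
  rw [ev, ev, ← F.evT_map V e, PiTensorProduct.reindex_tprod]
  simp

theorem ev_add {I : Type} [Finite I] (x y : F.obj I) (v : I → V) :
    F.ev (x + y) v = F.ev x v + F.ev y v := by
  rw [ev, TensorProduct.add_tmul, map_add]; rfl

theorem ev_neg {I : Type} [Finite I] (x : F.obj I) (v : I → V) :
    F.ev (-x) v = -F.ev x v := by
  rw [ev, TensorProduct.neg_tmul, map_neg]; rfl

theorem eval_induction {p : F.Eval V → Prop}
    (hev : ∀ (n : ℕ) (x : F.obj (Fin n)) (v : Fin n → V), p (F.ev x v))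
    (hadd : ∀ x y, p x → p y → p (x + y)) (z : F.Eval V) : p z := by
  have h0 : p 0 := by
    have := hev 0 0 (fun _ => 0)
    rwa [ev, TensorProduct.zero_tmul, map_zero] at this
  refine DirectSum.induction_on (motive := p) z h0 ?_ hadd
  · intro n y
    obtain ⟨y, rfl⟩ := F.evalMk_surjective V n y
    change p (F.evalIn V n _)
    induction y using TensorProduct.induction_on with
    | zero => rw [map_zero, map_zero]; exact h0
    | add x y hx hy => rw [map_add, map_add]; exact hadd _ _ hx hy
    | tmul x t =>
      induction t using PiTensorProduct.induction_on with
      | add s t hs ht => rw [TensorProduct.tmul_add, map_add, map_add]; exact hadd _ _ hs ht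
      | smul_tprod r v =>
        rw [← TensorProduct.smul_tmul, ← evT_fin]
        exact hev n (r • x) v

theorem evalMap_ev {I : Type} [Finite I] (f : V →ₗ[k] W) (x : F.obj I) (v : I → V) :
    F.evalMap f (F.ev x v) = F.ev x (f ∘ v) := by
  rw [ev, F.evT_eq V _ (Finite.equivFin I), evalMap, evalLift_in, ev,
    F.evT_eq W _ (Finite.equivFin I), LinearMap.comp_apply, evalDegLift_mk, LinearMap.comp_apply,
    LinearMap.lTensor_tmul,
    PiTensorProduct.reindex_tprod, PiTensorProduct.map_tprod, PiTensorProduct.reindex_tprod]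
  rfl

end Eval

end Species

/-! ## Twisted Lie algebras -/

/-- A twisted Lie algebra: a Lie algebra in the category of species with the Cauchy product. The
bracket is a family of equivariant maps `g(I) ⊗ g(J) → g(I ⊔ J)`. -/
structure TwistedLieAlgebra (k : Type u) [Field k] extends Species.{u, w} k where
  bracket : (I J : Type) → [Finite I] → [Finite J] → obj I →ₗ[k] obj J →ₗ[k] obj (I ⊕ J)
  bracket_map : ∀ {I I' J J' : Type} [Finite I] [Finite I'] [Finite J] [Finite J'] (e : I ≃ I')
    (f : J ≃ J') (x : obj I) (y : obj J),
    bracket I' J' (map e x) (map f y) = map (e.sumCongr f) (bracket I J x y)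
  bracket_skew : ∀ {I J : Type} [Finite I] [Finite J] (x : obj I) (y : obj J),
    bracket J I y x = -map (Equiv.sumComm I J) (bracket I J x y)
  jacobi : ∀ {I J K : Type} [Finite I] [Finite J] [Finite K] (x : obj I) (y : obj J) (z : obj K),
    bracket I (J ⊕ K) x (bracket J K y z) =
      map (Equiv.sumAssoc I J K) (bracket (I ⊕ J) K (bracket I J x y) z) +
      map (((Equiv.sumAssoc J I K).symm.trans
        ((Equiv.sumComm J I).sumCongr (Equiv.refl K))).trans (Equiv.sumAssoc I J K))
        (bracket J (I ⊕ K) y (bracket I K x z))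

namespace TwistedLieAlgebra

variable {k : Type u} [Field k] (g : TwistedLieAlgebra.{u, w} k) (V : Type v) [AddCommGroup V]
  [Module k V]

/-- The bracket `F(I) ⊗ V^{⊗ I} × F(J) ⊗ V^{⊗ J} → g(V)`, given by the bracket of `g` and the
concatenation of tensors. -/
def evalBracketAux (I J : Type) [Finite I] [Finite J] :
    (g.obj I ⊗[k] (⨂[k] _ : I, V)) →ₗ[k] (g.obj J ⊗[k] (⨂[k] _ : J, V)) →ₗ[k]
      g.toSpecies.Eval V :=
  (TensorProduct.map₂ (g.bracket I J) (TensorProduct.curry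
    (PiTensorProduct.tmulEquiv k V (ι := I) (ι₂ := J)).toLinearMap)).compr₂
    (g.toSpecies.evT V (I ⊕ J))

theorem evalBracketAux_tprod {I J : Type} [Finite I] [Finite J] (x : g.obj I) (y : g.obj J)
    (v : I → V) (w : J → V) : g.evalBracketAux V I J (x ⊗ₜ PiTensorProduct.tprod k v)
      (y ⊗ₜ PiTensorProduct.tprod k w) = g.toSpecies.ev (g.bracket I J x y) (Sum.elim v w) := by
  simp [evalBracketAux, Species.ev]

theorem evalBracketAux_rel {I J I' J' : Type} [Finite I] [Finite J] [Finite I'] [Finite J']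
    (e : I ≃ I') (f : J ≃ J')
    (x : g.obj I) (y : g.obj J) (t : ⨂[k] _ : I, V) (s : ⨂[k] _ : J, V) :
    g.evalBracketAux V I' J' (g.map e x ⊗ₜ PiTensorProduct.reindex k (fun _ => V) e t)
      (g.map f y ⊗ₜ PiTensorProduct.reindex k (fun _ => V) f s) =
    g.evalBracketAux V I J (x ⊗ₜ t) (y ⊗ₜ s) := by
  induction t using PiTensorProduct.induction_on with
  | add a b ha hb =>
    simp only [map_add, TensorProduct.tmul_add, LinearMap.add_apply, ha, hb]
  | smul_tprod r v =>
    induction s using PiTensorProduct.induction_on with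
    | add a b ha hb => simp only [map_add, TensorProduct.tmul_add, ha, hb]
    | smul_tprod r' w =>
      simp only [map_smul, TensorProduct.tmul_smul, LinearMap.smul_apply]
      congr 2
      rw [PiTensorProduct.reindex_tprod, PiTensorProduct.reindex_tprod, evalBracketAux_tprod,
        evalBracketAux_tprod, g.bracket_map, Species.ev_map]
      congr 1
      funext i
      rcases i with i | i
      · exact congrArg v (e.symm_apply_apply i)
      · exact congrArg w (f.symm_apply_apply i)

/-- An auxiliary map for `evalBracketDeg`: passing to the quotient in the second argument. -/
def evalBracketHalf (n m : ℕ) : (g.obj (Fin n) ⊗[k] (⨂[k] _ : Fin n, V)) →ₗ[k]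
    g.toSpecies.EvalDeg V m →ₗ[k] g.toSpecies.Eval V :=
  (g.toSpecies.evalDegLift V m (g.evalBracketAux V (Fin n) (Fin m)).flip (by
    intro σ y s
    refine TensorProduct.ext' fun x t => ?_
    have h := g.evalBracketAux_rel V (Equiv.refl _) σ x (g.map σ.symm y) t s
    rw [PiTensorProduct.reindex_refl, g.map_refl, ← g.map_trans, Equiv.symm_trans_self,
      g.map_refl] at h
    exact h.symm)).flip

theorem evalBracketHalf_mk (n m : ℕ) (a : g.obj (Fin n) ⊗[k] (⨂[k] _ : Fin n, V))
    (b : g.obj (Fin m) ⊗[k] (⨂[k] _ : Fin m, V)) :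
    g.evalBracketHalf V n m a (g.toSpecies.evalMk V m b) =
      g.evalBracketAux V (Fin n) (Fin m) a b := rfl

/-- The bracket of `g(V)` on homogeneous components. -/
def evalBracketDeg (n m : ℕ) : g.toSpecies.EvalDeg V n →ₗ[k] g.toSpecies.EvalDeg V m →ₗ[k]
    g.toSpecies.Eval V :=
  g.toSpecies.evalDegLift V n (g.evalBracketHalf V n m) (by
    intro σ x t
    refine LinearMap.ext fun b => ?_
    obtain ⟨b, rfl⟩ := g.toSpecies.evalMk_surjective V m b
    rw [evalBracketHalf_mk, evalBracketHalf_mk]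
    refine DFunLike.congr_fun (f := g.evalBracketAux V (Fin n) (Fin m) _) ?_ b
    refine TensorProduct.ext' fun y s => ?_
    have h := g.evalBracketAux_rel V σ (Equiv.refl _) (g.map σ.symm x) y t s
    rw [PiTensorProduct.reindex_refl, g.map_refl, ← g.map_trans, Equiv.symm_trans_self,
      g.map_refl] at h
    exact h.symm)

theorem evalBracketDeg_mk (n m : ℕ) (a : g.obj (Fin n) ⊗[k] (⨂[k] _ : Fin n, V))
    (b : g.obj (Fin m) ⊗[k] (⨂[k] _ : Fin m, V)) :
    g.evalBracketDeg V n m (g.toSpecies.evalMk V n a) (g.toSpecies.evalMk V m b) =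
      g.evalBracketAux V (Fin n) (Fin m) a b := rfl

/-- The bracket of `g(V)`. -/
def evalBracket : g.toSpecies.Eval V →ₗ[k] g.toSpecies.Eval V →ₗ[k] g.toSpecies.Eval V :=
  g.toSpecies.evalLift V fun n => LinearMap.flip (g.toSpecies.evalLift V fun m =>
    (g.evalBracketDeg V n m).flip)

/-- The Lie algebra `g(V)`, the value on `V` of the analytic functor underlying `g`. -/
def LieEval : Type (max u v w) := g.toSpecies.Eval V

instance : AddCommGroup (g.LieEval V) := inferInstanceAs (AddCommGroup (g.toSpecies.Eval V))

instance : Module k (g.LieEval V) := inferInstanceAs (Module k (g.toSpecies.Eval V))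

variable {V} in
theorem evalBracket_ev {I J : Type} [Finite I] [Finite J] (x : g.obj I) (y : g.obj J)
    (v : I → V) (w : J → V) :
    g.evalBracket V (g.toSpecies.ev x v) (g.toSpecies.ev y w) =
      g.toSpecies.ev (g.bracket I J x y) (Sum.elim v w) := by
  rw [← g.evalBracketAux_tprod, ← g.evalBracketAux_rel V (Finite.equivFin I) (Finite.equivFin J)]
  rw [Species.ev, Species.ev, g.evT_eq V _ (Finite.equivFin I), g.evT_eq V _ (Finite.equivFin J),
    evalBracket, Species.evalLift_in, LinearMap.flip_apply, Species.evalLift_in,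
    LinearMap.flip_apply, evalBracketDeg_mk]

variable {V} in
theorem evalBracket_skew (x y : g.toSpecies.Eval V) :
    g.evalBracket V x y = -g.evalBracket V y x := by
  induction x using Species.eval_induction with
  | hadd a b ha hb => simp only [map_add, LinearMap.add_apply, ha, hb]; abel
  | hev n x v =>
    induction y using Species.eval_induction with
    | hadd a b ha hb => simp only [map_add, LinearMap.add_apply, ha, hb]; abel
    | hev m y w =>
      rw [evalBracket_ev, evalBracket_ev, g.bracket_skew x y, Species.ev_neg, Species.ev_map,
        neg_neg]
      congr 1
      funext i
      rcases i with i | i <;> rfl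

variable {V} in
theorem evalBracket_jacobi (x y z : g.toSpecies.Eval V) :
    g.evalBracket V x (g.evalBracket V y z) = g.evalBracket V (g.evalBracket V x y) z +
      g.evalBracket V y (g.evalBracket V x z) := by
  induction x using Species.eval_induction with
  | hadd a b ha hb => simp only [map_add, LinearMap.add_apply, ha, hb]; abel
  | hev n x v =>
    induction y using Species.eval_induction with
    | hadd a b ha hb => simp only [map_add, LinearMap.add_apply, ha, hb]; abel
    | hev m y w =>
      induction z using Species.eval_induction with
      | hadd a b ha hb => simp only [map_add, ha, hb]; abel
      | hev l z u =>
        simp only [evalBracket_ev]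
        rw [g.jacobi, Species.ev_add, Species.ev_map, Species.ev_map]
        congr 2
        · funext i
          rcases i with (i | i) | i <;> rfl
        · funext i
          rcases i with i | i | i <;> rfl

variable [CharZero k]

instance : LieRing (g.LieEval V) where
  bracket := fun x y => g.evalBracket V x y
  add_lie x y z := LinearMap.map_add₂ (g.evalBracket V) x y z
  lie_add x y z := map_add (g.evalBracket V x) y z
  lie_self x := eq_zero_of_eq_neg_self k (g.evalBracket_skew x x)
  leibniz_lie x y z := g.evalBracket_jacobi x y z

instance : LieAlgebra k (g.LieEval V) where
  lie_smul t x y := map_smul (g.evalBracket V x) t y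

variable {V} {W : Type v} [AddCommGroup W] [Module k W]

theorem evalMap_evalBracket (f : V →ₗ[k] W) (x y : g.toSpecies.Eval V) :
    g.toSpecies.evalMap f (g.evalBracket V x y) =
      g.evalBracket W (g.toSpecies.evalMap f x) (g.toSpecies.evalMap f y) := by
  induction x using Species.eval_induction with
  | hadd a b ha hb => simp only [map_add, LinearMap.add_apply, ha, hb]
  | hev n x v =>
    induction y using Species.eval_induction with
    | hadd a b ha hb => simp only [map_add, ha, hb]
    | hev m y w =>
      simp only [evalBracket_ev, Species.evalMap_ev]
      congr 1
      funext i
      rcases i with i | i <;> rfl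

/-- Functoriality of the Lie algebra `g(V)` in `V`. -/
def lieEvalMap (f : V →ₗ[k] W) : g.LieEval V →ₗ⁅k⁆ g.LieEval W where
  toLinearMap := g.toSpecies.evalMap f
  map_lie' {x y} := g.evalMap_evalBracket f x y

end TwistedLieAlgebra

/-! ## Homology of Lie algebras -/

namespace ChevalleyEilenberg

/-- The extension of a permutation of `{1, …, n}` to `{0, …, n}` fixing `0`. -/
def extPerm {n : ℕ} (π : Equiv.Perm (Fin n)) : Equiv.Perm (Fin (n + 1)) :=
  Equiv.Perm.decomposeFin.symm (0, π)

@[simp] theorem extPerm_zero {n : ℕ} (π : Equiv.Perm (Fin n)) : extPerm π 0 = 0 := by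
  simp [extPerm]

@[simp] theorem extPerm_succ {n : ℕ} (π : Equiv.Perm (Fin n)) (i : Fin n) :
    extPerm π i.succ = (π i).succ := by
  simp [extPerm]

@[simp] theorem sign_extPerm {n : ℕ} (π : Equiv.Perm (Fin n)) :
    Equiv.Perm.sign (extPerm π) = Equiv.Perm.sign π := by
  simp [extPerm]

@[simp] theorem extPerm_symm_zero {n : ℕ} (π : Equiv.Perm (Fin n)) : (extPerm π).symm 0 = 0 := by
  rw [Equiv.symm_apply_eq, extPerm_zero]

@[simp] theorem extPerm_symm_succ {n : ℕ} (π : Equiv.Perm (Fin n)) (i : Fin n) :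
    (extPerm π).symm i.succ = (π.symm i).succ := by
  rw [Equiv.symm_apply_eq, extPerm_succ, Equiv.apply_symm_apply]

theorem exists_extPerm {n : ℕ} (ρ : Equiv.Perm (Fin (n + 1))) (h : ρ 0 = 0) :
    ∃ π, ρ = extPerm π := by
  obtain ⟨⟨p, π⟩, rfl⟩ := Equiv.Perm.decomposeFin.symm.surjective ρ
  rw [Equiv.Perm.decomposeFin_symm_apply_zero] at h
  subst h
  exact ⟨π, rfl⟩

/-- The permutation which moves the `i`-th factor to the front, the factor `i.succAbove j`
(that is, the `j`-th one of those remaining) to the second place, and keeps the other factors in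
order. Its sign is `(-1)^(i+j)`. -/
def pairPerm {n : ℕ} (i : Fin (n + 2)) (j : Fin (n + 1)) : Equiv.Perm (Fin (n + 2)) :=
  extPerm j.cycleRange * i.cycleRange

theorem sign_pairPerm {n : ℕ} (i : Fin (n + 2)) (j : Fin (n + 1)) :
    Equiv.Perm.sign (pairPerm i j) = (-1) ^ (i + j : ℕ) := by
  rw [pairPerm, map_mul, sign_extPerm, Fin.sign_cycleRange, Fin.sign_cycleRange, pow_add, mul_comm]

theorem pairPerm_symm_zero {n : ℕ} (i : Fin (n + 2)) (j : Fin (n + 1)) :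
    (pairPerm i j).symm 0 = i := by
  change i.cycleRange.symm ((extPerm j.cycleRange).symm 0) = i
  rw [extPerm_symm_zero, Fin.cycleRange_symm_zero]

theorem pairPerm_symm_one {n : ℕ} (i : Fin (n + 2)) (j : Fin (n + 1)) :
    (pairPerm i j).symm 1 = i.succAbove j := by
  change i.cycleRange.symm ((extPerm j.cycleRange).symm (Fin.succ 0)) = _
  rw [extPerm_symm_succ, Fin.cycleRange_symm_zero, Fin.cycleRange_symm_succ]

theorem pairPerm_symm_succ_succ {n : ℕ} (i : Fin (n + 2)) (j : Fin (n + 1)) (l : Fin n) :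
    (pairPerm i j).symm l.succ.succ = i.succAbove (j.succAbove l) := by
  change i.cycleRange.symm ((extPerm j.cycleRange).symm l.succ.succ) = _
  rw [extPerm_symm_succ, Fin.cycleRange_symm_succ, Fin.cycleRange_symm_succ]

/-- The pairs `(i, j)` with `i ≤ j`; they stand for the pairs of positions `i < j + 1`. -/
def pairs (n : ℕ) : Finset (Fin (n + 2) × Fin (n + 1)) :=
  Finset.univ.filter fun p => p.1 ≤ p.2.castSucc

section sums

variable {A : Type*} [AddCommGroup A]

theorem sum_pairs {n : ℕ} (f : Fin (n + 2) → Fin (n + 2) → A) :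
    ∑ p ∈ pairs n, f p.1 (p.1.succAbove p.2) =
      ∑ p ∈ (Finset.univ : Finset (Fin (n + 2) × Fin (n + 2))) with p.1 < p.2, f p.1 p.2 := by
  refine Finset.sum_bij (fun p _ => (p.1, p.1.succAbove p.2)) ?_ ?_ ?_ ?_
  · rintro ⟨i, j⟩ h
    simp only [pairs, Finset.mem_filter, Finset.mem_univ, true_and] at h ⊢
    rw [Fin.succAbove_of_le_castSucc _ _ h]
    exact lt_of_le_of_lt h Fin.castSucc_lt_succ
  · rintro ⟨i, j⟩ h ⟨i', j'⟩ h' e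
    simp only [Prod.mk.injEq] at e
    obtain ⟨rfl, e⟩ := e
    rw [Fin.succAbove_right_injective e]
  · rintro ⟨a, b⟩ h
    simp only [Finset.mem_filter, Finset.mem_univ, true_and] at h
    obtain ⟨j, hj⟩ := Fin.exists_succAbove_eq (ne_of_gt h)
    refine ⟨(a, j), ?_, by simp [hj]⟩
    simp only [pairs, Finset.mem_filter, Finset.mem_univ, true_and]
    by_contra hc
    rw [Fin.succAbove_of_castSucc_lt _ _ (not_le.mp hc)] at hj
    rw [← hj] at h
    exact hc h.le
  · rintro ⟨i, j⟩ h
    rfl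

theorem two_nsmul_sum_lt {m : ℕ} (f : Fin m → Fin m → A) (hf : ∀ a b, f a b = f b a) :
    2 • ∑ p ∈ (Finset.univ : Finset (Fin m × Fin m)) with p.1 < p.2, f p.1 p.2 =
      ∑ p ∈ (Finset.univ : Finset (Fin m × Fin m)) with p.1 ≠ p.2, f p.1 p.2 := by
  have h1 : ∑ p ∈ (Finset.univ : Finset (Fin m × Fin m)) with p.1 < p.2, f p.1 p.2 =
      ∑ p ∈ (Finset.univ : Finset (Fin m × Fin m)) with p.2 < p.1, f p.1 p.2 := by
    refine Finset.sum_bij (fun p _ => p.swap) ?_ ?_ ?_ ?_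
    · rintro ⟨a, b⟩ h; simpa using h
    · rintro ⟨a, b⟩ _ ⟨c, d⟩ _ h; simpa [and_comm] using h
    · rintro ⟨a, b⟩ h; exact ⟨(b, a), by simpa using h, rfl⟩
    · rintro ⟨a, b⟩ h; exact hf a b
  rw [two_nsmul]
  nth_rewrite 2 [h1]
  rw [← Finset.sum_union]
  · congr 1
    ext ⟨a, b⟩
    simp [lt_or_lt_iff_ne]
  · rw [Finset.disjoint_filter]
    rintro ⟨a, b⟩ _ h h'
    exact lt_asymm h h'

theorem sum_ne_perm {m : ℕ} (f : Fin m → Fin m → A) (τ : Equiv.Perm (Fin m)) :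
    ∑ p ∈ (Finset.univ : Finset (Fin m × Fin m)) with p.1 ≠ p.2, f (τ p.1) (τ p.2) =
      ∑ p ∈ (Finset.univ : Finset (Fin m × Fin m)) with p.1 ≠ p.2, f p.1 p.2 := by
  rw [Finset.sum_filter, Finset.sum_filter]
  rw [← Equiv.sum_comp (Equiv.prodCongr τ τ) (fun p => if p.1 ≠ p.2 then f p.1 p.2 else 0)]
  simp

theorem sum_pairs_perm (k : Type u) [Field k] [CharZero k] [Module k A] {n : ℕ} (G : Equiv.Perm (Fin (n + 2)) → A)
    (hswap : ∀ σ, G (Equiv.swap 0 1 * σ) = G σ)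
    (hext : ∀ (π : Equiv.Perm (Fin n)) σ, G (extPerm (extPerm π) * σ) = G σ)
    (τ : Equiv.Perm (Fin (n + 2))) :
    ∑ p ∈ pairs n, G (pairPerm p.1 p.2 * τ) = ∑ p ∈ pairs n, G (pairPerm p.1 p.2) := by
  have key : ∀ σ σ' : Equiv.Perm (Fin (n + 2)), σ.symm 0 = σ'.symm 0 → σ.symm 1 = σ'.symm 1 →
      G σ = G σ' := by
    intro σ σ' h0 h1
    obtain ⟨π, hπ⟩ := exists_extPerm (σ * σ'⁻¹) (by
      change σ (σ'.symm 0) = 0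
      rw [← h0, Equiv.apply_symm_apply])
    obtain ⟨π', rfl⟩ := exists_extPerm π (by
      have : (σ * σ'⁻¹) 1 = 1 := by
        change σ (σ'.symm 1) = 1
        rw [← h1, Equiv.apply_symm_apply]
      rw [hπ, ← Fin.succ_zero_eq_one, extPerm_succ] at this
      exact Fin.succ_injective _ this)
    rw [← hext π' σ', ← hπ, inv_mul_cancel_right]
  classical
  let H : Fin (n + 2) → Fin (n + 2) → A := fun a b =>
    if h : ∃ σ : Equiv.Perm (Fin (n + 2)), σ.symm 0 = a ∧ σ.symm 1 = b then G h.choose else 0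
  have hH : ∀ σ, H (σ.symm 0) (σ.symm 1) = G σ := by
    intro σ
    have h : ∃ σ' : Equiv.Perm (Fin (n + 2)), σ'.symm 0 = σ.symm 0 ∧ σ'.symm 1 = σ.symm 1 :=
      ⟨σ, rfl, rfl⟩
    simp only [H, dif_pos h]
    exact key _ _ h.choose_spec.1 h.choose_spec.2
  have hsymm : ∀ a b, H a b = H b a := by
    intro a b
    by_cases h : ∃ σ : Equiv.Perm (Fin (n + 2)), σ.symm 0 = a ∧ σ.symm 1 = b
    · obtain ⟨σ, rfl, rfl⟩ := h
      rw [hH, ← hswap, ← hH]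
      simp [Equiv.Perm.mul_def]
    · have h' : ¬ ∃ σ : Equiv.Perm (Fin (n + 2)), σ.symm 0 = b ∧ σ.symm 1 = a := by
        rintro ⟨σ, h0, h1⟩
        exact h ⟨Equiv.swap 0 1 * σ, by simp [Equiv.Perm.mul_def, h1],
          by simp [Equiv.Perm.mul_def, h0]⟩
      simp only [H, dif_neg h, dif_neg h']
  have e1 : ∀ τ : Equiv.Perm (Fin (n + 2)), ∑ p ∈ pairs n, G (pairPerm p.1 p.2 * τ) =
      ∑ p ∈ (Finset.univ : Finset (Fin (n + 2) × Fin (n + 2))) with p.1 < p.2,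
        H (τ.symm p.1) (τ.symm p.2) := by
    intro τ
    rw [← sum_pairs (fun a b => H (τ.symm a) (τ.symm b))]
    refine Finset.sum_congr rfl fun p _ => ?_
    rw [← hH]
    change H (τ.symm ((pairPerm p.1 p.2).symm 0)) (τ.symm ((pairPerm p.1 p.2).symm 1)) = _
    rw [pairPerm_symm_zero, pairPerm_symm_one]
  have e2 := e1 1
  simp only [mul_one] at e2
  have h2 : 2 • ∑ p ∈ pairs n, G (pairPerm p.1 p.2 * τ) =
      2 • ∑ p ∈ pairs n, G (pairPerm p.1 p.2) := by
    rw [e1, e2, two_nsmul_sum_lt (fun a b => H (τ.symm a) (τ.symm b)) (fun a b => hsymm _ _),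
      sum_ne_perm H τ.symm]
    exact (two_nsmul_sum_lt H hsymm).symm
  rw [← sub_eq_zero, ← nsmul_sub, ← Nat.cast_smul_eq_nsmul k] at h2
  exact sub_eq_zero.mp ((smul_eq_zero.mp h2).resolve_left (by norm_num))

end sums

/-- A multilinear map which transforms by the sign under permutations is alternating. -/
def alternatingOfPerm {k : Type u} [Field k] [CharZero k] {M N : Type*} [AddCommGroup M]
    [Module k M] [AddCommGroup N] [Module k N] {n : ℕ}
    (f : MultilinearMap k (fun _ : Fin n => M) N)
    (h : ∀ (τ : Equiv.Perm (Fin n)) (x : Fin n → M), f (x ∘ τ) = (Equiv.Perm.sign τ : ℤ) • f x) :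
    M [⋀^Fin n]→ₗ[k] N :=
  { f with
    map_eq_zero_of_eq' := by
      intro x i j hx hij
      have h1 := h (Equiv.swap i j) x
      have h2 : x ∘ Equiv.swap i j = x := by
        funext l
        rcases eq_or_ne l i with rfl | hi
        · simp [hx]
        · rcases eq_or_ne l j with rfl | hj
          · simp [hx]
          · simp [Equiv.swap_apply_of_ne_of_ne hi hj]
      rw [h2, Equiv.Perm.sign_swap hij] at h1
      simp only [Units.val_neg, Units.val_one, neg_smul, one_smul] at h1
      exact eq_zero_of_eq_neg_self k h1 }

end ChevalleyEilenberg

namespace ChevalleyEilenberg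

section homology

variable {k : Type u} [Field k] {B : Type v} [AddCommGroup B] [Module k B] {BB : Type w}
  [AddCommGroup BB] [Module k BB]

/-- The quotient of the cycles `Z` by the boundaries `R`. -/
abbrev HomologyQuot (Z R : Submodule k B) : Type v := Z ⧸ R.submoduleOf Z

/-- The map induced on homology by a map preserving cycles and boundaries. -/
def quotMap {Z R : Submodule k B} {Z' R' : Submodule k BB} (f : B →ₗ[k] BB)
    (hZ : ∀ x ∈ Z, f x ∈ Z') (hR : ∀ x ∈ R, f x ∈ R') : HomologyQuot Z R →ₗ[k] HomologyQuot Z' R' :=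
  Submodule.mapQ _ _ (f.restrict hZ) (fun x hx => hR x.1 hx)

end homology

section lie

variable (k : Type u) [Field k] [CharZero k] (L : Type v) [LieRing L] [LieAlgebra k L]

/-- The multilinear map `(y_0, y_1, y_2, …) ↦ [y_0, y_1] ∧ y_2 ∧ ⋯`. -/
def bracketFirst (n : ℕ) : MultilinearMap k (fun _ : Fin (n + 2) => L) (⋀[k]^(n + 1) L) :=
  LinearMap.uncurryLeft (M := fun _ : Fin (n + 2) => L)
    ((multilinearCurryLeftEquiv k (fun _ : Fin (n + 1) => L) (⋀[k]^(n + 1) L)).symm.toLinearMap ∘ₗ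
      (LieModule.toEnd k L L : L →ₗ[k] L →ₗ[k] L).compr₂
        (exteriorPower.ιMulti k (n + 1) (M := L)).toMultilinearMap.curryLeft)

variable {L}

theorem bracketFirst_apply (n : ℕ) (y : Fin (n + 2) → L) : bracketFirst k L n y =
    exteriorPower.ιMulti k (n + 1) (Fin.cons ⁅y 0, y 1⁆ (fun l => y l.succ.succ)) := rfl

theorem bracketFirst_swap (n : ℕ) (y : Fin (n + 2) → L) :
    bracketFirst k L n (y ∘ Equiv.swap 0 1) = -bracketFirst k L n y := by
  rw [bracketFirst_apply, bracketFirst_apply]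
  have h := (exteriorPower.ιMulti k (n + 1) (M := L)).toMultilinearMap.cons_smul
    (fun l : Fin n => y l.succ.succ) (-1) ⁅y 0, y 1⁆
  rw [neg_one_smul, neg_one_smul, lie_skew] at h
  refine Eq.trans ?_ h
  have h3 : ∀ l : Fin n, Equiv.swap (0 : Fin (n + 2)) 1 l.succ.succ = l.succ.succ := fun l =>
    Equiv.swap_apply_of_ne_of_ne (Fin.succ_ne_zero _) (by
      rw [← Fin.succ_zero_eq_one]; exact fun h => Fin.succ_ne_zero _ (Fin.succ_injective _ h))
  simp only [Function.comp_apply, Equiv.swap_apply_left, Equiv.swap_apply_right, h3]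
  rfl

theorem bracketFirst_ext (n : ℕ) (π : Equiv.Perm (Fin n)) (y : Fin (n + 2) → L) :
    bracketFirst k L n (y ∘ extPerm (extPerm π)) =
      (Equiv.Perm.sign π : ℤ) • bracketFirst k L n y := by
  rw [bracketFirst_apply, bracketFirst_apply]
  have h := (exteriorPower.ιMulti k (n + 1) (M := L)).map_perm
    (Fin.cons ⁅y 0, y 1⁆ (fun l => y l.succ.succ)) (extPerm π)
  rw [sign_extPerm] at h
  refine Eq.trans ?_ h
  congr 1
  funext l
  refine Fin.cases ?_ (fun l => ?_) l
  · have h1 : extPerm (extPerm π) 1 = 1 := by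
      rw [← Fin.succ_zero_eq_one, extPerm_succ, extPerm_zero]
    simp [h1]
  · simp

/-- The multilinear map underlying the Chevalley-Eilenberg differential. -/
def dMulti (n : ℕ) : MultilinearMap k (fun _ : Fin (n + 2) => L) (⋀[k]^(n + 1) L) :=
  ∑ p ∈ pairs n, ((-1) ^ (p.1 + p.2 : ℕ) : ℤ) •
    (bracketFirst k L n).domDomCongr (pairPerm p.1 p.2).symm

theorem dMulti_eq (n : ℕ) (x : Fin (n + 2) → L) : dMulti k n x =
    ∑ p ∈ pairs n, (Equiv.Perm.sign (pairPerm p.1 p.2) : ℤ) •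
      bracketFirst k L n (x ∘ (pairPerm p.1 p.2).symm) := by
  rw [dMulti, sum_apply]
  refine Finset.sum_congr rfl fun p _ => ?_
  rw [sign_pairPerm]
  simp [Function.comp_def]

theorem extPerm_symm {n : ℕ} (π : Equiv.Perm (Fin n)) : (extPerm π).symm = extPerm π.symm := by
  ext1 i
  refine Fin.cases ?_ (fun i => ?_) i
  · rw [extPerm_symm_zero, extPerm_zero]
  · rw [extPerm_symm_succ, extPerm_succ]

theorem dMulti_perm (n : ℕ) (τ : Equiv.Perm (Fin (n + 2))) (x : Fin (n + 2) → L) :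
    dMulti k n (x ∘ τ) = (Equiv.Perm.sign τ : ℤ) • dMulti k n x := by
  have h := sum_pairs_perm k (fun σ : Equiv.Perm (Fin (n + 2)) => (Equiv.Perm.sign σ : ℤ) •
    bracketFirst k L n (x ∘ σ.symm)) ?_ ?_ τ.symm
  · rw [dMulti_eq, dMulti_eq, ← h, Finset.smul_sum]
    refine Finset.sum_congr rfl fun p _ => ?_
    rw [smul_smul]
    congr 1
    rw [map_mul, Equiv.Perm.sign_symm, Units.val_mul, mul_comm, mul_assoc, Int.units_coe_mul_self,
      mul_one]
  · intro σ
    rw [map_mul, Equiv.Perm.sign_swap Fin.zero_ne_one]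
    have := bracketFirst_swap k n (x ∘ σ.symm)
    have e : (x ∘ (Equiv.swap 0 1 * σ).symm) = (x ∘ σ.symm) ∘ Equiv.swap 0 1 := by
      funext i; simp [Equiv.Perm.mul_def]
    rw [e, this]
    simp
  · intro π σ
    have := bracketFirst_ext k n π.symm (x ∘ σ.symm)
    have e2 : extPerm (extPerm π.symm) = (extPerm (extPerm π)).symm := by
      rw [extPerm_symm, extPerm_symm]
    have e : (x ∘ (extPerm (extPerm π) * σ).symm) = (x ∘ σ.symm) ∘ extPerm (extPerm π.symm) := by
      rw [e2]; rfl
    rw [e, this, map_mul, sign_extPerm, sign_extPerm, Equiv.Perm.sign_symm, smul_smul,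
      Units.val_mul, mul_right_comm, Int.units_coe_mul_self, one_mul]

variable (L)

/-- The Chevalley-Eilenberg differential `Λ^{n+1}(L) → Λ^n(L)`. It vanishes for `n = 0`, and
`d_ιMulti` below gives the formula for `n > 0`. -/
def d : (n : ℕ) → ⋀[k]^(n + 1) L →ₗ[k] ⋀[k]^n L
  | 0 => 0
  | n + 1 => exteriorPower.alternatingMapLinearEquiv (alternatingOfPerm (dMulti k n)
      (dMulti_perm k n))

variable {L}

theorem d_ιMulti (n : ℕ) (x : Fin (n + 2) → L) :
    d k L (n + 1) (exteriorPower.ιMulti k (n + 2) x) =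
      ∑ p ∈ pairs n, ((-1) ^ (p.1 + p.2 : ℕ) : ℤ) • exteriorPower.ιMulti k (n + 1)
        (Fin.cons ⁅x p.1, x (p.1.succAbove p.2)⁆
          (fun l => x (p.1.succAbove (p.2.succAbove l)))) := by
  rw [d, exteriorPower.alternatingMapLinearEquiv_apply_ιMulti]
  change dMulti k n x = _
  rw [dMulti_eq]
  refine Finset.sum_congr rfl fun p _ => ?_
  rw [sign_pairPerm, bracketFirst_apply]
  simp [pairPerm_symm_zero, pairPerm_symm_one, pairPerm_symm_succ_succ]

variable (L)

/-- The cycles in the Chevalley-Eilenberg complex. -/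
def cycles : (n : ℕ) → Submodule k (⋀[k]^n L)
  | 0 => ⊤
  | n + 1 => LinearMap.ker (d k L n)

/-- The homology `H_n(L, k)` of the Lie algebra `L` with trivial coefficients: the homology of
the Chevalley-Eilenberg complex `(Λ(L), d)`. -/
abbrev LieHomology (n : ℕ) : Type (max u v) :=
  HomologyQuot (cycles k L n) (LinearMap.range (d k L n))

variable {L} {L' : Type w} [LieRing L'] [LieAlgebra k L']

theorem d_map (φ : L →ₗ⁅k⁆ L') (n : ℕ) (x : ⋀[k]^(n + 1) L) :
    d k L' n (exteriorPower.map (n + 1) (φ : L →ₗ[k] L') x) =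
      exteriorPower.map n (φ : L →ₗ[k] L') (d k L n x) := by
  rcases n with _ | n
  · simp [d]
  · suffices h : d k L' (n + 1) ∘ₗ exteriorPower.map (n + 2) (φ : L →ₗ[k] L') =
        exteriorPower.map (n + 1) (φ : L →ₗ[k] L') ∘ₗ d k L (n + 1) from DFunLike.congr_fun h x
    refine exteriorPower.linearMap_ext ?_
    ext1 x
    simp only [LinearMap.compAlternatingMap_apply, LinearMap.comp_apply, d_ιMulti, map_sum,
      exteriorPower.map_apply_ιMulti, map_zsmul]
    refine Finset.sum_congr rfl fun p _ => ?_
    congr 2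
    funext l
    refine Fin.cases ?_ (fun l => ?_) l <;> simp

/-- Functoriality of the homology of Lie algebras. -/
def LieHomology.map (φ : L →ₗ⁅k⁆ L') (n : ℕ) : LieHomology k L n →ₗ[k] LieHomology k L' n :=
  quotMap (exteriorPower.map n (φ : L →ₗ[k] L'))
    (by
      rcases n with _ | n
      · intro x _; trivial
      · intro x hx
        change d k L' n _ = 0
        rw [d_map, LinearMap.mem_ker.mp hx, map_zero])
    (by
      rintro _ ⟨y, rfl⟩
      exact ⟨_, d_map k φ n y⟩)

/-- The operator `x_1 ∧ ⋯ ∧ x_n ↦ ∑ᵢ x_1 ∧ ⋯ ∧ D x_i ∧ ⋯ ∧ x_n` on `Λ^n(L)`, as a multilinear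
map. -/
def derMulti (D : L →ₗ[k] L) (n : ℕ) : MultilinearMap k (fun _ : Fin n => L) (⋀[k]^n L) :=
  ∑ i, (exteriorPower.ιMulti k n (M := L)).toMultilinearMap.compLinearMap
    (Function.update (fun _ => LinearMap.id) i D)

theorem derMulti_apply (D : L →ₗ[k] L) (n : ℕ) (x : Fin n → L) : derMulti k D n x =
    ∑ i, exteriorPower.ιMulti k n (Function.update x i (D (x i))) := by
  rw [derMulti, sum_apply]
  refine Finset.sum_congr rfl fun i _ => ?_
  rw [MultilinearMap.compLinearMap_apply]
  change exteriorPower.ιMulti k n _ = _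
  congr 1
  funext j
  rcases eq_or_ne j i with rfl | h
  · simp
  · simp [h]

theorem derMulti_perm (D : L →ₗ[k] L) (n : ℕ) (τ : Equiv.Perm (Fin n)) (x : Fin n → L) :
    derMulti k D n (x ∘ τ) = (Equiv.Perm.sign τ : ℤ) • derMulti k D n x := by
  rw [derMulti_apply, derMulti_apply, Finset.smul_sum, ← Equiv.sum_comp τ (fun i =>
    (Equiv.Perm.sign τ : ℤ) • exteriorPower.ιMulti k n (Function.update x i (D (x i))))]
  refine Finset.sum_congr rfl fun i _ => ?_
  have h := (exteriorPower.ιMulti k n (M := L)).map_perm (Function.update x (τ i) (D (x (τ i)))) τ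
  refine Eq.trans ?_ h
  congr 1
  funext j
  simp [Function.update_apply, Function.comp_def]

/-- The action on `Λ^n(L)` of a linear endomorphism of `L`, extended as a derivation:
`x_1 ∧ ⋯ ∧ x_n ↦ ∑ᵢ x_1 ∧ ⋯ ∧ D x_i ∧ ⋯ ∧ x_n`. -/
def derExt (D : L →ₗ[k] L) (n : ℕ) : ⋀[k]^n L →ₗ[k] ⋀[k]^n L :=
  exteriorPower.alternatingMapLinearEquiv (alternatingOfPerm (derMulti k D n) (derMulti_perm k D n))

theorem derExt_ιMulti (D : L →ₗ[k] L) (n : ℕ) (x : Fin n → L) :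
    derExt k D n (exteriorPower.ιMulti k n x) =
      ∑ i, exteriorPower.ιMulti k n (Function.update x i (D (x i))) := by
  rw [← derMulti_apply, derExt, exteriorPower.alternatingMapLinearEquiv_apply_ιMulti]
  rfl

theorem bracketFirst_der (D : LieDerivation k L L) (n : ℕ) (y : Fin (n + 2) → L) :
    ∑ i, bracketFirst k L n (Function.update y i (D (y i))) =
      derExt k (D : L →ₗ[k] L) (n + 1) (bracketFirst k L n y) := by
  simp only [bracketFirst_apply, derExt_ιMulti]
  rw [Fin.sum_univ_succ, Fin.sum_univ_succ, Fin.sum_univ_succ, ← add_assoc]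
  set r : Fin n → L := fun l => y l.succ.succ with hr
  congr 1
  · have h := (exteriorPower.ιMulti k (n + 1) (M := L)).toMultilinearMap.cons_add r
      ⁅y 0, D (y 1)⁆ ⁅D (y 0), y 1⁆
    rw [← LieDerivation.apply_lie_eq_add] at h
    refine (add_comm _ _).trans ?_
    refine Eq.trans ?_ (h.symm.trans ?_)
    · refine congrArg₂ (· + ·) ?_ ?_
      · change exteriorPower.ιMulti k (n + 1) _ = exteriorPower.ιMulti k (n + 1) _
        congr 1
      · change exteriorPower.ιMulti k (n + 1) _ = exteriorPower.ιMulti k (n + 1) _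
        congr 1
    · change exteriorPower.ιMulti k (n + 1) _ = exteriorPower.ιMulti k (n + 1) _
      congr 1
      rw [Fin.update_cons_zero]
      rfl
  · refine Finset.sum_congr rfl fun l _ => ?_
    congr 1
    rw [← Fin.cons_update, Fin.cons_succ, Function.update_of_ne (Fin.succ_ne_zero _).symm,
      Function.update_of_ne]
    · congr 1
      funext j
      simp only [Function.update_apply, hr, Fin.succ_inj]
      rfl
    · exact fun h => Fin.succ_ne_zero l (Fin.succ_injective _ h.symm)

theorem d_der (D : LieDerivation k L L) (n : ℕ) (x : ⋀[k]^(n + 1) L) :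
    d k L n (derExt k (D : L →ₗ[k] L) (n + 1) x) = derExt k (D : L →ₗ[k] L) n (d k L n x) := by
  rcases n with _ | n
  · simp [d]
  · suffices h : d k L (n + 1) ∘ₗ derExt k (D : L →ₗ[k] L) (n + 2) =
        derExt k (D : L →ₗ[k] L) (n + 1) ∘ₗ d k L (n + 1) from DFunLike.congr_fun h x
    refine exteriorPower.linearMap_ext ?_
    ext1 x
    have hd : ∀ x : Fin (n + 2) → L, d k L (n + 1) (exteriorPower.ιMulti k (n + 2) x) =
        dMulti k n x := fun x => by
      rw [d, exteriorPower.alternatingMapLinearEquiv_apply_ιMulti]; rfl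
    simp only [LinearMap.compAlternatingMap_apply, LinearMap.comp_apply, derExt_ιMulti, map_sum, hd,
      dMulti_eq, map_zsmul, ← bracketFirst_der]
    rw [Finset.sum_comm]
    refine Finset.sum_congr rfl fun p _ => ?_
    rw [← Finset.smul_sum, ← Equiv.sum_comp (pairPerm p.1 p.2).symm]
    congr 1
    refine Finset.sum_congr rfl fun i _ => ?_
    congr 1
    funext j
    simp [Function.update_apply, Function.comp_def]

/-- The action of a derivation of `L` on the homology of `L`. -/
def LieHomology.der (D : LieDerivation k L L) (n : ℕ) :
    LieHomology k L n →ₗ[k] LieHomology k L n :=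
  quotMap (derExt k (D : L →ₗ[k] L) n)
    (by
      rcases n with _ | n
      · intro x _; trivial
      · intro x hx
        change d k L n _ = 0
        rw [d_der, LinearMap.mem_ker.mp hx, map_zero])
    (by
      rintro _ ⟨y, rfl⟩
      exact ⟨_, d_der k D n y⟩)

end lie

end ChevalleyEilenberg

/-! ## Homology of twisted Lie algebras -/

namespace Species

variable {k : Type u} [Field k] (F : Species.{u, w} k)

theorem map_map {I J K : Type} [Finite I] [Finite J] [Finite K] (e : I ≃ J) (f : J ≃ K)
    (x : F.obj I) : F.map f (F.map e x) = F.map (e.trans f) x :=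
  (F.map_trans e f x).symm

theorem map_congr {I J : Type} [Finite I] [Finite J] {e e' : I ≃ J} (h : ∀ i, e i = e' i)
    (x : F.obj I) : F.map e x = F.map e' x := by
  rw [Equiv.ext h]

theorem map_self {I : Type} [Finite I] {e : I ≃ I} (h : ∀ i, e i = i)
    (x : F.obj I) : F.map e x = x := by
  rw [F.map_congr (e' := Equiv.refl I) h, F.map_refl]

/-- The value on `I` of the `n`-th tensor power of `F` with respect to the Cauchy product:
the direct sum over all the ordered decompositions `I = I_0 ⊔ ⋯ ⊔ I_{n-1}` of
`F(I_0) ⊗ ⋯ ⊗ F(I_{n-1})`. The decomposition is given by the map `I → Fin n` with fibres `I_j`. -/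
def CauchyPow (n : ℕ) (I : Type) [Finite I] : Type (max u w) :=
  ⨁ f : I → Fin n, ⨂[k] j : Fin n, F.obj {i // f i = j}

variable (n : ℕ) (I : Type) [Finite I]

instance : AddCommGroup (F.CauchyPow n I) :=
  inferInstanceAs (AddCommGroup (⨁ f : I → Fin n, ⨂[k] j : Fin n, F.obj {i // f i = j}))

instance : Module k (F.CauchyPow n I) :=
  inferInstanceAs (Module k (⨁ f : I → Fin n, ⨂[k] j : Fin n, F.obj {i // f i = j}))

variable {n I}

open scoped Classical in
/-- The tensor `x_0 ⊗ ⋯ ⊗ x_{n-1}`, where `x_j` belongs to the value of `F` on the `j`-th part of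
the decomposition `f`. -/
def gen (f : I → Fin n) : MultilinearMap k (fun j => F.obj {i // f i = j}) (F.CauchyPow n I) :=
  (DirectSum.lof k (I → Fin n) (fun f => ⨂[k] j : Fin n, F.obj {i // f i = j}) f).compMultilinearMap
    (PiTensorProduct.tprod k)

variable {N : Type*} [AddCommGroup N] [Module k N]

open scoped Classical in
/-- Maps out of the Cauchy power. -/
def powLift (φ : ∀ f : I → Fin n, MultilinearMap k (fun j => F.obj {i // f i = j}) N) :
    F.CauchyPow n I →ₗ[k] N :=
  DirectSum.toModule k (I → Fin n) N fun f => PiTensorProduct.lift (φ f)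

theorem powLift_gen (φ : ∀ f : I → Fin n, MultilinearMap k (fun j => F.obj {i // f i = j}) N)
    (f : I → Fin n) (x : ∀ j, F.obj {i // f i = j}) :
    F.powLift φ (F.gen f x) = φ f x := by
  classical
  refine (DirectSum.toModule_lof k f _).trans ?_
  rw [PiTensorProduct.lift.tprod]

theorem pow_ext {φ ψ : F.CauchyPow n I →ₗ[k] N}
    (h : ∀ (f : I → Fin n) (x : ∀ j, F.obj {i // f i = j}), φ (F.gen f x) = ψ (F.gen f x))
    (a : F.CauchyPow n I) : φ a = ψ a := by
  classical
  suffices e : φ = ψ by rw [e]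
  refine DirectSum.linearMap_ext k fun f => ?_
  refine PiTensorProduct.ext ?_
  ext x
  exact h f x

theorem gen_congr {f f' : I → Fin n} (h : ∀ i, f i = f' i) (x : ∀ j, F.obj {i // f i = j}) :
    F.gen f x = F.gen f' fun j => F.map (Equiv.subtypeEquivRight fun i => by rw [h i]) (x j) := by
  obtain rfl : f = f' := funext h
  congr 1
  funext j
  exact (F.map_self (fun i => rfl) _).symm

theorem map_fibre {f : I → Fin n} (x : ∀ j, F.obj {i // f i = j}) {j j' : Fin n} (h : j = j')
    {K : Type} [Finite K] (e : {i // f i = j} ≃ K) :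
    F.map e (x j) = F.map ((Equiv.subtypeEquivRight fun i => by rw [h]).trans e) (x j') := by
  subst h
  exact F.map_congr (fun i => rfl) _

variable {J K : Type} [Finite J] [Finite K]

/-- Functoriality of the Cauchy power in the finite set. -/
def powMap (e : I ≃ J) : F.CauchyPow n I →ₗ[k] F.CauchyPow n J :=
  F.powLift fun f => (F.gen (f ∘ e.symm)).compLinearMap fun _ =>
    F.map (e.subtypeEquiv fun i => by simp)

theorem powMap_gen (e : I ≃ J) (f : I → Fin n) (x : ∀ j, F.obj {i // f i = j}) :
    F.powMap e (F.gen f x) =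
      F.gen (f ∘ e.symm) fun j => F.map (e.subtypeEquiv fun i => by simp) (x j) :=
  F.powLift_gen _ _ _

theorem powMap_refl (a : F.CauchyPow n I) : F.powMap (Equiv.refl I) a = a := by
  refine F.pow_ext (ψ := LinearMap.id) (fun f x => ?_) a
  rw [powMap_gen, LinearMap.id_apply]
  refine congrArg (F.gen f) (funext fun j => ?_)
  exact F.map_self (fun i => rfl) _

theorem powMap_trans (e : I ≃ J) (e' : J ≃ K) (a : F.CauchyPow n I) :
    F.powMap (e.trans e') a = F.powMap e' (F.powMap e a) := by
  refine F.pow_ext (ψ := F.powMap e' ∘ₗ F.powMap e) (fun f x => ?_) a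
  rw [LinearMap.comp_apply, powMap_gen, powMap_gen, powMap_gen]
  refine congrArg (F.gen (f ∘ (e.trans e').symm)) (funext fun j => ?_)
  rw [map_map]
  exact F.map_congr (fun i => rfl) _

/-- The permutation of the tensor factors: the `j`-th factor of the result is the factor of the
argument with the number `σ⁻¹ j`. -/
def perm (σ : Equiv.Perm (Fin n)) : F.CauchyPow n I →ₗ[k] F.CauchyPow n I :=
  F.powLift fun f => (MultilinearMap.domDomCongrLinearEquiv' k k (fun j => F.obj {i // f i = j})
    (F.CauchyPow n I) σ).symm ((F.gen (σ ∘ f)).compLinearMap fun _ =>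
      F.map (Equiv.subtypeEquivRight fun i => by simp [Equiv.eq_symm_apply]))

theorem perm_gen (σ : Equiv.Perm (Fin n)) (f : I → Fin n) (x : ∀ j, F.obj {i // f i = j}) :
    F.perm σ (F.gen f x) = F.gen (σ ∘ f) fun j =>
      F.map (Equiv.subtypeEquivRight fun i => by simp [Equiv.eq_symm_apply]) (x (σ.symm j)) :=
  F.powLift_gen _ _ _

theorem perm_mul (σ τ : Equiv.Perm (Fin n)) (a : F.CauchyPow n I) :
    F.perm (σ * τ) a = F.perm σ (F.perm τ a) := by
  refine F.pow_ext (ψ := F.perm σ ∘ₗ F.perm τ) (fun f x => ?_) a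
  rw [LinearMap.comp_apply, perm_gen, perm_gen, perm_gen]
  refine congrArg (F.gen (⇑(σ * τ) ∘ f)) (funext fun j => ?_)
  rw [map_map]
  exact F.map_congr (fun i => rfl) _

theorem perm_powMap (σ : Equiv.Perm (Fin n)) (e : I ≃ J) (a : F.CauchyPow n I) :
    F.perm σ (F.powMap e a) = F.powMap e (F.perm σ a) := by
  refine F.pow_ext (φ := F.perm σ ∘ₗ F.powMap e) (ψ := F.powMap e ∘ₗ F.perm σ) (fun f x => ?_) a
  rw [LinearMap.comp_apply, LinearMap.comp_apply, perm_gen, powMap_gen, perm_gen, powMap_gen]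
  refine congrArg (F.gen (⇑σ ∘ f ∘ e.symm)) (funext fun j => ?_)
  rw [map_map, map_map]
  exact F.map_congr (fun i => rfl) _

/-- The relations `σ x = sgn(σ) x` in the Cauchy power. -/
def extRel (n : ℕ) (I : Type) [Finite I] : Submodule k (F.CauchyPow n I) :=
  Submodule.span k (Set.range fun p : Equiv.Perm (Fin n) × F.CauchyPow n I =>
    F.perm p.1 p.2 - (Equiv.Perm.sign p.1 : ℤ) • p.2)

/-- Linear maps of Cauchy powers compatible with all the relations `σ x = sgn(σ) x`. -/
theorem extRel_le {m : ℕ} (φ : F.CauchyPow m I →ₗ[k] N)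
    (h : ∀ (σ : Equiv.Perm (Fin m)) (a : F.CauchyPow m I),
      φ (F.perm σ a) = (Equiv.Perm.sign σ : ℤ) • φ a) :
    F.extRel m I ≤ LinearMap.ker φ := by
  rw [extRel, Submodule.span_le]
  rintro _ ⟨⟨σ, a⟩, rfl⟩
  rw [SetLike.mem_coe, LinearMap.mem_ker, map_sub, map_zsmul, h, sub_self]

/-- The value on `I` of the `n`-th exterior power of `F` with respect to the Cauchy product. -/
def ExtObj (n : ℕ) (I : Type) [Finite I] : Type (max u w) := F.CauchyPow n I ⧸ F.extRel n I

instance (n : ℕ) (I : Type) [Finite I] : AddCommGroup (F.ExtObj n I) :=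
  inferInstanceAs (AddCommGroup (F.CauchyPow n I ⧸ F.extRel n I))

instance (n : ℕ) (I : Type) [Finite I] : Module k (F.ExtObj n I) :=
  inferInstanceAs (Module k (F.CauchyPow n I ⧸ F.extRel n I))

/-- The quotient map from the Cauchy power to the exterior power. -/
def extMk (n : ℕ) (I : Type) [Finite I] : F.CauchyPow n I →ₗ[k] F.ExtObj n I := (F.extRel n I).mkQ

theorem extMk_surjective (n : ℕ) (I : Type) [Finite I] : Function.Surjective (F.extMk n I) :=
  (F.extRel n I).mkQ_surjective

theorem extMk_perm (σ : Equiv.Perm (Fin n)) (a : F.CauchyPow n I) :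
    F.extMk n I (F.perm σ a) = (Equiv.Perm.sign σ : ℤ) • F.extMk n I a :=
  (Submodule.Quotient.eq _).mpr (Submodule.subset_span ⟨⟨σ, a⟩, rfl⟩)

/-- Maps out of the exterior power. -/
def extLift (φ : F.CauchyPow n I →ₗ[k] N)
    (h : ∀ (σ : Equiv.Perm (Fin n)) (a : F.CauchyPow n I),
      φ (F.perm σ a) = (Equiv.Perm.sign σ : ℤ) • φ a) : F.ExtObj n I →ₗ[k] N :=
  Submodule.liftQ (F.extRel n I) φ (F.extRel_le φ h)

theorem extLift_mk (φ : F.CauchyPow n I →ₗ[k] N)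
    (h : ∀ (σ : Equiv.Perm (Fin n)) (a : F.CauchyPow n I),
      φ (F.perm σ a) = (Equiv.Perm.sign σ : ℤ) • φ a) (a : F.CauchyPow n I) :
    F.extLift φ h (F.extMk n I a) = φ a := rfl

/-- Functoriality of the exterior power in the finite set. -/
def extMap (n : ℕ) (e : I ≃ J) : F.ExtObj n I →ₗ[k] F.ExtObj n J :=
  F.extLift (F.extMk n J ∘ₗ F.powMap e) (by
    intro σ a
    rw [LinearMap.comp_apply, LinearMap.comp_apply, ← perm_powMap, extMk_perm])

theorem extMap_mk (e : I ≃ J) (a : F.CauchyPow n I) :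
    F.extMap n e (F.extMk n I a) = F.extMk n J (F.powMap e a) := rfl

/-- The `n`-th exterior power of `F` with respect to the Cauchy product. -/
def extPow (n : ℕ) : Species.{u, max u w} k where
  obj I _ := F.ExtObj n I
  map e := F.extMap n e
  map_refl I _ x := by
    obtain ⟨a, rfl⟩ := F.extMk_surjective n I x
    rw [extMap_mk, powMap_refl]
  map_trans e f x := by
    obtain ⟨a, rfl⟩ := F.extMk_surjective n _ x
    rw [extMap_mk, extMap_mk, extMap_mk, powMap_trans]

end Species

namespace TwistedLieAlgebra

open ChevalleyEilenberg

variable {k : Type u} [Field k] (g : TwistedLieAlgebra.{u, w} k) {n : ℕ} {I J : Type}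
  [Finite I] [Finite J]

/-- The map identifying the first two of `n + 2` positions. -/
def mergeIdx (n : ℕ) : Fin (n + 2) → Fin (n + 1) := Fin.cases 0 id

theorem mergeIdx_zero (j : Fin (n + 2)) : mergeIdx n j = 0 ↔ j = 0 ∨ j = 1 := by
  refine Fin.cases ?_ (fun j => ?_) j
  · simp [mergeIdx]
  · rw [← Fin.succ_zero_eq_one, Fin.succ_inj]
    simp [mergeIdx, Fin.succ_ne_zero]

theorem mergeIdx_succ (j : Fin (n + 2)) (l : Fin n) : mergeIdx n j = l.succ ↔ j = l.succ.succ := by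
  refine Fin.cases ?_ (fun j => ?_) j
  · simp [mergeIdx, (Fin.succ_ne_zero _).symm]
  · simp [mergeIdx]

/-- The union of the first two parts of a decomposition. -/
def mergeEquiv (f : I → Fin (n + 2)) :
    {i // f i = 0} ⊕ {i // f i = 1} ≃ {i // mergeIdx n (f i) = 0} :=
  Equiv.ofBijective
    (Sum.elim (fun i => ⟨i.1, (mergeIdx_zero _).mpr (Or.inl i.2)⟩)
      (fun i => ⟨i.1, (mergeIdx_zero _).mpr (Or.inr i.2)⟩)) (by
    constructor
    · rintro (⟨i, hi⟩ | ⟨i, hi⟩) (⟨j, hj⟩ | ⟨j, hj⟩) h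
      · simpa using h
      · obtain rfl : i = j := by simpa using h
        rw [hi, ← Fin.succ_zero_eq_one] at hj
        exact absurd hj.symm (Fin.succ_ne_zero _)
      · obtain rfl : i = j := by simpa using h
        rw [hj, ← Fin.succ_zero_eq_one] at hi
        exact absurd hi.symm (Fin.succ_ne_zero _)
      · simpa using h
    · rintro ⟨i, hi⟩
      rcases (mergeIdx_zero _).mp hi with h | h
      · exact ⟨Sum.inl ⟨i, h⟩, rfl⟩
      · exact ⟨Sum.inr ⟨i, h⟩, rfl⟩)

/-- The remaining parts of a decomposition. -/
def mergeEquivSucc (f : I → Fin (n + 2)) (l : Fin n) :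
    {i // f i = l.succ.succ} ≃ {i // mergeIdx n (f i) = l.succ} :=
  Equiv.subtypeEquivRight fun _ => (mergeIdx_succ _ _).symm

/-- The factors of `[x_0, x_1] ⊗ x_2 ⊗ ⋯`. -/
def mergeTuple (f : I → Fin (n + 2)) (x : ∀ j, g.obj {i // f i = j}) :
    ∀ j, g.obj {i // mergeIdx n (f i) = j} :=
  Fin.cons (α := fun j => g.obj {i // mergeIdx n (f i) = j})
    (g.map (mergeEquiv f) (g.bracket _ _ (x 0) (x 1)))
    (fun l => g.map (mergeEquivSucc f l) (x l.succ.succ))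

/-- The multilinear map `(x_0, x_1, x_2, …) ↦ [x_0, x_1] ⊗ x_2 ⊗ ⋯` on one component of the Cauchy
power. -/
def mergeMulti (f : I → Fin (n + 2)) :
    MultilinearMap k (fun j => g.obj {i // f i = j}) (g.toSpecies.CauchyPow (n + 1) I) :=
  LinearMap.uncurryLeft (M := fun j => g.obj {i // f i = j})
    ((multilinearCurryLeftEquiv k (fun j : Fin (n + 1) => g.obj {i // f i = j.succ})
      (g.toSpecies.CauchyPow (n + 1) I)).symm.toLinearMap ∘ₗ
      (g.bracket {i // f i = 0} {i // f i = 1}).compr₂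
        (MultilinearMap.compLinearMapₗ (fun l => g.map (mergeEquivSucc f l)) ∘ₗ
          (g.toSpecies.gen (mergeIdx n ∘ f)).curryLeft ∘ₗ g.map (mergeEquiv f)))

theorem mergeMulti_apply (f : I → Fin (n + 2)) (x : ∀ j, g.obj {i // f i = j}) :
    g.mergeMulti f x = g.toSpecies.gen (mergeIdx n ∘ f) (g.mergeTuple f x) := rfl

/-- The map `x_0 ⊗ x_1 ⊗ x_2 ⊗ ⋯ ↦ [x_0, x_1] ⊗ x_2 ⊗ ⋯` on the Cauchy power. -/
def merge (n : ℕ) (I : Type) [Finite I] :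
    g.toSpecies.CauchyPow (n + 2) I →ₗ[k] g.toSpecies.CauchyPow (n + 1) I :=
  g.toSpecies.powLift g.mergeMulti

theorem merge_gen (f : I → Fin (n + 2)) (x : ∀ j, g.obj {i // f i = j}) :
    g.merge n I (g.toSpecies.gen f x) = g.toSpecies.gen (mergeIdx n ∘ f) (g.mergeTuple f x) := by
  rw [merge, Species.powLift_gen, mergeMulti_apply]

theorem merge_powMap (e : I ≃ J) (a : g.toSpecies.CauchyPow (n + 2) I) :
    g.merge n J (g.toSpecies.powMap e a) = g.toSpecies.powMap e (g.merge n I a) := by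
  refine g.toSpecies.pow_ext (φ := g.merge n J ∘ₗ g.toSpecies.powMap e)
    (ψ := g.toSpecies.powMap e ∘ₗ g.merge n I) (fun f x => ?_) a
  rw [LinearMap.comp_apply, LinearMap.comp_apply, merge_gen, Species.powMap_gen, merge_gen,
    Species.powMap_gen]
  refine congrArg (g.toSpecies.gen (mergeIdx n ∘ f ∘ e.symm)) (funext fun j => ?_)
  refine Fin.cases ?_ (fun l => ?_) j
  · simp only [mergeTuple, Fin.cons_zero]
    rw [g.bracket_map, Species.map_map, Species.map_map]
    exact g.toSpecies.map_congr (by rintro (i | i) <;> rfl) _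
  · simp only [mergeTuple, Fin.cons_succ]
    rw [Species.map_map, Species.map_map]
    exact g.toSpecies.map_congr (fun i => rfl) _

theorem merge_swap (a : g.toSpecies.CauchyPow (n + 2) I) :
    g.merge n I (g.toSpecies.perm (Equiv.swap 0 1) a) = -g.merge n I a := by
  refine g.toSpecies.pow_ext (φ := g.merge n I ∘ₗ g.toSpecies.perm (Equiv.swap 0 1))
    (ψ := -g.merge n I) (fun f x => ?_) a
  rw [LinearMap.comp_apply, LinearMap.neg_apply, merge_gen, Species.perm_gen, merge_gen]
  have hss : ∀ l : Fin n, Equiv.swap (0 : Fin (n + 2)) 1 l.succ.succ = l.succ.succ := fun l =>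
    Equiv.swap_apply_of_ne_of_ne (Fin.succ_ne_zero _) (by
      rw [← Fin.succ_zero_eq_one]; exact fun h => Fin.succ_ne_zero _ (Fin.succ_injective _ h))
  have hidx : ∀ j : Fin (n + 2), mergeIdx n (Equiv.swap 0 1 j) = mergeIdx n j := by
    refine Fin.cases ?_ (fun j => Fin.cases ?_ (fun l => ?_) j)
    · rw [Equiv.swap_apply_left]; rfl
    · rw [Fin.succ_zero_eq_one, Equiv.swap_apply_right]; rfl
    · rw [hss]
  rw [g.toSpecies.gen_congr (f := mergeIdx n ∘ Equiv.swap 0 1 ∘ f) (f' := mergeIdx n ∘ f)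
    (fun i => hidx (f i))]
  have h := (g.toSpecies.gen (mergeIdx n ∘ f)).cons_smul
    (fun l => g.map (mergeEquivSucc f l) (x l.succ.succ)) (-1)
    (g.map (mergeEquiv f) (g.bracket _ _ (x 0) (x 1)))
  rw [neg_one_smul, neg_one_smul] at h
  refine Eq.trans ?_ h
  refine congrArg (g.toSpecies.gen (mergeIdx n ∘ f)) (funext fun j => ?_)
  refine Fin.cases ?_ (fun l => ?_) j
  · simp only [mergeTuple, Fin.cons_zero]
    rw [g.toSpecies.map_fibre x (j := (Equiv.swap 0 1).symm 0) (j' := 1) (by simp),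
      g.toSpecies.map_fibre x (j := (Equiv.swap 0 1).symm 1) (j' := 0) (by simp),
      g.bracket_map, g.bracket_skew (x 0) (x 1), map_neg, map_neg, map_neg, Species.map_map,
      Species.map_map, Species.map_map]
    refine congrArg Neg.neg (g.toSpecies.map_congr ?_ _)
    rintro (i | i) <;> rfl
  · simp only [mergeTuple, Fin.cons_succ]
    rw [g.toSpecies.map_fibre x (j := (Equiv.swap 0 1).symm l.succ.succ) (j' := l.succ.succ)
      (by rw [Equiv.symm_swap, hss]), Species.map_map, Species.map_map]
    exact g.toSpecies.map_congr (fun i => rfl) _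

theorem merge_ext (π : Equiv.Perm (Fin n)) (a : g.toSpecies.CauchyPow (n + 2) I) :
    g.merge n I (g.toSpecies.perm (extPerm (extPerm π)) a) =
      g.toSpecies.perm (extPerm π) (g.merge n I a) := by
  refine g.toSpecies.pow_ext (φ := g.merge n I ∘ₗ g.toSpecies.perm (extPerm (extPerm π)))
    (ψ := g.toSpecies.perm (extPerm π) ∘ₗ g.merge n I) (fun f x => ?_) a
  rw [LinearMap.comp_apply, LinearMap.comp_apply, merge_gen, Species.perm_gen, merge_gen,
    Species.perm_gen]
  have hidx : ∀ j : Fin (n + 2), mergeIdx n (extPerm (extPerm π) j) = extPerm π (mergeIdx n j) := by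
    refine Fin.cases ?_ (fun j => ?_)
    · rw [extPerm_zero]; exact (extPerm_zero _).symm
    · rw [extPerm_succ]; rfl
  have h1 : (extPerm (extPerm π)).symm 1 = 1 := by
    rw [← Fin.succ_zero_eq_one, extPerm_symm_succ, extPerm_symm_zero]
  rw [g.toSpecies.gen_congr (f := mergeIdx n ∘ extPerm (extPerm π) ∘ f)
    (f' := extPerm π ∘ mergeIdx n ∘ f) (fun i => hidx (f i))]
  refine congrArg (g.toSpecies.gen (extPerm π ∘ mergeIdx n ∘ f)) (funext fun j => ?_)
  refine Fin.cases ?_ (fun l => ?_) j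
  · rw [g.toSpecies.map_fibre (f := mergeIdx n ∘ f) (g.mergeTuple f x)
      (j := (extPerm π).symm 0) (j' := 0) (extPerm_symm_zero π)]
    simp only [mergeTuple, Fin.cons_zero]
    rw [g.toSpecies.map_fibre x (j := (extPerm (extPerm π)).symm 0) (j' := 0)
      (extPerm_symm_zero _), g.toSpecies.map_fibre x (j := (extPerm (extPerm π)).symm 1) (j' := 1)
      h1, g.bracket_map, Species.map_map, Species.map_map, Species.map_map]
    refine g.toSpecies.map_congr ?_ _
    rintro (i | i) <;> rfl
  · rw [g.toSpecies.map_fibre (f := mergeIdx n ∘ f) (g.mergeTuple f x)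
      (j := (extPerm π).symm l.succ) (j' := (π.symm l).succ) (extPerm_symm_succ π l)]
    simp only [mergeTuple, Fin.cons_succ]
    rw [g.toSpecies.map_fibre x (j := (extPerm (extPerm π)).symm l.succ.succ)
      (j' := (π.symm l).succ.succ) (by rw [extPerm_symm_succ, extPerm_symm_succ]),
      Species.map_map, Species.map_map, Species.map_map]
    exact g.toSpecies.map_congr (fun i => rfl) _

end TwistedLieAlgebra

namespace TwistedLieAlgebra

open ChevalleyEilenberg

variable {k : Type u} [Field k] (g : TwistedLieAlgebra.{u, w} k) {n : ℕ} {I J : Type}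
  [Finite I] [Finite J]

/-- The Chevalley-Eilenberg differential on the Cauchy power: the sum over pairs of positions of
the signed tensors in which the two factors are moved to the front and replaced by their bracket. -/
def powD (n : ℕ) (I : Type) [Finite I] :
    g.toSpecies.CauchyPow (n + 2) I →ₗ[k] g.toSpecies.ExtObj (n + 1) I :=
  ∑ p ∈ pairs n, ((-1) ^ (p.1 + p.2 : ℕ) : ℤ) •
    (g.toSpecies.extMk (n + 1) I ∘ₗ g.merge n I ∘ₗ g.toSpecies.perm (pairPerm p.1 p.2))

theorem powD_apply (a : g.toSpecies.CauchyPow (n + 2) I) : g.powD n I a =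
    ∑ p ∈ pairs n, (Equiv.Perm.sign (pairPerm p.1 p.2) : ℤ) •
      g.toSpecies.extMk (n + 1) I (g.merge n I (g.toSpecies.perm (pairPerm p.1 p.2) a)) := by
  rw [powD, LinearMap.sum_apply]
  refine Finset.sum_congr rfl fun p _ => ?_
  rw [sign_pairPerm]
  simp

theorem powD_powMap (e : I ≃ J) (a : g.toSpecies.CauchyPow (n + 2) I) :
    g.powD n J (g.toSpecies.powMap e a) = g.toSpecies.extMap (n + 1) e (g.powD n I a) := by
  rw [powD_apply, powD_apply, map_sum]
  refine Finset.sum_congr rfl fun p _ => ?_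
  rw [map_zsmul, Species.extMap_mk, Species.perm_powMap, merge_powMap]

variable [CharZero k]

theorem powD_perm (τ : Equiv.Perm (Fin (n + 2))) (a : g.toSpecies.CauchyPow (n + 2) I) :
    g.powD n I (g.toSpecies.perm τ a) = (Equiv.Perm.sign τ : ℤ) • g.powD n I a := by
  have h := sum_pairs_perm k (fun σ : Equiv.Perm (Fin (n + 2)) => (Equiv.Perm.sign σ : ℤ) •
    g.toSpecies.extMk (n + 1) I (g.merge n I (g.toSpecies.perm σ a))) ?_ ?_ τ
  · rw [powD_apply, powD_apply, ← h, Finset.smul_sum]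
    refine Finset.sum_congr rfl fun p _ => ?_
    rw [smul_smul, Species.perm_mul]
    congr 1
    rw [map_mul, Units.val_mul, mul_comm, mul_assoc, Int.units_coe_mul_self, mul_one]
  · intro σ
    rw [map_mul, Equiv.Perm.sign_swap Fin.zero_ne_one, Species.perm_mul, merge_swap, map_neg]
    simp
  · intro π σ
    rw [Species.perm_mul, merge_ext, Species.extMk_perm, map_mul, sign_extPerm, sign_extPerm,
      smul_smul, Units.val_mul, mul_right_comm, Int.units_coe_mul_self, one_mul]

/-- The Chevalley-Eilenberg differential `Λ^{n+1}(g) → Λ^n(g)` on the value on `I`,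
`x_1 ∧ ⋯ ∧ x_{n+1} ↦ ∑_{i<j} (-1)^{i+j-1} [x_i, x_j] ∧ x_1 ∧ ⋯` (with `x_i`, `x_j` omitted). -/
def d : (n : ℕ) → (I : Type) → [Finite I] →
    g.toSpecies.ExtObj (n + 1) I →ₗ[k] g.toSpecies.ExtObj n I
  | 0, _, _ => 0
  | n + 1, I, _ => g.toSpecies.extLift (g.powD n I) g.powD_perm

theorem d_mk (a : g.toSpecies.CauchyPow (n + 2) I) :
    g.d (n + 1) I (g.toSpecies.extMk (n + 2) I a) = g.powD n I a := rfl

theorem d_extMap (e : I ≃ J) (x : g.toSpecies.ExtObj (n + 1) I) :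
    g.d n J (g.toSpecies.extMap (n + 1) e x) = g.toSpecies.extMap n e (g.d n I x) := by
  rcases n with _ | n
  · simp [d]
  · obtain ⟨a, rfl⟩ := g.toSpecies.extMk_surjective _ _ x
    rw [Species.extMap_mk, d_mk, d_mk, powD_powMap]

/-- The cycles of the Chevalley-Eilenberg complex of `g`. -/
def cycles : (n : ℕ) → (I : Type) → [Finite I] → Submodule k (g.toSpecies.ExtObj n I)
  | 0, _, _ => ⊤
  | n + 1, I, _ => LinearMap.ker (g.d n I)

theorem extMap_cycles (e : I ≃ J) (n : ℕ) : ∀ x ∈ g.cycles n I,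
    g.toSpecies.extMap n e x ∈ g.cycles n J := by
  rcases n with _ | n
  · intro x _; trivial
  · intro x hx
    change g.d n J _ = 0
    rw [d_extMap, LinearMap.mem_ker.mp hx, map_zero]

theorem extMap_range (e : I ≃ J) (n : ℕ) : ∀ x ∈ LinearMap.range (g.d n I),
    g.toSpecies.extMap n e x ∈ LinearMap.range (g.d n J) := by
  rintro _ ⟨y, rfl⟩
  exact ⟨_, g.d_extMap e y⟩

/-- The homology `H_n(g, k)` of a twisted Lie algebra with trivial coefficients: the homology of
its Chevalley-Eilenberg complex, a species. -/
def homology (n : ℕ) : Species.{u, max u w} k where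
  obj I _ := HomologyQuot (g.cycles n I) (LinearMap.range (g.d n I))
  map e := quotMap (g.toSpecies.extMap n e) (g.extMap_cycles e n) (g.extMap_range e n)
  map_refl I _ x := by
    obtain ⟨⟨a, ha⟩, rfl⟩ := Submodule.mkQ_surjective _ x
    refine congrArg (Submodule.mkQ _) (Subtype.ext ?_)
    exact (g.toSpecies.extPow n).map_refl I a
  map_trans e f x := by
    obtain ⟨⟨a, ha⟩, rfl⟩ := Submodule.mkQ_surjective _ x
    refine congrArg (Submodule.mkQ _) (Subtype.ext ?_)
    exact (g.toSpecies.extPow n).map_trans e f a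

/-- A derivation of a twisted Lie algebra. -/
structure Derivation (g : TwistedLieAlgebra.{u, w} k) extends
    Species.Hom g.toSpecies g.toSpecies where
  leibniz : ∀ {I J : Type} [Finite I] [Finite J] (x : g.obj I) (y : g.obj J),
    app (I ⊕ J) (g.bracket I J x y) = g.bracket I J (app I x) y + g.bracket I J x (app J y)

variable {g} (δ : Derivation g)

namespace Derivation

/-- The operator `x_1 ⊗ ⋯ ⊗ x_n ↦ ∑ⱼ x_1 ⊗ ⋯ ⊗ δ x_j ⊗ ⋯ ⊗ x_n` on the Cauchy power. -/
def pow (n : ℕ) (I : Type) [Finite I] :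
    g.toSpecies.CauchyPow n I →ₗ[k] g.toSpecies.CauchyPow n I :=
  g.toSpecies.powLift fun f => ∑ j, (g.toSpecies.gen f).compLinearMap
    (Function.update (fun _ => LinearMap.id) j (δ.app _))

theorem pow_gen (f : I → Fin n) (x : ∀ j, g.obj {i // f i = j}) :
    δ.pow n I (g.toSpecies.gen f x) =
      ∑ j, g.toSpecies.gen f (Function.update x j (δ.app _ (x j))) := by
  rw [pow, Species.powLift_gen, sum_apply]
  refine Finset.sum_congr rfl fun j _ => ?_
  rw [MultilinearMap.compLinearMap_apply]
  refine congrArg (g.toSpecies.gen f) (funext fun l => ?_)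
  rcases eq_or_ne l j with rfl | h
  · simp
  · simp [h]

theorem pow_perm (σ : Equiv.Perm (Fin n)) (a : g.toSpecies.CauchyPow n I) :
    δ.pow n I (g.toSpecies.perm σ a) = g.toSpecies.perm σ (δ.pow n I a) := by
  refine g.toSpecies.pow_ext (φ := δ.pow n I ∘ₗ g.toSpecies.perm σ)
    (ψ := g.toSpecies.perm σ ∘ₗ δ.pow n I) (fun f x => ?_) a
  rw [LinearMap.comp_apply, LinearMap.comp_apply, Species.perm_gen, pow_gen, pow_gen, map_sum,
    ← Equiv.sum_comp σ.symm (fun j => g.toSpecies.perm σ _)]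
  refine Finset.sum_congr rfl fun j _ => ?_
  rw [Species.perm_gen]
  refine congrArg (g.toSpecies.gen (σ ∘ f)) (funext fun l => ?_)
  rcases eq_or_ne l j with rfl | h
  · rw [Function.update_self, Function.update_self, δ.naturality]
  · rw [Function.update_of_ne h, Function.update_of_ne (fun e => h (σ.symm.injective e))]

theorem pow_powMap (e : I ≃ J) (a : g.toSpecies.CauchyPow n I) :
    δ.pow n J (g.toSpecies.powMap e a) = g.toSpecies.powMap e (δ.pow n I a) := by
  refine g.toSpecies.pow_ext (φ := δ.pow n J ∘ₗ g.toSpecies.powMap e)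
    (ψ := g.toSpecies.powMap e ∘ₗ δ.pow n I) (fun f x => ?_) a
  rw [LinearMap.comp_apply, LinearMap.comp_apply, Species.powMap_gen, pow_gen, pow_gen, map_sum]
  refine Finset.sum_congr rfl fun j _ => ?_
  rw [Species.powMap_gen]
  refine congrArg (g.toSpecies.gen (f ∘ e.symm)) (funext fun l => ?_)
  rcases eq_or_ne l j with rfl | h
  · rw [Function.update_self, Function.update_self, δ.naturality]
  · rw [Function.update_of_ne h, Function.update_of_ne h]

theorem merge_pow (a : g.toSpecies.CauchyPow (n + 2) I) :
    g.merge n I (δ.pow (n + 2) I a) = δ.pow (n + 1) I (g.merge n I a) := by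
  refine g.toSpecies.pow_ext (φ := g.merge n I ∘ₗ δ.pow (n + 2) I)
    (ψ := δ.pow (n + 1) I ∘ₗ g.merge n I) (fun f x => ?_) a
  rw [LinearMap.comp_apply, LinearMap.comp_apply, merge_gen, pow_gen, pow_gen, map_sum]
  simp only [merge_gen]
  rw [Fin.sum_univ_succ, Fin.sum_univ_succ, Fin.sum_univ_succ, ← add_assoc]
  have h01 : (1 : Fin (n + 2)) ≠ 0 := fun h => Fin.succ_ne_zero 0 ((Fin.succ_zero_eq_one).trans h)
  have h1 : ∀ l : Fin n, l.succ.succ ≠ (1 : Fin (n + 2)) := fun l h =>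
    Fin.succ_ne_zero l (Fin.succ_injective _ h)
  congr 1
  · set r : ∀ l : Fin n, g.obj {i // mergeIdx n (f i) = l.succ} :=
      fun l => g.map (mergeEquivSucc f l) (x l.succ.succ) with hr
    have h := (g.toSpecies.gen (mergeIdx n ∘ f)).cons_add r
      (g.map (mergeEquiv f) (g.bracket _ _ (δ.app _ (x 0)) (x 1)))
      (g.map (mergeEquiv f) (g.bracket _ _ (x 0) (δ.app _ (x 1))))
    rw [← map_add, ← δ.leibniz, ← δ.naturality] at h
    refine Eq.trans ?_ (h.symm.trans ?_)
    · refine congrArg₂ (· + ·) ?_ ?_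
      · refine congrArg (g.toSpecies.gen (mergeIdx n ∘ f)) ?_
        rw [mergeTuple, Function.update_self, Function.update_of_ne h01]
        rfl
      · refine congrArg (g.toSpecies.gen (mergeIdx n ∘ f)) ?_
        change g.mergeTuple f (Function.update x 1 (δ.app _ (x 1))) = _
        rw [mergeTuple, Function.update_self, Function.update_of_ne h01.symm]
        refine congrArg (Fin.cons _) (funext fun l => ?_)
        rw [Function.update_of_ne (h1 l)]
    · refine congrArg (g.toSpecies.gen (mergeIdx n ∘ f)) ?_
      rw [mergeTuple, Fin.update_cons_zero]
      rfl
  · refine Finset.sum_congr rfl fun l _ => ?_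
    refine congrArg (g.toSpecies.gen (mergeIdx n ∘ f)) (funext fun j => ?_)
    refine Fin.cases ?_ (fun j => ?_) j
    · rw [Function.update_of_ne (Fin.succ_ne_zero _).symm]
      simp only [mergeTuple, Fin.cons_zero]
      rw [Function.update_of_ne (Fin.succ_ne_zero _).symm, Function.update_of_ne (h1 l).symm]
    · rcases eq_or_ne j l with rfl | h
      · rw [Function.update_self]
        simp only [mergeTuple, Fin.cons_succ]
        rw [Function.update_self, δ.naturality]
      · rw [Function.update_of_ne (fun e => h (Fin.succ_injective _ e))]
        simp only [mergeTuple, Fin.cons_succ]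
        rw [Function.update_of_ne (fun e => h (Fin.succ_injective _ (Fin.succ_injective _ e)))]

/-- The action of a derivation of `g` on the exterior power. -/
def ext (n : ℕ) (I : Type) [Finite I] : g.toSpecies.ExtObj n I →ₗ[k] g.toSpecies.ExtObj n I :=
  g.toSpecies.extLift (g.toSpecies.extMk n I ∘ₗ δ.pow n I) (by
    intro σ a
    rw [LinearMap.comp_apply, LinearMap.comp_apply, pow_perm, Species.extMk_perm])

theorem ext_mk (a : g.toSpecies.CauchyPow n I) :
    δ.ext n I (g.toSpecies.extMk n I a) = g.toSpecies.extMk n I (δ.pow n I a) := rfl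

theorem ext_extMap (e : I ≃ J) (x : g.toSpecies.ExtObj n I) :
    δ.ext n J (g.toSpecies.extMap n e x) = g.toSpecies.extMap n e (δ.ext n I x) := by
  obtain ⟨a, rfl⟩ := g.toSpecies.extMk_surjective _ _ x
  rw [Species.extMap_mk, ext_mk, ext_mk, Species.extMap_mk, pow_powMap]

theorem d_ext (x : g.toSpecies.ExtObj (n + 1) I) :
    g.d n I (δ.ext (n + 1) I x) = δ.ext n I (g.d n I x) := by
  rcases n with _ | n
  · simp [d]
  · obtain ⟨a, rfl⟩ := g.toSpecies.extMk_surjective _ _ x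
    rw [ext_mk, d_mk, d_mk, powD_apply, powD_apply, map_sum]
    refine Finset.sum_congr rfl fun p _ => ?_
    rw [map_zsmul, ext_mk, ← pow_perm, merge_pow]

/-- The action of a derivation of `g` on the homology of `g`. -/
def homology (n : ℕ) : Species.Hom (g.homology n) (g.homology n) where
  app I _ := quotMap (δ.ext n I)
    (by
      rcases n with _ | n
      · intro x _; trivial
      · intro x hx
        change g.d n I _ = 0
        rw [d_ext, LinearMap.mem_ker.mp hx, map_zero])
    (by
      rintro _ ⟨y, rfl⟩
      exact ⟨_, δ.d_ext y⟩)
  naturality e x := by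
    obtain ⟨⟨a, ha⟩, rfl⟩ := Submodule.mkQ_surjective _ x
    refine congrArg (Submodule.mkQ _) (Subtype.ext ?_)
    exact δ.ext_extMap e a

end Derivation

end TwistedLieAlgebra

/-! ## The twisted Lie algebra of the Tits-Allison-Gao construction -/

open JordanAlg

namespace FreeTAG

section map

variable {k : Type u} [Field k] [CharZero k] {V : Type v} [AddCommGroup V] [Module k V]
  {W : Type w} [AddCommGroup W] [Module k W]

/-- Functoriality of `TAG(Jord(V))` in `V`. -/
def map (f : V →ₗ[k] W) : TAG k (FreeJordan k V) →ₗ⁅k⁆ TAG k (FreeJordan k W) :=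
  TAG.map (FreeJordan.map f)

theorem fst_map (f : V →ₗ[k] W) (p : TAG k (FreeJordan k V)) :
    (map f p).1 = LinearMap.lTensor (Sl2 k)
      ((FreeJordan.map f : FreeJordan k V →ₙₐ[k] FreeJordan k W) :
        FreeJordan k V →ₗ[k] FreeJordan k W) p.1 := rfl

theorem snd_map (f : V →ₗ[k] W) (p : TAG k (FreeJordan k V)) :
    (map f p).2 = BMap k (FreeJordan.map f) p.2 := rfl

theorem map_id (p : TAG k (FreeJordan k V)) : map (LinearMap.id : V →ₗ[k] V) p = p := by
  ext
  · rw [fst_map, FreeJordan.map_id]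
    exact LinearMap.lTensor_id_apply _ _ _
  · rw [snd_map, FreeJordan.map_id]
    generalize p.2 = b
    induction b using B_induction with
    | hadd x y hx hy => rw [map_add, hx, hy]
    | hsmul t x hx => rw [map_smul, hx]
    | hw a b => simp

theorem map_map {X : Type*} [AddCommGroup X] [Module k X] (f : V →ₗ[k] W) (g : W →ₗ[k] X)
    (p : TAG k (FreeJordan k V)) : map g (map f p) = map (g ∘ₗ f) p := by
  ext
  · rw [fst_map, fst_map, fst_map]
    generalize p.1 = t
    induction t using TensorProduct.induction_on with
    | zero => simp
    | add a b ha hb => simp only [map_add, ha, hb]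
    | tmul p a => simp [FreeJordan.map_map]
  · rw [snd_map, snd_map, snd_map]
    generalize p.2 = b
    induction b using B_induction with
    | hadd x y hx hy => simp only [map_add, hx, hy]
    | hsmul t x hx => simp only [map_smul, hx]
    | hw a b => simp [FreeJordan.map_map]

theorem map_slMap (f : V →ₗ[k] W) (s : Sl2 k) (p : TAG k (FreeJordan k V)) :
    map f (TAG.slMap s p) = TAG.slMap s (map f p) := by
  ext
  · rw [fst_map, TAG.fst_slMap, TAG.fst_slMap, fst_map]
    generalize p.1 = t
    induction t using TensorProduct.induction_on with
    | zero => simp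
    | add a b ha hb => simp only [map_add, ha, hb]
    | tmul p a => simp
  · rw [snd_map, TAG.snd_slMap, TAG.snd_slMap, LinearMap.map_zero]

end map

section multilinear

variable (k : Type u) [Field k] [CharZero k] {I J K : Type}

/-- The map induced by a map of sets of free generators. -/
def rename (f : I → J) : TAG k (FreeJordan k (I →₀ k)) →ₗ⁅k⁆ TAG k (FreeJordan k (J →₀ k)) :=
  map (Finsupp.lmapDomain k k f)

theorem rename_id (p : TAG k (FreeJordan k (I →₀ k))) : rename k id p = p := by
  rw [rename, Finsupp.lmapDomain_id, map_id]

theorem rename_rename (f : I → J) (g : J → K) (p : TAG k (FreeJordan k (I →₀ k))) :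
    rename k g (rename k f p) = rename k (g ∘ f) p := by
  rw [rename, rename, rename, map_map, ← Finsupp.lmapDomain_comp]

open scoped Classical in
/-- The rescaling of the vector space with basis `(x_i)` which sends `x_i` to `t x_i` and fixes the
other basis vectors. -/
def scale (i : I) (t : k) : (I →₀ k) →ₗ[k] (I →₀ k) :=
  Finsupp.linearCombination k fun j => Finsupp.single j (if j = i then t else 1)

/-- The elements of `TAG(Jord(x_i : i ∈ I)) = 𝔰𝔩₂ ⊗ Jord(x_i : i ∈ I) ⊕ B(Jord(x_i : i ∈ I))` of
degree exactly one in each generator `x_i`, that is, those multiplied by `t` when `x_i` is replaced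
by `t x_i`. -/
def multilinear (I : Type) : Submodule k (TAG k (FreeJordan k (I →₀ k))) where
  carrier := {p | ∀ (i : I) (t : k), map (scale k i t) p = t • p}
  zero_mem' i t := by simp
  add_mem' hp hq i t := by rw [map_add, hp i t, hq i t, smul_add]
  smul_mem' c p hp i t := by rw [map_smul, hp i t, smul_comm]

variable {k}

theorem scale_rename (f : I → J) (hf : Function.Injective f) (i : I) (t : k)
    (p : TAG k (FreeJordan k (I →₀ k))) :
    map (scale k (f i) t) (rename k f p) = rename k f (map (scale k i t) p) := by
  rw [rename, map_map, map_map]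
  refine congrArg (fun φ => map φ p) (Finsupp.lhom_ext' fun j => LinearMap.ext_ring ?_)
  rcases eq_or_ne j i with rfl | h
  · simp [scale]
  · simp [scale, h, hf.ne h]

theorem scale_rename_of_ne (f : I → J) (j : J) (hj : ∀ i, f i ≠ j) (t : k)
    (p : TAG k (FreeJordan k (I →₀ k))) :
    map (scale k j t) (rename k f p) = rename k f p := by
  rw [rename, map_map]
  refine congrArg (fun φ => map φ p) (Finsupp.lhom_ext' fun i => LinearMap.ext_ring ?_)
  simp [scale, hj]

theorem rename_mem (e : I ≃ J) (p : TAG k (FreeJordan k (I →₀ k))) (hp : p ∈ multilinear k I) :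
    rename k e p ∈ multilinear k J := by
  intro j t
  obtain ⟨i, rfl⟩ := e.surjective j
  rw [scale_rename e e.injective, hp i t, map_smul]

theorem lie_mem {p : TAG k (FreeJordan k (I →₀ k))} (hp : p ∈ multilinear k I)
    {q : TAG k (FreeJordan k (J →₀ k))} (hq : q ∈ multilinear k J) :
    ⁅rename k (Sum.inl : I → I ⊕ J) p, rename k (Sum.inr : J → I ⊕ J) q⁆ ∈
      multilinear k (I ⊕ J) := by
  rintro (i | j) t
  · rw [LieHom.map_lie, scale_rename _ Sum.inl_injective, hp i t, map_smul, smul_lie,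
      scale_rename_of_ne _ _ (fun _ => Sum.inr_ne_inl)]
  · rw [LieHom.map_lie, scale_rename _ Sum.inr_injective, hq j t, map_smul, lie_smul,
      scale_rename_of_ne _ _ (fun _ => Sum.inl_ne_inr)]

theorem slMap_mem (s : Sl2 k) (p : TAG k (FreeJordan k (I →₀ k))) (hp : p ∈ multilinear k I) :
    TAG.slMap s p ∈ multilinear k I := by
  intro i t
  rw [map_slMap, hp i t, map_smul]

variable (k) in
/-- Renaming of the generators. -/
def mlMap (e : I ≃ J) : multilinear k I →ₗ[k] multilinear k J :=
  LinearMap.restrict (rename k e : TAG k (FreeJordan k (I →₀ k)) →ₗ[k] _) (rename_mem e)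

theorem coe_mlMap (e : I ≃ J) (x : multilinear k I) : (mlMap k e x).1 = rename k e x.1 := rfl

variable (k) in
/-- The bracket of elements depending on disjoint sets of generators. -/
def mlBracket (I J : Type) :
    multilinear k I →ₗ[k] multilinear k J →ₗ[k] multilinear k (I ⊕ J) :=
  LinearMap.mk₂ k
    (fun x y => ⟨⁅rename k Sum.inl x.1, rename k Sum.inr y.1⁆, lie_mem x.2 y.2⟩)
    (fun x x' y => Subtype.ext (by
      change ⁅rename k _ (x.1 + x'.1), _⁆ = _
      rw [map_add, add_lie]; rfl))
    (fun t x y => Subtype.ext (by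
      change ⁅rename k _ (t • x.1), _⁆ = _
      rw [map_smul, smul_lie]; rfl))
    (fun x y y' => Subtype.ext (by
      change ⁅_, rename k _ (y.1 + y'.1)⁆ = _
      rw [map_add, lie_add]; rfl))
    (fun t x y => Subtype.ext (by
      change ⁅_, rename k _ (t • y.1)⁆ = _
      rw [map_smul, lie_smul]; rfl))

theorem coe_mlBracket (x : multilinear k I) (y : multilinear k J) : (mlBracket k I J x y).1 =
    ⁅rename k (Sum.inl : I → I ⊕ J) x.1, rename k (Sum.inr : J → I ⊕ J) y.1⁆ := rfl

end multilinear

end FreeTAG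

open FreeTAG

/-- The twisted Lie algebra `𝔰𝔩₂ ⊗ Jord ⊕ B(Jord)`: its value on `I` consists of the elements of
`TAG(Jord(x_i : i ∈ I))` of degree one in each generator, and the bracket is that of `TAG`. -/
def twistedTAG (k : Type u) [Field k] [CharZero k] : TwistedLieAlgebra.{u, u} k where
  obj I _ := multilinear k I
  map e := mlMap k e
  map_refl I _ x := Subtype.ext (rename_id k x.1)
  map_trans e f x := Subtype.ext (rename_rename k e f x.1).symm
  bracket I J _ _ := mlBracket k I J
  bracket_map e f x y := Subtype.ext (by
    rw [coe_mlMap, coe_mlBracket, coe_mlBracket, LieHom.map_lie, coe_mlMap, coe_mlMap,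
      rename_rename, rename_rename, rename_rename, rename_rename]
    rfl)
  bracket_skew {I J} _ _ x y := Subtype.ext (by
    rw [Submodule.coe_neg, coe_mlMap, coe_mlBracket, coe_mlBracket, LieHom.map_lie,
      rename_rename, rename_rename, lie_skew]
    rfl)
  jacobi {I J K} _ _ _ x y z := Subtype.ext (by
    simp only [Submodule.coe_add, coe_mlMap, coe_mlBracket, LieHom.map_lie, rename_rename]
    exact leibniz_lie _ _ _)

/-- The action of `𝔰𝔩₂` on `twistedTAG k` by derivations. -/
def twistedSlAction {k : Type u} [Field k] [CharZero k] (s : Sl2 k) :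
    (twistedTAG k).Derivation where
  app I _ := (TAG.slMap s).restrict (slMap_mem s)
  naturality e x := Subtype.ext (map_slMap _ s x.1).symm
  leibniz {I J} _ _ x y := Subtype.ext (by
    change TAG.slMap s ⁅rename k (Sum.inl : I → I ⊕ J) x.1, rename k (Sum.inr : J → I ⊕ J) y.1⁆ =
      ⁅rename k (Sum.inl : I → I ⊕ J) (TAG.slMap s x.1), rename k (Sum.inr : J → I ⊕ J) y.1⁆ +
      ⁅rename k (Sum.inl : I → I ⊕ J) x.1, rename k (Sum.inr : J → I ⊕ J) (TAG.slMap s y.1)⁆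
    rw [TAG.slMap_lie, rename, rename, map_slMap, map_slMap])

end

universe w₁ w₂ w₃

set_option linter.unusedSectionVars false

noncomputable section

open scoped TensorProduct DirectSum

/-! In characteristic zero, evaluation at `V` is an exact functor which turns Cauchy products into
tensor products and respects their symmetry. The Chevalley–Eilenberg complex is made of exterior
powers and the bracket only, so such a functor carries the complex of `g` to the complex of `g(V)`,
and exactness carries homology to homology.

Exactness is `eval_exact`. The summands of `F(V)` are coinvariants of symmetric groups. The norm,
the sum over all permutations, maps coinvariants back to `F(n) ⊗ V^{⊗ n}`, and followed by the
projection it is multiplication by `n!`. As `n!` is invertible, a question about coinvariants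
becomes one about honest tensors, where flatness of `V^{⊗ n}` over the field answers it.

Compatibility with exterior powers is `extEvalEquiv`: a decomposition of `I` with one element of `F`
on each part gives a tuple of elements of `F(V)`, and the wedge of this tuple corresponds to the
class of the decomposable tensor. Testing on such tuples suffices, because elements with unrelated
label sets can be placed on the disjoint union of these sets (`multilinearMap_ext_tuple`). The
differentials agree (`dHom_eval`) summand by summand: on both sides a summand is a signed
permutation bringing a pair to the front, followed by the bracket of the first two factors. Homology
is cycles modulo those boundaries which are cycles, and exactness, applied to the inclusion of the
cycles and to their projection to homology, yields `TwistedLieAlgebra.homologyEquiv`, which is the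
second claim. Derivations of `g` are followed through the same steps.

The first claim also needs that `twistedTAG k` has the value `TAG(Jord(V))` on `V`, as a Lie algebra
with its `𝔰𝔩₂`-action (`evalLieEquiv`). The map `evalHom` sends `(p, v)` to `p(v)`. Membership in
`multilinear` only controls rescalings of single generators; that `p(v)` is multilinear in `v`
follows from a spanning set of monomials (`exists_multilinearMap`). Surjectivity holds because every
nonassociative monomial arises from one with distinct variables by substitution. Injectivity is
polarization: `n` linear forms give a map from `V` to the space with basis `Fin n`, and the
multilinear part of the image of an element is the contraction of the norm of its degree `n`
component with these forms (`projection_map_evalHom`). Contractions detect zero, and so does the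
norm. The multilinear part is split off by rescaling the generators by distinct primes and
projecting to an eigenspace (`exists_multilinear_projection`). -/

namespace Species

/-! ### Maps out of the value of an analytic functor -/

section universal

variable {k : Type u} [Field k] {F : Species.{u, w} k} {V : Type v} [AddCommGroup V] [Module k V]
  {N : Type w₁} [AddCommGroup N] [Module k N]

/-- The universal property of `F(V)`: natural families of maps `F(I) → Hom(V^{⊗ I}, N)`. -/
def evLift (φ : ∀ (I : Type) [Finite I], F.obj I →ₗ[k] MultilinearMap k (fun _ : I => V) N)
    (hφ : ∀ (I J : Type) [Finite I] [Finite J] (e : I ≃ J) (x : F.obj I) (v : J → V),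
      φ J (F.map e x) v = φ I x (v ∘ e)) : F.Eval V →ₗ[k] N :=
  F.evalLift V fun n => F.evalDegLift V n
    (TensorProduct.lift ((PiTensorProduct.lift (R := k) (s := fun _ : Fin n => V)
      (E := N)).toLinearMap ∘ₗ φ (Fin n))) (by
      intro σ x t
      induction t using PiTensorProduct.induction_on with
      | add a b ha hb => simp only [map_add, TensorProduct.tmul_add, ha, hb]
      | smul_tprod r v =>
        simp only [map_smul, TensorProduct.tmul_smul]
        congr 1
        rw [PiTensorProduct.reindex_tprod]
        simp only [TensorProduct.lift.tmul, LinearMap.comp_apply, LinearEquiv.coe_coe,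
          PiTensorProduct.lift.tprod, hφ]
        rfl)

/-- The construction of `evLift` uses `φ` on the sets `Fin n` only; naturality along
`Finite.equivFin I` recovers its value on an arbitrary finite set. -/
theorem evLift_ev (φ : ∀ (I : Type) [Finite I], F.obj I →ₗ[k] MultilinearMap k (fun _ : I => V) N)
    (hφ : ∀ (I J : Type) [Finite I] [Finite J] (e : I ≃ J) (x : F.obj I) (v : J → V),
      φ J (F.map e x) v = φ I x (v ∘ e)) {I : Type} [Finite I] (x : F.obj I) (v : I → V) :
    evLift φ hφ (F.ev x v) = φ I x v := by
  rw [ev, F.evT_eq V _ (Finite.equivFin I), evLift, evalLift_in, evalDegLift_mk,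
    PiTensorProduct.reindex_tprod]
  simp only [TensorProduct.lift.tmul, LinearMap.comp_apply, LinearEquiv.coe_coe,
    PiTensorProduct.lift.tprod, hφ]
  congr 1
  funext i
  simp

theorem eval_hom_ext {f f' : F.Eval V →ₗ[k] N}
    (h : ∀ (n : ℕ) (x : F.obj (Fin n)) (v : Fin n → V), f (F.ev x v) = f' (F.ev x v)) : f = f' := by
  ext z
  induction z using eval_induction with
  | hev n x v => exact h n x v
  | hadd x y hx hy => rw [map_add, map_add, hx, hy]

variable (F V) in
/-- The map `(x, v) ↦ ev x v`, linear in `x` and multilinear in `v`. -/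
def evMulti (I : Type) [Finite I] : F.obj I →ₗ[k] MultilinearMap k (fun _ : I => V) (F.Eval V) :=
  (PiTensorProduct.lift (R := k) (s := fun _ : I => V) (E := F.Eval V)).symm.toLinearMap ∘ₗ
    TensorProduct.curry (F.evT V I)

theorem evMulti_apply {I : Type} [Finite I] (x : F.obj I) (v : I → V) :
    F.evMulti V I x v = F.ev x v := rfl

theorem ev_update_add {I : Type} [Finite I] [DecidableEq I] (x : F.obj I) (v : I → V) (i : I)
    (a b : V) : F.ev x (Function.update v i (a + b)) =
      F.ev x (Function.update v i a) + F.ev x (Function.update v i b) :=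
  (F.evMulti V I x).map_update_add v i a b

theorem ev_update_smul {I : Type} [Finite I] [DecidableEq I] (x : F.obj I) (v : I → V) (i : I)
    (t : k) (a : V) : F.ev x (Function.update v i (t • a)) = t • F.ev x (Function.update v i a) :=
  (F.evMulti V I x).map_update_smul v i t a

theorem ev_smul {I : Type} [Finite I] (t : k) (x : F.obj I) (v : I → V) :
    F.ev (t • x) v = t • F.ev x v := by
  rw [← evMulti_apply, map_smul]; rfl

theorem ev_zero {I : Type} [Finite I] (v : I → V) : F.ev (0 : F.obj I) v = 0 := by
  rw [← evMulti_apply, map_zero]; rfl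

theorem ev_sum {I : Type} [Finite I] {A : Type*} (s : Finset A) (x : A → F.obj I) (v : I → V) :
    F.ev (∑ a ∈ s, x a) v = ∑ a ∈ s, F.ev (x a) v := by
  simp only [← evMulti_apply, map_sum, sum_apply]

theorem ev_zsmul {I : Type} [Finite I] (t : ℤ) (x : F.obj I) (v : I → V) :
    F.ev (t • x) v = t • F.ev x v := by
  simp only [← evMulti_apply, map_zsmul]; rfl

end universal

/-! ### Morphisms of species and the grading of `F(V)` -/

section hom

variable {k : Type u} [Field k] {F G : Species.{u, w} k} {V : Type v} [AddCommGroup V] [Module k V]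

theorem Hom.eval_ev (η : Hom F G) {I : Type} [Finite I] (x : F.obj I) (v : I → V) :
    η.eval V (F.ev x v) = G.ev (η.app I x) v := by
  rw [ev, F.evT_eq V _ (Finite.equivFin I), Hom.eval, evalLift_in, LinearMap.comp_apply,
    evalDegLift_mk, LinearMap.comp_apply, LinearMap.rTensor_tmul, η.naturality, ev,
    G.evT_eq V _ (Finite.equivFin I)]

/-- The component of degree `n` of the map induced by a morphism of species. -/
def Hom.evalDeg (V : Type v) [AddCommGroup V] [Module k V] (η : Hom F G) (n : ℕ) :
    F.EvalDeg V n →ₗ[k] G.EvalDeg V n :=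
  F.evalDegLift V n (G.evalMk V n ∘ₗ (η.app (Fin n)).rTensor (⨂[k] _ : Fin n, V)) (by
      intro σ x t
      simp only [LinearMap.comp_apply, LinearMap.rTensor_tmul]
      rw [η.naturality, G.evalMk_symm])

theorem Hom.evalDeg_mk (η : Hom F G) (n : ℕ) (a : F.obj (Fin n) ⊗[k] (⨂[k] _ : Fin n, V)) :
    η.evalDeg V n (F.evalMk V n a) =
      G.evalMk V n ((η.app (Fin n)).rTensor (⨂[k] _ : Fin n, V) a) := rfl

theorem Hom.eval_in (η : Hom F G) (n : ℕ) (a : F.EvalDeg V n) :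
    η.eval V (F.evalIn V n a) = G.evalIn V n (η.evalDeg V n a) :=
  F.evalLift_in V _ n a

variable (F V) in
/-- The projection to the homogeneous component of degree `n`. -/
def evalProj (n : ℕ) : F.Eval V →ₗ[k] F.EvalDeg V n :=
  DirectSum.component k ℕ (F.EvalDeg V) n

theorem evalProj_in_self (n : ℕ) (a : F.EvalDeg V n) : F.evalProj V n (F.evalIn V n a) = a :=
  DirectSum.component.lof_self k n a

theorem evalProj_in_of_ne {n m : ℕ} (h : m ≠ n) (a : F.EvalDeg V n) :
    F.evalProj V m (F.evalIn V n a) = 0 := by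
  classical
  refine (DirectSum.component.of k m n a).trans (dif_neg h.symm)

theorem eval_sum_in (z : F.Eval V) :
    ∃ s : Finset ℕ, z = ∑ n ∈ s, F.evalIn V n (F.evalProj V n z) := by
  classical
  exact ⟨_, (DirectSum.sum_support_of (β := F.EvalDeg V) z).symm⟩

theorem evalProj_ext {z z' : F.Eval V} (h : ∀ n, F.evalProj V n z = F.evalProj V n z') : z = z' :=
  DFinsupp.ext h

theorem Hom.evalProj_eval (η : Hom F G) (n : ℕ) (z : F.Eval V) :
    G.evalProj V n (η.eval V z) = η.evalDeg V n (F.evalProj V n z) := by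
  obtain ⟨s, hs⟩ := eval_sum_in z
  have key : ∀ m (a : F.EvalDeg V m), G.evalProj V n (η.eval V (F.evalIn V m a)) =
      η.evalDeg V n (F.evalProj V n (F.evalIn V m a)) := by
    intro m a
    rw [Hom.eval_in]
    rcases eq_or_ne n m with rfl | h
    · rw [evalProj_in_self, evalProj_in_self]
    · rw [evalProj_in_of_ne h, evalProj_in_of_ne h, map_zero]
  rw [hs]
  simp only [map_sum, key]

end hom

/-! ### The norm map and exactness of evaluation in characteristic zero -/

section norm

variable {k : Type u} [Field k] (F : Species.{u, w} k) (V : Type v) [AddCommGroup V] [Module k V]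

/-- The diagonal action of a permutation on `F(n) ⊗ V^{⊗ n}`. -/
def diag {n : ℕ} (σ : Equiv.Perm (Fin n)) : F.obj (Fin n) ⊗[k] (⨂[k] _ : Fin n, V) →ₗ[k]
    F.obj (Fin n) ⊗[k] (⨂[k] _ : Fin n, V) :=
  TensorProduct.map (F.map σ) (PiTensorProduct.reindex k (fun _ => V) σ).toLinearMap

/-- The norm map of `F(n) ⊗ V^{⊗ n}`. -/
def norm (n : ℕ) : F.obj (Fin n) ⊗[k] (⨂[k] _ : Fin n, V) →ₗ[k]
    F.obj (Fin n) ⊗[k] (⨂[k] _ : Fin n, V) := ∑ σ : Equiv.Perm (Fin n), F.diag V σ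

theorem norm_apply (n : ℕ) (a : F.obj (Fin n) ⊗[k] (⨂[k] _ : Fin n, V)) :
    F.norm V n a = ∑ σ : Equiv.Perm (Fin n), F.diag V σ a := LinearMap.sum_apply _ _ _

theorem evalMk_diag {n : ℕ} (σ : Equiv.Perm (Fin n))
    (a : F.obj (Fin n) ⊗[k] (⨂[k] _ : Fin n, V)) :
    F.evalMk V n (F.diag V σ a) = F.evalMk V n a := by
  induction a using TensorProduct.induction_on with
  | zero => simp
  | add a b ha hb => simp only [map_add, ha, hb]
  | tmul x t => exact F.evalMk_map V n σ x t

/-- In the coinvariants all the translates of `a` by permutations coincide, and there are `n!` of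
them. -/
theorem evalMk_norm (n : ℕ) (a : F.obj (Fin n) ⊗[k] (⨂[k] _ : Fin n, V)) :
    F.evalMk V n (F.norm V n a) = (n.factorial : k) • F.evalMk V n a := by
  rw [norm_apply, map_sum]
  simp only [evalMk_diag]
  rw [Finset.sum_const, Finset.card_univ, Fintype.card_perm, Fintype.card_fin,
    Nat.cast_smul_eq_nsmul]

theorem diag_diag {n : ℕ} (σ τ : Equiv.Perm (Fin n))
    (a : F.obj (Fin n) ⊗[k] (⨂[k] _ : Fin n, V)) :
    F.diag V τ (F.diag V σ a) = F.diag V (τ * σ) a := by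
  induction a using TensorProduct.induction_on with
  | zero => simp
  | add a b ha hb => simp only [map_add, ha, hb]
  | tmul x t =>
    simp only [diag, TensorProduct.map_tmul, LinearEquiv.coe_coe]
    rw [reindex_comp, ← F.map_trans]
    rfl

theorem norm_diag {n : ℕ} (σ : Equiv.Perm (Fin n))
    (a : F.obj (Fin n) ⊗[k] (⨂[k] _ : Fin n, V)) :
    F.norm V n (F.diag V σ a) = F.norm V n a := by
  rw [norm_apply, norm_apply]
  simp only [diag_diag]
  exact Equiv.sum_comp (Equiv.mulRight σ) fun τ => F.diag V τ a

/-- The norm map from coinvariants to invariants. -/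
def normBar (n : ℕ) : F.EvalDeg V n →ₗ[k] F.obj (Fin n) ⊗[k] (⨂[k] _ : Fin n, V) :=
  F.evalDegLift V n (F.norm V n) (by
    intro σ x t
    rw [← F.norm_diag V σ (F.map σ.symm x ⊗ₜ t)]
    simp only [diag, TensorProduct.map_tmul, LinearEquiv.coe_coe]
    rw [← F.map_trans, Equiv.symm_trans_self, F.map_refl])

theorem normBar_mk (n : ℕ) (a : F.obj (Fin n) ⊗[k] (⨂[k] _ : Fin n, V)) :
    F.normBar V n (F.evalMk V n a) = F.norm V n a := rfl

variable {F V}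

/-- By `evalMk_norm`, a vanishing norm kills `n!` times the class. A class of coinvariants can
therefore be tested on its norm, which is an actual tensor; injectivity of `evalHom` rests on this.
-/
theorem eq_zero_of_norm_eq_zero [CharZero k] {n : ℕ}
    {a : F.obj (Fin n) ⊗[k] (⨂[k] _ : Fin n, V)} (h : F.norm V n a = 0) : F.evalMk V n a = 0 := by
  have h1 := F.evalMk_norm V n a
  rw [h, map_zero] at h1
  exact (smul_eq_zero.mp h1.symm).resolve_left (Nat.cast_ne_zero.mpr n.factorial_ne_zero)

theorem norm_rTensor {G : Species.{u, w} k} (η : Hom F G) (n : ℕ)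
    (a : F.obj (Fin n) ⊗[k] (⨂[k] _ : Fin n, V)) :
    G.norm V n ((η.app (Fin n)).rTensor _ a) = (η.app (Fin n)).rTensor _ (F.norm V n a) := by
  rw [norm_apply, norm_apply, map_sum]
  refine Finset.sum_congr rfl fun σ _ => ?_
  induction a using TensorProduct.induction_on with
  | zero => simp
  | add a b ha hb => simp only [map_add, ha, hb]
  | tmul x t => simp [diag, η.naturality]

/-- In characteristic zero, evaluation of analytic functors is exact. -/
theorem eval_exact [CharZero k] {G H : Species.{u, w} k} (η : Hom F G) (ξ : Hom G H)
    (h : ∀ n, Function.Exact (η.app (Fin n)) (ξ.app (Fin n))) :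
    Function.Exact (η.eval V) (ξ.eval V) := by
  intro z
  constructor
  · intro hz
    have key : ∀ n, G.evalIn V n (G.evalProj V n z) ∈ LinearMap.range (η.eval V) := by
      intro n
      have hn : ξ.evalDeg V n (G.evalProj V n z) = 0 := by
        rw [← Hom.evalProj_eval, hz, map_zero]
      obtain ⟨a, ha⟩ := G.evalMk_surjective V n (G.evalProj V n z)
      rw [← ha] at hn ⊢
      rw [Hom.evalDeg_mk] at hn
      -- The image of `a` vanishes only modulo the relations, but the image of its norm vanishes
      -- outright, so exactness of tensoring with `V^{⊗ n}` applies to the norm.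
      have h1 : (ξ.app (Fin n)).rTensor (⨂[k] _ : Fin n, V) (G.norm V n a) = 0 := by
        rw [← norm_rTensor, ← normBar_mk, hn, map_zero]
      obtain ⟨b, hb⟩ := (Module.Flat.rTensor_exact (⨂[k] _ : Fin n, V) (h n) _).mp h1
      have h2 : (n.factorial : k) ≠ 0 := Nat.cast_ne_zero.mpr n.factorial_ne_zero
      -- The element `b` maps to the norm of `a`, whose class is `n!` times that of `a`; hence the
      -- factor.
      refine ⟨(n.factorial : k)⁻¹ • F.evalIn V n (F.evalMk V n b), ?_⟩
      rw [map_smul, Hom.eval_in, Hom.evalDeg_mk, hb, evalMk_norm, map_smul, smul_smul,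
        inv_mul_cancel₀ h2, one_smul]
    obtain ⟨s, hs⟩ := eval_sum_in z
    change z ∈ LinearMap.range (η.eval V)
    rw [hs]
    exact Submodule.sum_mem _ fun n _ => key n
  · rintro ⟨y, rfl⟩
    have : ξ.eval V ∘ₗ η.eval V = 0 := eval_hom_ext fun n x v => by
      rw [LinearMap.comp_apply, Hom.eval_ev, Hom.eval_ev, (h n).apply_apply_eq_zero, ev_zero]
      rfl
    exact DFunLike.congr_fun this y

theorem eval_surjective {G : Species.{u, w} k} (η : Hom F G)
    (h : ∀ n, Function.Surjective (η.app (Fin n))) : Function.Surjective (η.eval V) := by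
  rw [← LinearMap.range_eq_top, eq_top_iff]
  rintro z -
  induction z using eval_induction with
  | hev n x v =>
    obtain ⟨y, rfl⟩ := h n x
    exact ⟨F.ev y v, η.eval_ev y v⟩
  | hadd x y hx hy => exact add_mem hx hy

theorem eval_injective [CharZero k] {G : Species.{u, w} k} (η : Hom F G)
    (h : ∀ n, Function.Injective (η.app (Fin n))) : Function.Injective (η.eval V) := by
  -- Injectivity is exactness at `F` of a sequence whose first map is zero; the zero endomorphism of
  -- `F` serves as that map.
  let o : Hom F F := { app := fun _ _ => 0, naturality := fun e x => (map_zero (F.map e)).symm }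
  have := eval_exact (V := V) o η fun n x => by
    constructor
    · intro hx
      exact ⟨0, ((injective_iff_map_eq_zero _).mp (h n) x hx).symm⟩
    · rintro ⟨y, rfl⟩
      exact map_zero _
  rw [injective_iff_map_eq_zero]
  intro z hz
  obtain ⟨y, rfl⟩ := (this z).mp hz
  have h0 : o.eval V = 0 := eval_hom_ext fun n x v => by
    rw [Hom.eval_ev]
    exact ev_zero v
  rw [h0]; rfl

end norm

end Species

namespace Species

/-! ### Pairings of species and the bilinear maps they induce -/

section product

variable {k : Type u} [Field k] {F : Species.{u, w₁} k} {G : Species.{u, w₂} k}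
  {H : Species.{u, w₃} k} {V : Type v} [AddCommGroup V] [Module k V]

/-- Natural bilinear maps `F(I) × G(J) → H(I ⊔ J)`, that is, maps from the Cauchy product. -/
structure Pairing (F : Species.{u, w₁} k) (G : Species.{u, w₂} k) (H : Species.{u, w₃} k) where
  app : (I J : Type) → [Finite I] → [Finite J] → F.obj I →ₗ[k] G.obj J →ₗ[k] H.obj (I ⊕ J)
  naturality : ∀ {I I' J J' : Type} [Finite I] [Finite I'] [Finite J] [Finite J'] (e : I ≃ I')
    (f : J ≃ J') (x : F.obj I) (y : G.obj J),
    app I' J' (F.map e x) (G.map f y) = H.map (e.sumCongr f) (app I J x y)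

namespace Pairing

variable (μ : Pairing F G H)

/-- Pairing of `F(I)`, with labels in `V`, with `G(V)`. -/
def evalRight {I : Type} [Finite I] (x : F.obj I) (v : I → V) : G.Eval V →ₗ[k] H.Eval V :=
  evLift (fun J _ =>
    { toFun := fun y =>
        { toFun := fun w => H.ev (μ.app I J x y) (Sum.elim v w)
          map_update_add' := by
            intro _ w j a b
            classical
            simp only [Sum.elim_update_right, ev_update_add]
          map_update_smul' := by
            intro _ w j t a
            classical
            simp only [Sum.elim_update_right, ev_update_smul] }
      map_add' := fun y y' => by ext w; simp [ev_add]
      map_smul' := fun t y => by ext w; simp [ev_smul] }) (by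
    intro J J' _ _ e y w
    have h := μ.naturality (Equiv.refl I) e x y
    rw [F.map_refl] at h
    simp only [LinearMap.coe_mk, AddHom.coe_mk, MultilinearMap.coe_mk]
    rw [h, H.ev_map]
    congr 1
    funext i
    rcases i with i | i <;> rfl)

theorem evalRight_ev {I J : Type} [Finite I] [Finite J] (x : F.obj I) (v : I → V) (y : G.obj J)
    (w : J → V) : μ.evalRight x v (G.ev y w) = H.ev (μ.app I J x y) (Sum.elim v w) :=
  evLift_ev _ _ _ _

/-- The bilinear map `F(V) × G(V) → H(V)` induced by a pairing. -/
def eval (V : Type v) [AddCommGroup V] [Module k V] : F.Eval V →ₗ[k] G.Eval V →ₗ[k] H.Eval V :=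
  evLift (fun I _ =>
    { toFun := fun x =>
        { toFun := fun v => μ.evalRight x v
          map_update_add' := by
            intro _ v i a b
            classical
            refine eval_hom_ext fun n y w => ?_
            simp only [LinearMap.add_apply, evalRight_ev, Sum.elim_update_left,
              ev_update_add]
          map_update_smul' := by
            intro _ v i t a
            classical
            refine eval_hom_ext fun n y w => ?_
            simp only [LinearMap.smul_apply, evalRight_ev, Sum.elim_update_left,
              ev_update_smul] }
      map_add' := fun x x' => by
        ext1 v
        refine eval_hom_ext fun n y w => ?_
        simp [evalRight_ev, ev_add]
      map_smul' := fun t x => by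
        ext1 v
        refine eval_hom_ext fun n y w => ?_
        simp [evalRight_ev, ev_smul] }) (by
    intro I I' _ _ e x v
    refine eval_hom_ext fun n y w => ?_
    have h := μ.naturality e (Equiv.refl _) x y
    rw [G.map_refl] at h
    simp only [LinearMap.coe_mk, AddHom.coe_mk, MultilinearMap.coe_mk, evalRight_ev]
    rw [h, H.ev_map]
    congr 1
    funext i
    rcases i with i | i <;> rfl)

theorem eval_ev {I J : Type} [Finite I] [Finite J] (x : F.obj I) (v : I → V) (y : G.obj J)
    (w : J → V) : μ.eval V (F.ev x v) (G.ev y w) = H.ev (μ.app I J x y) (Sum.elim v w) := by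
  rw [← evalRight_ev]
  exact DFunLike.congr_fun (evLift_ev _ _ x v) _

end Pairing

end product

/-! ### Tensor powers for the Cauchy product and their evaluation -/

section pow

variable {k : Type u} [Field k] (F : Species.{u, w} k)

/-- The `n`-th tensor power of `F` with respect to the Cauchy product. -/
def powSpecies (n : ℕ) : Species.{u, max u w} k where
  obj I _ := F.CauchyPow n I
  map e := F.powMap e
  map_refl _ _ x := F.powMap_refl x
  map_trans e f x := F.powMap_trans e f x

/-- The quotient map from the tensor power to the exterior power. -/
def extHom (n : ℕ) : Hom (F.powSpecies n) (F.extPow n) where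
  app I _ := F.extMk n I
  naturality _ _ := rfl

variable {n : ℕ} {I J : Type} [Finite I] [Finite J]

/-- The decomposition of `I ⊔ J` with first part `I` and the other ones from a decomposition
of `J`. -/
def consIdx (I : Type) (f : J → Fin n) : I ⊕ J → Fin (n + 1) :=
  Sum.elim (fun _ => 0) (Fin.succ ∘ f)

/-- The first part of `consIdx`. -/
def consEquivZero (I : Type) (f : J → Fin n) : I ≃ {i // consIdx I f i = 0} :=
  Equiv.ofBijective (fun i => ⟨Sum.inl i, rfl⟩) (by
    constructor
    · intro i i' h
      exact Sum.inl_injective (congrArg Subtype.val h)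
    · rintro ⟨i | j, h⟩
      · exact ⟨i, rfl⟩
      · exact absurd h (Fin.succ_ne_zero _))

/-- The other parts of `consIdx`. -/
def consEquivSucc (I : Type) (f : J → Fin n) (l : Fin n) :
    {j // f j = l} ≃ {i // consIdx I f i = l.succ} :=
  Equiv.ofBijective (fun j => ⟨Sum.inr j.1, congrArg Fin.succ j.2⟩) (by
    constructor
    · intro i i' h
      exact Subtype.ext (Sum.inr_injective (congrArg Subtype.val h))
    · rintro ⟨i | j, h⟩
      · exact absurd h.symm (Fin.succ_ne_zero _)
      · exact ⟨⟨j, Fin.succ_injective _ h⟩, rfl⟩)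

/-- The factors of `x ⊗ (y_0 ⊗ y_1 ⊗ ⋯)`. -/
def consTuple (f : J → Fin n) (x : F.obj I) (y : ∀ j, F.obj {i // f i = j}) :
    ∀ j, F.obj {i // consIdx I f i = j} :=
  Fin.cons (α := fun j => F.obj {i // consIdx I f i = j}) (F.map (consEquivZero I f) x)
    (fun l => F.map (consEquivSucc I f l) (y l))

/-- The map `y_0 ⊗ y_1 ⊗ ⋯ ↦ x ⊗ y_0 ⊗ y_1 ⊗ ⋯`. -/
def consMap (n : ℕ) (J : Type) [Finite J] (x : F.obj I) :
    F.CauchyPow n J →ₗ[k] F.CauchyPow (n + 1) (I ⊕ J) :=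
  F.powLift fun f => ((F.gen (consIdx I f)).curryLeft (F.map (consEquivZero I f) x)).compLinearMap
    fun l => F.map (consEquivSucc I f l)

theorem consMap_gen (f : J → Fin n) (x : F.obj I) (y : ∀ j, F.obj {i // f i = j}) :
    F.consMap n J x (F.gen f y) = F.gen (consIdx I f) (F.consTuple f x y) :=
  F.powLift_gen _ _ _

theorem pow_hom_ext {N : Type*} [AddCommGroup N] [Module k N] {φ ψ : F.CauchyPow n I →ₗ[k] N}
    (h : ∀ (f : I → Fin n) (x : ∀ j, F.obj {i // f i = j}), φ (F.gen f x) = ψ (F.gen f x)) :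
    φ = ψ := LinearMap.ext (F.pow_ext h)

variable (I J) in
/-- The bilinear map `(x, y_0 ⊗ y_1 ⊗ ⋯) ↦ x ⊗ y_0 ⊗ y_1 ⊗ ⋯`. -/
def consLin (n : ℕ) : F.obj I →ₗ[k] F.CauchyPow n J →ₗ[k] F.CauchyPow (n + 1) (I ⊕ J) where
  toFun x := F.consMap n J x
  map_add' x x' := F.pow_hom_ext fun f y => by
    rw [LinearMap.add_apply, consMap_gen, consMap_gen, consMap_gen]
    simp only [consTuple, map_add]
    exact (F.gen _).cons_add _ _ _
  map_smul' t x := F.pow_hom_ext fun f y => by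
    rw [LinearMap.smul_apply, consMap_gen, consMap_gen]
    simp only [consTuple, map_smul]
    exact (F.gen _).cons_smul _ _ _

theorem consMap_powMap {I' J' : Type} [Finite I'] [Finite J'] (e : I ≃ I') (e' : J ≃ J')
    (x : F.obj I) (y : F.CauchyPow n J) : F.consMap n J' (F.map e x) (F.powMap e' y) =
      F.powMap (e.sumCongr e') (F.consMap n J x y) := by
  refine F.pow_ext (φ := F.consMap n J' (F.map e x) ∘ₗ F.powMap e')
    (ψ := F.powMap (e.sumCongr e') ∘ₗ F.consMap n J x) (fun f y => ?_) y
  rw [LinearMap.comp_apply, LinearMap.comp_apply, powMap_gen, consMap_gen, consMap_gen,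
    powMap_gen, F.gen_congr (f := consIdx I' (f ∘ e'.symm))
      (f' := consIdx I f ∘ (e.sumCongr e').symm) (by rintro (i | i) <;> rfl)]
  refine congrArg (F.gen _) (funext fun j => ?_)
  refine Fin.cases ?_ (fun l => ?_) j
  · simp only [consTuple, Fin.cons_zero]
    rw [map_map, map_map, map_map]
    refine F.map_congr (fun i => ?_) _
    rfl
  · simp only [consTuple, Fin.cons_succ]
    rw [map_map, map_map, map_map]
    refine F.map_congr (fun i => ?_) _
    rfl

/-- The pairing `F · F^n → F^{n+1}` for the Cauchy product. -/
def consPairing (n : ℕ) : Pairing F (F.powSpecies n) (F.powSpecies (n + 1)) where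
  app I J _ _ := F.consLin I J n
  naturality e e' x y := F.consMap_powMap e e' x y

section

variable {V : Type v} [AddCommGroup V] [Module k V]

/-- The class in `F^n(V)` of an element of `F^n(I)` with the entries labelled by `v`. -/
def powEv (a : F.CauchyPow n I) (v : I → V) : (F.powSpecies n).Eval V :=
  (F.powSpecies n).ev (I := I) a v

theorem powEv_powMap (e : I ≃ J) (a : F.CauchyPow n I) (v : J → V) :
    F.powEv (F.powMap e a) v = F.powEv a (v ∘ e) := (F.powSpecies n).ev_map e a v

theorem consPairing_eval_ev (x : F.obj I) (v : I → V) (a : F.CauchyPow n J) (w : J → V) :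
    (F.consPairing n).eval V (F.ev x v) (F.powEv a w) =
      F.powEv (F.consMap n J x a) (Sum.elim v w) :=
  (F.consPairing n).eval_ev x v (J := J) a w

end

variable (V : Type v) [AddCommGroup V] [Module k V]

/-- The map `F(V) × ⋯ × F(V) → F^n(V)`. -/
def powMul : (n : ℕ) → MultilinearMap k (fun _ : Fin n => F.Eval V) ((F.powSpecies n).Eval V)
  | 0 => MultilinearMap.constOfIsEmpty k _ (F.powEv (F.gen (id : Fin 0 → Fin 0) fun j => j.elim0)
      Fin.elim0)
  | n + 1 => LinearMap.uncurryLeft (M := fun _ : Fin (n + 1) => F.Eval V)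
      { toFun := fun x => ((F.consPairing n).eval V x).compMultilinearMap (powMul n)
        map_add' := fun x y => by ext v; simp
        map_smul' := fun t x => by ext v; simp }

theorem powMul_succ (x : Fin (n + 1) → F.Eval V) : F.powMul V (n + 1) x =
    (F.consPairing n).eval V (x 0) (F.powMul V n (Fin.tail x)) := rfl

variable {V}

/-- A finite set as the union of the first part of a decomposition and the rest. -/
def splitEquiv (f : I → Fin (n + 1)) : {i // f i = 0} ⊕ {i // f i ≠ 0} ≃ I :=
  Equiv.sumCompl fun i => f i = 0

/-- The parts of a decomposition except for the first one. -/
def splitEquivSucc (f : I → Fin (n + 1)) (l : Fin n) : {i // f i = l.succ} ≃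
    {i : {i // f i ≠ 0} // (f i.1).pred i.2 = l} where
  toFun i := ⟨⟨i.1, by rw [i.2]; exact Fin.succ_ne_zero l⟩, by simp [i.2]⟩
  invFun i := ⟨i.1.1, by
    have h := congrArg Fin.succ i.2
    rwa [Fin.succ_pred] at h⟩
  left_inv _ := rfl
  right_inv _ := rfl

/-- This frees `powMul` from its recursive definition: its value on the factors of a decomposition
does not depend on how the parts were split off. The recursion peels off the part over `0` and
applies the induction hypothesis to the complement of that part, so the set `I` has to vary.
Transport along `splitEquiv f` turns the resulting decomposition back into `f`, and all relabellings
of the factors compose to the identity. -/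
theorem powMul_ev (n : ℕ) : ∀ (I : Type) [Finite I] (f : I → Fin n)
    (x : ∀ j, F.obj {i // f i = j}) (v : I → V),
    F.powMul V n (fun j => F.ev (x j) fun i => v i.1) =
      F.powEv (F.gen f x) v := by
  induction n with
  | zero =>
    intro I _ f x v
    -- A set decomposed into no parts is empty, whereas the empty product was defined on `Fin 0`;
    -- the two are matched by the unique bijection.
    have : IsEmpty I := f.isEmpty
    let e : Fin 0 ≃ I := Equiv.equivOfIsEmpty _ _
    have h := F.powEv_powMap e (F.gen (id : Fin 0 → Fin 0) fun j => j.elim0) v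
    refine Eq.trans ?_ (h.symm.trans ?_)
    · exact congrArg (F.powEv _) (Subsingleton.elim _ _)
    · rw [powMap_gen, F.gen_congr (f' := f) (fun i => (f i).elim0)]
      congr 2
      funext j
      exact j.elim0
  | succ n ih =>
    intro I _ f x v
    -- The decomposition of the rest, with the numbers of its parts lowered by one.
    let f' : {i // f i ≠ 0} → Fin n := fun i => (f i.1).pred i.2
    let x' : ∀ l, F.obj {i // f' i = l} := fun l => F.map (splitEquivSucc f l) (x l.succ)
    have h := ih {i // f i ≠ 0} f' x' (fun i => v i.1)
    have h' : Fin.tail (fun j => F.ev (x j) fun i => v i.1) =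
        fun l => F.ev (x' l) fun i => v i.1.1 := by
      funext l
      rw [ev_map]; rfl
    rw [powMul_succ, h', h, consPairing_eval_ev]
    have h2 := F.powEv_powMap (splitEquiv f) (F.consMap n _ (x 0) (F.gen f' x')) v
    refine Eq.trans ?_ (h2.symm.trans ?_)
    · congr 1
      funext i
      rcases i with i | i <;> rfl
    · have hidx : ∀ i, (consIdx {i // f i = 0} f' ∘ (splitEquiv f).symm) i = f i := by
        intro i
        obtain ⟨i, rfl⟩ := (splitEquiv f).surjective i
        rw [Function.comp_apply, Equiv.symm_apply_apply]
        rcases i with i | i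
        · exact i.2.symm
        · exact Fin.succ_pred _ i.2
      rw [consMap_gen, powMap_gen, F.gen_congr hidx]
      congr 2
      funext j
      refine Fin.cases ?_ (fun l => ?_) j
      · simp only [consTuple, Fin.cons_zero]
        rw [map_map, map_map]
        exact F.map_self (fun i => rfl) _
      · simp only [consTuple, Fin.cons_succ, x']
        rw [map_map, map_map, map_map]
        exact F.map_self (fun i => rfl) _

end pow
end Species

namespace Species

open ChevalleyEilenberg

/-! ### Exterior powers commute with evaluation -/

section exterior

variable {k : Type u} [Field k] [CharZero k] {F : Species.{u, w} k} {V : Type v} [AddCommGroup V]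
  [Module k V] {N : Type w₁} [AddCommGroup N] [Module k N] {n : ℕ} {I J : Type} [Finite I]
  [Finite J]

/-- The tuple of elements of `F(V)` given by a decomposable element of `F^n(I)` and labels
in `V`. -/
def tuple (f : I → Fin n) (x : ∀ j, F.obj {i // f i = j}) (v : I → V) : Fin n → F.Eval V :=
  fun j => F.ev (x j) fun i => v i.1

theorem span_ev : Submodule.span k
    (Set.range fun p : Σ n : ℕ, F.obj (Fin n) × (Fin n → V) => F.ev p.2.1 p.2.2) = ⊤ := by
  rw [eq_top_iff]
  rintro z -
  induction z using eval_induction with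
  | hev n x v => exact Submodule.subset_span ⟨⟨n, x, v⟩, rfl⟩
  | hadd x y hx hy => exact add_mem hx hy

/-- By multilinearity it suffices to test on tuples of elements `ev x_j v_j` with `x_j` in `F (Fin
m_j)`. The finite sets are unrelated, but on the disjoint union of the `Fin m_j`, decomposed by the
index `j`, such a family becomes a single `tuple`. -/
theorem multilinearMap_ext_tuple {φ ψ : MultilinearMap k (fun _ : Fin n => F.Eval V) N}
    (h : ∀ (I : Type) [Finite I] (f : I → Fin n) (x : ∀ j, F.obj {i // f i = j}) (v : I → V),
      φ (tuple f x v) = ψ (tuple f x v)) : φ = ψ := by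
  refine MultilinearMap.ext_of_span_eq_top (fun _ => span_ev (F := F) (V := V)) fun p => ?_
  let e : ∀ j, Fin (p j).1 ≃ {i : Σ j, Fin (p j).1 // i.1 = j} := fun j =>
    { toFun := fun i => ⟨⟨j, i⟩, rfl⟩
      invFun := fun i => i.2 ▸ i.1.2
      left_inv := fun _ => rfl
      right_inv := by rintro ⟨⟨j, i⟩, rfl⟩; rfl }
  have hp : (fun j => F.ev (p j).2.1 (p j).2.2) =
      tuple (I := Σ j, Fin (p j).1) Sigma.fst (fun j => F.map (e j) (p j).2.1)
        (fun i => (p i.1).2.2 i.2) := by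
    funext j
    rw [tuple, ev_map]
    rfl
  rw [hp]
  exact h _ _ _ _

theorem tuple_perm (f : I → Fin n) (x : ∀ j, F.obj {i // f i = j}) (v : I → V)
    (σ : Equiv.Perm (Fin n)) : tuple f x v ∘ σ.symm = tuple (σ ∘ f) (fun j =>
      F.map (Equiv.subtypeEquivRight fun i => by simp [Equiv.eq_symm_apply]) (x (σ.symm j))) v := by
  funext j
  simp only [tuple, Function.comp_apply]
  rw [ev_map]
  rfl

/-- The class in `Λ^n(F)(V)` of an element of `Λ^n(F)(I)` with the entries labelled by `v`. -/
def extEv (a : F.ExtObj n I) (v : I → V) : (F.extPow n).Eval V := (F.extPow n).ev (I := I) a v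

theorem extHom_eval_powEv (a : F.CauchyPow n I) (v : I → V) :
    (F.extHom n).eval V (F.powEv a v) = extEv (F.extMk n I a) v :=
  (F.extHom n).eval_ev (I := I) a v

variable (F V) in
/-- The map `F(V) × ⋯ × F(V) → Λ^n(F)(V)`. -/
def extMulti (n : ℕ) : MultilinearMap k (fun _ : Fin n => F.Eval V) ((F.extPow n).Eval V) :=
  ((F.extHom n).eval V).compMultilinearMap (F.powMul V n)

theorem extMulti_tuple (f : I → Fin n) (x : ∀ j, F.obj {i // f i = j}) (v : I → V) :
    extMulti F V n (tuple f x v) = extEv (F.extMk n I (F.gen f x)) v := by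
  rw [extMulti, LinearMap.compMultilinearMap_apply, ← extHom_eval_powEv, ← powMul_ev]
  rfl

/-- On tuples, a permutation of the entries becomes `perm` on the Cauchy power, and `extMk` replaces
`perm` by the sign. -/
theorem extMulti_perm (τ : Equiv.Perm (Fin n)) (z : Fin n → F.Eval V) :
    extMulti F V n (z ∘ τ) = (Equiv.Perm.sign τ : ℤ) • extMulti F V n z := by
  -- The double inverse puts the permutation in the form `σ.symm` expected by `tuple_perm`, with `σ
  -- = τ.symm`.
  suffices h : (extMulti F V n).domDomCongr τ.symm.symm =
      (Equiv.Perm.sign τ : ℤ) • extMulti F V n from DFunLike.congr_fun h z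
  refine multilinearMap_ext_tuple fun I _ f x v => ?_
  change extMulti F V n (tuple f x v ∘ τ.symm.symm) =
    (Equiv.Perm.sign τ : ℤ) • extMulti F V n (tuple f x v)
  rw [tuple_perm, extMulti_tuple, extMulti_tuple, ← perm_gen, extMk_perm, Equiv.Perm.sign_symm]
  exact (F.extPow n).ev_zsmul _ _ _

variable (F V) in
/-- The map `Λ^n(F(V)) → Λ^n(F)(V)`. -/
def extEval (n : ℕ) : ⋀[k]^n (F.Eval V) →ₗ[k] (F.extPow n).Eval V :=
  exteriorPower.alternatingMapLinearEquiv (alternatingOfPerm (extMulti F V n) extMulti_perm)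

theorem extEval_ιMulti (z : Fin n → F.Eval V) :
    extEval F V n (exteriorPower.ιMulti k n z) = extMulti F V n z :=
  exteriorPower.alternatingMapLinearEquiv_apply_ιMulti _ _

/-- The parts are disjoint, so the label of `i` occurs in the factor numbered `f i` and in no other.
Multilinearity of a wedge in all the labels thus reduces to multilinearity in one factor. -/
theorem tuple_update_labels [DecidableEq I] (f : I → Fin n) (x : ∀ j, F.obj {i // f i = j})
    (v : I → V) (i : I) (a : V) : tuple f x (Function.update v i a) =
      Function.update (tuple f x v) (f i)
        (F.ev (x (f i)) (Function.update (fun i' : {i' // f i' = f i} => v i'.1) ⟨i, rfl⟩ a)) := by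
  funext j
  rcases eq_or_ne j (f i) with rfl | h
  · rw [Function.update_self, tuple]
    congr 1
    funext i'
    simp [Function.update_apply, Subtype.ext_iff]
  · rw [Function.update_of_ne h, tuple, tuple]
    congr 1
    funext i'
    rw [Function.update_of_ne]
    rintro rfl
    exact h i'.2.symm

theorem tuple_update (f : I → Fin n) (x : ∀ j, F.obj {i // f i = j})
    (v : I → V) (j : Fin n) (y : F.obj {i // f i = j}) : tuple f (Function.update x j y) v =
      Function.update (tuple f x v) j (F.ev y fun i => v i.1) := by
  funext l
  rcases eq_or_ne l j with rfl | h
  · rw [Function.update_self, tuple, Function.update_self]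
  · rw [Function.update_of_ne h, tuple, Function.update_of_ne h, tuple]

/-- The decomposable tensors span: the quotient map by their span vanishes on each of them, and
linear maps on the Cauchy power are determined by these values. -/
theorem pow_induction {p : F.CauchyPow n I → Prop}
    (hgen : ∀ (f : I → Fin n) (x : ∀ j, F.obj {i // f i = j}), p (F.gen f x))
    (hzero : p 0) (hadd : ∀ a b, p a → p b → p (a + b)) (hsmul : ∀ (t : k) a, p a → p (t • a))
    (a : F.CauchyPow n I) : p a := by
  set S := Submodule.span k {a | ∃ (f : I → Fin n) (x : ∀ j, F.obj {i // f i = j}), F.gen f x = a}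
    with hS
  have h : S.mkQ = 0 := F.pow_hom_ext fun f x =>
    (Submodule.Quotient.mk_eq_zero _).mpr (Submodule.subset_span ⟨f, x, rfl⟩)
  have ha : a ∈ S := (Submodule.Quotient.mk_eq_zero S).mp (DFunLike.congr_fun h a)
  induction ha using Submodule.span_induction with
  | mem a ha => obtain ⟨f, x, rfl⟩ := ha; exact hgen f x
  | zero => exact hzero
  | add a b _ _ ha hb => exact hadd a b ha hb
  | smul t a _ ha => exact hsmul t a ha

variable (V) in
/-- The map `(x, v) ↦ ∧ⱼ ev (x_j) (v restricted to the part j)`. -/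
def wedgeGen (f : I → Fin n) : MultilinearMap k (fun j => F.obj {i // f i = j})
    (MultilinearMap k (fun _ : I => V) (⋀[k]^n (F.Eval V))) where
  toFun x :=
    { toFun := fun v => exteriorPower.ιMulti k n (tuple f x v)
      map_update_add' := fun v i a b => by
        simp only [tuple_update_labels, ev_update_add, AlternatingMap.map_update_add]
      map_update_smul' := fun v i t a => by
        simp only [tuple_update_labels, ev_update_smul, AlternatingMap.map_update_smul] }
  map_update_add' := fun {inst} x j y y' => by
    -- A `MultilinearMap` must be additive for any decidable equality on the index set; the given
    -- one is replaced by the standard one, for which `tuple_update` is stated.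
    obtain rfl : inst = fun a b => instDecidableEqFin n a b := Subsingleton.elim _ _
    ext1 v
    simp only [tuple_update, ev_add, AlternatingMap.map_update_add, MultilinearMap.coe_mk,
      add_apply]
  map_update_smul' := fun {inst} x j t y => by
    obtain rfl : inst = fun a b => instDecidableEqFin n a b := Subsingleton.elim _ _
    ext1 v
    simp only [tuple_update, ev_smul, AlternatingMap.map_update_smul, MultilinearMap.coe_mk,
      smul_apply]

variable (F V) in
/-- The map `F^n(I) → Hom(V^{⊗ I}, Λ^n(F(V)))`. -/
def wedgePow (n : ℕ) (I : Type) [Finite I] :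
    F.CauchyPow n I →ₗ[k] MultilinearMap k (fun _ : I => V) (⋀[k]^n (F.Eval V)) :=
  F.powLift (N := MultilinearMap k (fun _ : I => V) (⋀[k]^n (F.Eval V))) fun f => wedgeGen V f

theorem wedgePow_gen (f : I → Fin n) (x : ∀ j, F.obj {i // f i = j}) (v : I → V) :
    wedgePow F V n I (F.gen f x) v = exteriorPower.ιMulti k n (tuple f x v) := by
  rw [wedgePow, powLift_gen]
  rfl

theorem wedgePow_perm (σ : Equiv.Perm (Fin n)) (a : F.CauchyPow n I) :
    wedgePow F V n I (F.perm σ a) = (Equiv.Perm.sign σ : ℤ) • wedgePow F V n I a := by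
  induction a using pow_induction with
  | hzero => rw [map_zero, map_zero, smul_zero]
  | hadd a b ha hb => rw [map_add, map_add, map_add, ha, hb, smul_add]
  | hsmul t a ha =>
    rw [map_smul, map_smul, map_smul, ha]
    ext1 v
    exact smul_comm t (Equiv.Perm.sign σ : ℤ) (wedgePow F V n I a v)
  | hgen f x =>
    ext1 v
    rw [perm_gen, wedgePow_gen, ← tuple_perm, AlternatingMap.map_perm, Equiv.Perm.sign_symm]
    refine Eq.trans ?_ (congrArg ((Equiv.Perm.sign σ : ℤ) • ·) (wedgePow_gen f x v)).symm
    rfl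

theorem wedgePow_powMap (e : I ≃ J) (a : F.CauchyPow n I) (v : J → V) :
    wedgePow F V n J (F.powMap e a) v = wedgePow F V n I a (v ∘ e) := by
  induction a using pow_induction with
  | hzero => rw [map_zero, map_zero, map_zero]; rfl
  | hadd a b ha hb =>
    rw [map_add, map_add, map_add, add_apply, add_apply, ha, hb]
  | hsmul t a ha =>
    rw [map_smul, map_smul, map_smul, smul_apply, smul_apply, ha]
  | hgen f x =>
    rw [powMap_gen, wedgePow_gen, wedgePow_gen]
    congr 1
    funext j
    rw [tuple, ev_map]
    rfl

variable (F V) in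
/-- The map `Λ^n(F)(I) → Hom(V^{⊗ I}, Λ^n(F(V)))`. -/
def wedgeExt (n : ℕ) (I : Type) [Finite I] :
    F.ExtObj n I →ₗ[k] MultilinearMap k (fun _ : I => V) (⋀[k]^n (F.Eval V)) :=
  F.extLift (N := MultilinearMap k (fun _ : I => V) (⋀[k]^n (F.Eval V))) (wedgePow F V n I)
    wedgePow_perm

variable (F V) in
/-- The map `Λ^n(F)(V) → Λ^n(F(V))`. -/
def extEvalInv (n : ℕ) : (F.extPow n).Eval V →ₗ[k] ⋀[k]^n (F.Eval V) :=
  evLift (F := F.extPow n) (fun I _ => wedgeExt F V n I) (by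
    intro I J _ _ e x v
    obtain ⟨a, rfl⟩ := F.extMk_surjective n I x
    exact wedgePow_powMap e a v)

theorem extEvalInv_ev (f : I → Fin n) (x : ∀ j, F.obj {i // f i = j}) (v : I → V) :
    extEvalInv F V n (extEv (F.extMk n I (F.gen f x)) v) =
      exteriorPower.ιMulti k n (tuple f x v) :=
  (evLift_ev (F := F.extPow n) _ _ _ v).trans (wedgePow_gen f x v)

theorem extEval_tuple (f : I → Fin n) (x : ∀ j, F.obj {i // f i = j}) (v : I → V) :
    extEval F V n (exteriorPower.ιMulti k n (tuple f x v)) =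
      extEv (F.extMk n I (F.gen f x)) v := by
  rw [extEval_ιMulti, extMulti_tuple]

theorem exteriorPower_hom_ext_tuple {φ ψ : ⋀[k]^n (F.Eval V) →ₗ[k] N}
    (h : ∀ (I : Type) [Finite I] (f : I → Fin n) (x : ∀ j, F.obj {i // f i = j}) (v : I → V),
      φ (exteriorPower.ιMulti k n (tuple f x v)) = ψ (exteriorPower.ιMulti k n (tuple f x v))) :
    φ = ψ := by
  refine exteriorPower.linearMap_ext (AlternatingMap.coe_multilinearMap_injective ?_)
  exact multilinearMap_ext_tuple h

/-- Classes of decomposable tensors with labels span the evaluation of the exterior power. Together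
with `exteriorPower_hom_ext_tuple` this reduces the inverse laws for `extEvalEquiv` to elements
where both maps are explicit. -/
theorem extEval_hom_ext {φ ψ : (F.extPow n).Eval V →ₗ[k] N}
    (h : ∀ (m : ℕ) (f : Fin m → Fin n) (x : ∀ j, F.obj {i // f i = j}) (v : Fin m → V),
      φ (extEv (F.extMk n _ (F.gen f x)) v) = ψ (extEv (F.extMk n _ (F.gen f x)) v)) :
    φ = ψ := by
  refine eval_hom_ext fun m y v => ?_
  obtain ⟨a, rfl⟩ := F.extMk_surjective n (Fin m) y
  have hl : ∀ (χ : (F.extPow n).Eval V →ₗ[k] N) (t : k) (b : F.CauchyPow n (Fin m)),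
      χ (extEv (F.extMk n _ (t • b)) v) = t • χ (extEv (F.extMk n _ b) v) := fun χ t b => by
    rw [map_smul, ← map_smul χ]; exact congrArg χ ((F.extPow n).ev_smul t _ v)
  change φ (extEv (F.extMk n _ a) v) = ψ (extEv (F.extMk n _ a) v)
  induction a using pow_induction with
  | hzero => rw [← zero_smul k (0 : F.CauchyPow n (Fin m)), hl, hl, zero_smul, zero_smul]
  | hadd a b ha hb =>
    have hadd : ∀ (χ : (F.extPow n).Eval V →ₗ[k] N), χ (extEv (F.extMk n _ (a + b)) v) =
      χ (extEv (F.extMk n _ a) v) + χ (extEv (F.extMk n _ b) v) := fun χ => by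
      rw [map_add, ← map_add χ]; exact congrArg χ ((F.extPow n).ev_add _ _ v)
    rw [hadd, hadd, ha, hb]
  | hsmul t a ha => rw [hl, hl, ha]
  | hgen f x => exact h m f x v

variable (F V) in
/-- The isomorphism `Λ^n(F(V)) ≃ Λ^n(F)(V)`. -/
def extEvalEquiv (n : ℕ) : ⋀[k]^n (F.Eval V) ≃ₗ[k] (F.extPow n).Eval V :=
  LinearEquiv.ofLinearMap (extEval F V n) (extEvalInv F V n)
    (extEval_hom_ext fun m f x v => by
      rw [LinearMap.comp_apply, extEvalInv_ev, extEval_tuple, LinearMap.id_apply])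
    (exteriorPower_hom_ext_tuple fun I _ f x v => by
      rw [LinearMap.comp_apply, extEval_tuple, extEvalInv_ev, LinearMap.id_apply])

theorem extEvalEquiv_tuple (f : I → Fin n) (x : ∀ j, F.obj {i // f i = j}) (v : I → V) :
    extEvalEquiv F V n (exteriorPower.ιMulti k n (tuple f x v)) =
      extEv (F.extMk n I (F.gen f x)) v := extEval_tuple f x v

theorem extEvalEquiv_map {W : Type v} [AddCommGroup W] [Module k W] (f : V →ₗ[k] W)
    (z : ⋀[k]^n (F.Eval V)) : extEvalEquiv F W n (exteriorPower.map n (F.evalMap f) z) =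
      (F.extPow n).evalMap f (extEvalEquiv F V n z) := by
  suffices h : (extEvalEquiv F W n).toLinearMap ∘ₗ exteriorPower.map n (F.evalMap f) =
      (F.extPow n).evalMap f ∘ₗ (extEvalEquiv F V n).toLinearMap from DFunLike.congr_fun h z
  refine exteriorPower_hom_ext_tuple fun I _ g x v => ?_
  have h1 : F.evalMap f ∘ tuple g x v = tuple g x (f ∘ v) := by
    funext j
    exact F.evalMap_ev f _ _
  simp only [LinearMap.comp_apply, LinearEquiv.coe_coe]
  rw [exteriorPower.map_apply_ιMulti, h1, extEvalEquiv_tuple, extEvalEquiv_tuple]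
  exact ((F.extPow n).evalMap_ev f _ _).symm

end exterior
end Species

/-! ### Composition and naturality of evaluated morphisms -/

namespace Species

variable {k : Type u} [Field k] {F G H : Species.{u, w} k} {V W : Type v} [AddCommGroup V]
  [Module k V] [AddCommGroup W] [Module k W]

/-- Composition of morphisms of species. -/
def Hom.comp (ξ : Hom G H) (η : Hom F G) : Hom F H where
  app I _ := ξ.app I ∘ₗ η.app I
  naturality e x := by
    rw [LinearMap.comp_apply, LinearMap.comp_apply, η.naturality, ξ.naturality]

theorem Hom.eval_comp (ξ : Hom G H) (η : Hom F G) (z : F.Eval V) :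
    (ξ.comp η).eval V z = ξ.eval V (η.eval V z) := by
  suffices h : (ξ.comp η).eval V = ξ.eval V ∘ₗ η.eval V from DFunLike.congr_fun h z
  refine eval_hom_ext fun n x v => ?_
  rw [LinearMap.comp_apply, eval_ev, eval_ev, eval_ev]
  rfl

theorem Hom.eval_evalMap (η : Hom F G) (f : V →ₗ[k] W) (z : F.Eval V) :
    η.eval W (F.evalMap f z) = G.evalMap f (η.eval V z) := by
  suffices h : η.eval W ∘ₗ F.evalMap f = G.evalMap f ∘ₗ η.eval V from DFunLike.congr_fun h z
  refine eval_hom_ext fun n x v => ?_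
  rw [LinearMap.comp_apply, LinearMap.comp_apply, eval_ev, evalMap_ev, evalMap_ev, eval_ev]

theorem Hom.eval_eq_zero (η : Hom F G) (h : ∀ n, η.app (Fin n) = 0) : η.eval V = 0 :=
  eval_hom_ext fun n x v => by
    rw [eval_ev, h]
    exact ev_zero v

end Species

/-! ### Comparison of the two Chevalley–Eilenberg differentials -/

namespace ChevalleyEilenberg

/-- Each summand is written through the permutation bringing its pair to the front. This is the
shape of `powD_apply`, so that the two differentials can be compared one summand at a time. -/
theorem d_ιMulti_eq (k : Type u) [Field k] [CharZero k] {L : Type v} [LieRing L] [LieAlgebra k L]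
    (n : ℕ) (x : Fin (n + 2) → L) :
    d k L (n + 1) (exteriorPower.ιMulti k (n + 2) x) =
    ∑ p ∈ pairs n, (Equiv.Perm.sign (pairPerm p.1 p.2) : ℤ) •
      bracketFirst k L n (x ∘ (pairPerm p.1 p.2).symm) := by
  refine Eq.trans ?_ (dMulti_eq k n x)
  rw [d, exteriorPower.alternatingMapLinearEquiv_apply_ιMulti]
  rfl

end ChevalleyEilenberg

namespace TwistedLieAlgebra

open ChevalleyEilenberg Species

variable {k : Type u} [Field k] [CharZero k] (g : TwistedLieAlgebra.{u, w} k) (V : Type v)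
  [AddCommGroup V] [Module k V]

/-- The isomorphism `Λ^n(g(V)) ≃ Λ^n(g)(V)`. -/
def lieExtEquiv (n : ℕ) : ⋀[k]^n (g.LieEval V) ≃ₗ[k] (g.toSpecies.extPow n).Eval V :=
  extEvalEquiv g.toSpecies V n

/-- The tuple of elements of `g(V)` given by a decomposable element of `g^n(I)` and labels
in `V`. -/
abbrev lieTuple {V : Type v} [AddCommGroup V] [Module k V] {n : ℕ} {I : Type} [Finite I]
    (f : I → Fin n) (x : ∀ j, g.obj {i // f i = j}) (v : I → V) : Fin n → g.LieEval V :=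
  tuple (F := g.toSpecies) f x v

/-- The Chevalley-Eilenberg differential, as a morphism of species. -/
def dHom (n : ℕ) : Hom (g.toSpecies.extPow (n + 1)) (g.toSpecies.extPow n) where
  app I _ := g.d n I
  naturality e x := g.d_extMap e x

variable {V}

theorem lieExtEquiv_tuple {n : ℕ} {I : Type} [Finite I]
    (f : I → Fin n) (x : ∀ j, g.obj {i // f i = j}) (v : I → V) :
    g.lieExtEquiv V n (exteriorPower.ιMulti k n (g.lieTuple f x v)) =
      extEv (g.toSpecies.extMk n I (g.toSpecies.gen f x)) v := extEvalEquiv_tuple f x v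

theorem lieExt_hom_ext {n : ℕ} {N : Type*} [AddCommGroup N] [Module k N]
    {φ ψ : ⋀[k]^n (g.LieEval V) →ₗ[k] N}
    (h : ∀ (I : Type) [Finite I] (f : I → Fin n) (x : ∀ j, g.obj {i // f i = j}) (v : I → V),
      φ (exteriorPower.ιMulti k n (g.lieTuple f x v)) =
        ψ (exteriorPower.ιMulti k n (g.lieTuple f x v))) : φ = ψ :=
  exteriorPower_hom_ext_tuple h

/-- In `g(V)` the bracket of two labelled elements is the labelled bracket on the disjoint union of
their index sets. The bijection `mergeEquiv` identifies that union with the merged part of `I`, and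
the labels are unchanged. -/
theorem bracketFirst_lieTuple {n : ℕ} {I : Type} [Finite I]
    (f : I → Fin (n + 2)) (x : ∀ j, g.obj {i // f i = j}) (v : I → V) :
    bracketFirst k (g.LieEval V) n (g.lieTuple f x v) =
      exteriorPower.ιMulti k (n + 1) (g.lieTuple (mergeIdx n ∘ f) (g.mergeTuple f x) v) := by
  rw [bracketFirst_apply]
  congr 1
  funext j
  refine Fin.cases ?_ (fun l => ?_) j
  · refine (g.evalBracket_ev (x 0) (x 1) _ _).trans ?_
    simp only [lieTuple, tuple, mergeTuple, Fin.cons_zero]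
    refine Eq.trans ?_ (g.toSpecies.ev_map (mergeEquiv f) _ _).symm
    congr 1
    funext i
    rcases i with i | i <;> rfl
  · simp only [lieTuple, tuple, mergeTuple, Fin.cons_succ]
    exact (g.toSpecies.ev_map (mergeEquivSucc f l) (x l.succ.succ) fun i => v i.1).symm

theorem extEv_sum_zsmul {n : ℕ} {I : Type} [Finite I] {A : Type*} (s : Finset A) (c : A → ℤ)
    (a : A → g.toSpecies.ExtObj n I) (v : I → V) :
    extEv (∑ p ∈ s, c p • a p) v = ∑ p ∈ s, c p • extEv (a p) v := by
  refine ((g.toSpecies.extPow n).ev_sum s (fun p => c p • a p) v).trans ?_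
  exact Finset.sum_congr rfl fun p _ => (g.toSpecies.extPow n).ev_zsmul _ _ _

/-- Permuting a tuple corresponds to `perm` (`tuple_perm`) and bracketing its first two entries
corresponds to `merge` (`bracketFirst_lieTuple`). With the same signs and the same index set of
pairs, the two sums agree termwise. -/
theorem dHom_eval (n : ℕ) (z : ⋀[k]^(n + 1) (g.LieEval V)) :
    (g.dHom n).eval V (g.lieExtEquiv V (n + 1) z) =
      g.lieExtEquiv V n (ChevalleyEilenberg.d k (g.LieEval V) n z) := by
  rcases n with _ | n
  -- Both differentials from degree one to degree zero are zero by definition.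
  · rw [Hom.eval_eq_zero (g.dHom 0) fun _ => rfl]
    exact (map_zero (g.lieExtEquiv V 0)).symm
  · suffices h : (g.dHom (n + 1)).eval V ∘ₗ (g.lieExtEquiv V (n + 2)).toLinearMap =
        (g.lieExtEquiv V (n + 1)).toLinearMap ∘ₗ ChevalleyEilenberg.d k (g.LieEval V) (n + 1) from
      DFunLike.congr_fun h z
    refine g.lieExt_hom_ext fun I _ f x v => ?_
    simp only [LinearMap.comp_apply, LinearEquiv.coe_coe]
    rw [lieExtEquiv_tuple, d_ιMulti_eq, map_sum]
    refine ((g.dHom (n + 1)).eval_ev (I := I) _ v).trans ?_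
    change extEv (g.powD n I (g.toSpecies.gen f x)) v = _
    rw [powD_apply, extEv_sum_zsmul]
    refine Finset.sum_congr rfl fun p _ => ?_
    rw [map_zsmul, Species.perm_gen, merge_gen, ← lieExtEquiv_tuple, ← bracketFirst_lieTuple]
    congr 3
    exact (tuple_perm (F := g.toSpecies) f x v (pairPerm p.1 p.2)).symm

theorem lieExtEquiv_map {W : Type v} [AddCommGroup W] [Module k W] (f : V →ₗ[k] W) {n : ℕ}
    (z : ⋀[k]^n (g.LieEval V)) :
    g.lieExtEquiv W n (exteriorPower.map n (g.lieEvalMap f : g.LieEval V →ₗ[k] g.LieEval W) z) =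
      (g.toSpecies.extPow n).evalMap f (g.lieExtEquiv V n z) :=
  extEvalEquiv_map f z

/-! ### Derivations of a twisted Lie algebra and of its value -/

namespace Derivation

variable {g} (δ : g.Derivation)

theorem eval_evalBracket (a b : g.toSpecies.Eval V) : δ.toHom.eval V (g.evalBracket V a b) =
    g.evalBracket V (δ.toHom.eval V a) b + g.evalBracket V a (δ.toHom.eval V b) := by
  induction a using Species.eval_induction with
  | hadd a b ha hb => simp only [map_add, LinearMap.add_apply, ha, hb]; abel
  | hev n x v =>
    induction b using Species.eval_induction with
    | hadd a b ha hb => simp only [map_add, ha, hb]; abel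
    | hev m y w =>
      rw [Hom.eval_ev, Hom.eval_ev, evalBracket_ev, evalBracket_ev, evalBracket_ev, Hom.eval_ev,
        ← Species.ev_add, δ.leibniz]

variable (V) in
/-- The derivation of the Lie algebra `g(V)` induced by a derivation of `g`. -/
def lieEval : LieDerivation k (g.LieEval V) (g.LieEval V) where
  toLinearMap := δ.toHom.eval V
  leibniz' a b := by
    -- The Leibniz rule of a `LieDerivation` reads `⁅a, D b⁆ - ⁅b, D a⁆`; skew symmetry gives the
    -- usual form.
    rw [← lie_skew b, sub_neg_eq_add, add_comm]
    exact δ.eval_evalBracket a b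

/-- The action of a derivation on the exterior power, as a morphism of species. -/
def extHom (n : ℕ) : Hom (g.toSpecies.extPow n) (g.toSpecies.extPow n) where
  app I _ := δ.ext n I
  naturality e x := δ.ext_extMap e x

/-- Both operators are sums over the factors in which one factor at a time is replaced by its image
under `δ`; by `tuple_update` the terms with the same position match. -/
theorem extHom_eval {n : ℕ} (z : ⋀[k]^n (g.LieEval V)) :
    g.lieExtEquiv V n (derExt k (δ.lieEval V : g.LieEval V →ₗ[k] g.LieEval V) n z) =
      (δ.extHom n).eval V (g.lieExtEquiv V n z) := by
  suffices h : (g.lieExtEquiv V n).toLinearMap ∘ₗ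
      derExt k (δ.lieEval V : g.LieEval V →ₗ[k] g.LieEval V) n =
      (δ.extHom n).eval V ∘ₗ (g.lieExtEquiv V n).toLinearMap from DFunLike.congr_fun h z
  refine g.lieExt_hom_ext fun I _ f x v => ?_
  simp only [LinearMap.comp_apply, LinearEquiv.coe_coe]
  rw [lieExtEquiv_tuple, derExt_ιMulti, map_sum]
  refine Eq.trans ?_ ((δ.extHom n).eval_ev (I := I) _ v).symm
  change _ = extEv (δ.ext n I (g.toSpecies.extMk n I (g.toSpecies.gen f x))) v
  rw [ext_mk, pow_gen, map_sum]
  refine Eq.trans ?_ ((g.toSpecies.extPow n).ev_sum _ (fun j => g.toSpecies.extMk n I _) v).symm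
  refine Finset.sum_congr rfl fun j _ => ?_
  refine Eq.trans ?_ (g.lieExtEquiv_tuple f _ v)
  congr 2
  refine Eq.trans ?_ (tuple_update (F := g.toSpecies) f x v j _).symm
  refine congrArg (Function.update _ j) ?_
  exact δ.toHom.eval_ev _ _

end Derivation

end TwistedLieAlgebra

namespace TwistedLieAlgebra

open ChevalleyEilenberg Species

/-! ### Homology commutes with evaluation -/

section homology

variable {k : Type u} [Field k] [CharZero k] (g : TwistedLieAlgebra.{u, w} k)

/-- The differential with source the `n`-th term of the Chevalley-Eilenberg complex. -/
def dOut : (n : ℕ) → Hom (g.toSpecies.extPow n) (g.toSpecies.extPow (n - 1))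
  -- Since `0 - 1 = 0`, the target here is again `extPow 0`. The zero map makes everything in degree
  -- zero a cycle, so cycles are the kernel of a morphism of species in every degree.
  | 0 => { app := fun _ _ => 0, naturality := fun e _ => (map_zero ((g.toSpecies.extPow 0).map e)).symm }
  | n + 1 => g.dHom n

theorem cycles_eq_ker (n : ℕ) (I : Type) [Finite I] :
    g.cycles n I = LinearMap.ker ((g.dOut n).app I) := by
  rcases n with _ | n
  · exact LinearMap.ker_zero.symm
  · rfl

/-- The cycles, as a species. -/
def cyclesSpecies (n : ℕ) : Species.{u, max u w} k where
  obj I _ := g.cycles n I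
  map e := (g.toSpecies.extMap n e).restrict (g.extMap_cycles e n)
  map_refl I _ x := Subtype.ext ((g.toSpecies.extPow n).map_refl I x.1)
  map_trans e f x := Subtype.ext ((g.toSpecies.extPow n).map_trans e f x.1)

/-- The inclusion of the cycles. -/
def cyclesIncl (n : ℕ) : Hom (g.cyclesSpecies n) (g.toSpecies.extPow n) where
  app I _ := (g.cycles n I).subtype
  naturality _ _ := rfl

/-- The projection from the cycles to the homology. -/
def cyclesProj (n : ℕ) : Hom (g.cyclesSpecies n) (g.homology n) where
  app I _ := ((LinearMap.range (g.d n I)).submoduleOf (g.cycles n I)).mkQ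
  naturality _ _ := rfl

/-- The elements whose differential is a cycle, as a species. -/
def preCycles (n : ℕ) : Species.{u, max u w} k where
  obj I _ := (g.cycles n I).comap (g.d n I)
  map e := (g.toSpecies.extMap (n + 1) e).restrict (fun x hx => by
    change g.d n _ (g.toSpecies.extMap (n + 1) e x) ∈ g.cycles n _
    rw [d_extMap]
    exact g.extMap_cycles e n _ hx)
  map_refl I _ x := Subtype.ext ((g.toSpecies.extPow (n + 1)).map_refl I x.1)
  map_trans e f x := Subtype.ext ((g.toSpecies.extPow (n + 1)).map_trans e f x.1)

/-- The inclusion of the elements whose differential is a cycle. -/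
def preCyclesIncl (n : ℕ) : Hom (g.preCycles n) (g.toSpecies.extPow (n + 1)) where
  app I _ := ((g.cycles n I).comap (g.d n I)).subtype
  naturality _ _ := rfl

/-- The differential, with values in the cycles. -/
def preCyclesD (n : ℕ) : Hom (g.preCycles n) (g.cyclesSpecies n) where
  app I _ := (g.d n I).restrict fun _ hx => hx
  naturality e x := Subtype.ext (g.d_extMap e x.1)

variable {V : Type v} [AddCommGroup V] [Module k V]

theorem cyclesIncl_exact (n : ℕ) :
    Function.Exact ((g.cyclesIncl n).eval V) ((g.dOut n).eval V) :=
  eval_exact _ _ fun m x => by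
    have h : x ∈ g.cycles n (Fin m) ↔ (g.dOut n).app (Fin m) x = 0 := by
      rw [cycles_eq_ker]; rfl
    rw [← h]
    exact ⟨fun hx => ⟨⟨x, hx⟩, rfl⟩, fun ⟨y, hy⟩ => hy ▸ y.2⟩

/-- The homology is the quotient of the cycles by the boundaries which lie among the cycles.
Restricting the differential to the elements with a cycle as their image gives these boundaries, and
describing those elements as a kernel lets them pass through evaluation. In this form the identity
`d ∘ d = 0` is never needed. -/
theorem preCyclesIncl_exact (n : ℕ) : Function.Exact ((g.preCyclesIncl n).eval V)
    (((g.dOut n).comp (g.dHom n)).eval V) :=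
  eval_exact _ _ fun m x => by
    have h : g.d n (Fin m) x ∈ g.cycles n (Fin m) ↔
        ((g.dOut n).comp (g.dHom n)).app (Fin m) x = 0 := by
      rw [cycles_eq_ker]; rfl
    rw [← h]
    exact ⟨fun hx => ⟨⟨x, hx⟩, rfl⟩, fun ⟨y, hy⟩ => hy ▸ y.2⟩

/-- With surjectivity of the projection this is a presentation of the homology by species, and it
survives evaluation by `eval_exact`. -/
theorem cyclesProj_exact (n : ℕ) :
    Function.Exact ((g.preCyclesD n).eval V) ((g.cyclesProj n).eval V) :=
  eval_exact _ _ fun m x => by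
    have h : (g.cyclesProj n).app (Fin m) x = 0 ↔ x.1 ∈ LinearMap.range (g.d n (Fin m)) :=
      Submodule.Quotient.mk_eq_zero _
    rw [h]
    constructor
    · rintro ⟨y, hy⟩
      exact ⟨⟨y, show g.d n (Fin m) y ∈ _ from hy ▸ x.2⟩, Subtype.ext hy⟩
    · rintro ⟨y, rfl⟩
      exact ⟨y.1, rfl⟩

theorem cyclesIncl_injective (n : ℕ) : Function.Injective ((g.cyclesIncl n).eval V) :=
  eval_injective _ fun _ => Subtype.val_injective

theorem cyclesProj_surjective (n : ℕ) : Function.Surjective ((g.cyclesProj n).eval V) :=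
  eval_surjective _ fun _ => Submodule.mkQ_surjective _

/-- Evaluation preserves the kernel `cyclesSpecies`, and the isomorphism `lieExtEquiv` intertwines
the differentials. In degree zero both conditions are empty. -/
theorem mem_cycles_iff (n : ℕ) (x : ⋀[k]^n (g.LieEval V)) :
    x ∈ ChevalleyEilenberg.cycles k (g.LieEval V) n ↔
      ∃ y, (g.cyclesIncl n).eval V y = g.lieExtEquiv V n x := by
  refine Iff.trans ?_ (g.cyclesIncl_exact n (g.lieExtEquiv V n x))
  rcases n with _ | n
  · rw [Hom.eval_eq_zero (g.dOut 0) fun _ => rfl]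
    exact ⟨fun _ => rfl, fun _ => trivial⟩
  · change _ ↔ (g.dHom n).eval V _ = 0
    rw [dHom_eval, LinearEquiv.map_eq_zero_iff]
    rfl

/-- A diagram chase: a preimage of `x` under the differential comes from `preCycles`, since its
differential is the cycle `y`; injectivity of the evaluated inclusion of cycles then shows that `y`
itself is hit by `preCyclesD`. The converse reads the same square backwards. -/
theorem mem_range_iff (n : ℕ) (x : ⋀[k]^n (g.LieEval V)) (y : (g.cyclesSpecies n).Eval V)
    (hy : (g.cyclesIncl n).eval V y = g.lieExtEquiv V n x) :
    x ∈ LinearMap.range (ChevalleyEilenberg.d k (g.LieEval V) n) ↔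
      (g.cyclesProj n).eval V y = 0 := by
  have hcomm : ∀ b, (g.cyclesIncl n).eval V ((g.preCyclesD n).eval V b) =
      (g.dHom n).eval V ((g.preCyclesIncl n).eval V b) := by
    intro b
    rw [← Hom.eval_comp, ← Hom.eval_comp]
    rfl
  constructor
  · rintro ⟨w, rfl⟩
    rw [← dHom_eval] at hy
    -- The composite of the two differentials kills `w` because the image of `w` is, by `hy`, an
    -- evaluated cycle.
    obtain ⟨b, hb⟩ := (g.preCyclesIncl_exact n (g.lieExtEquiv V (n + 1) w)).mp (by
      rw [Hom.eval_comp, ← hy]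
      exact (g.cyclesIncl_exact n _).mpr ⟨y, rfl⟩)
    rw [← hb, ← hcomm] at hy
    exact (g.cyclesProj_exact n y).mpr ⟨b, (g.cyclesIncl_injective n hy).symm⟩
  · intro h
    obtain ⟨b, rfl⟩ := (g.cyclesProj_exact n y).mp h
    refine ⟨(g.lieExtEquiv V (n + 1)).symm ((g.preCyclesIncl n).eval V b), ?_⟩
    apply (g.lieExtEquiv V n).injective
    rw [← dHom_eval, LinearEquiv.apply_symm_apply, ← hy, hcomm]

variable (V) in
/-- The cycles of the species represent the cycles of the Lie algebra `g(V)`. -/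
def cyclesMap (n : ℕ) :
    (g.cyclesSpecies n).Eval V →ₗ[k] ChevalleyEilenberg.cycles k (g.LieEval V) n :=
  LinearMap.codRestrict _ ((g.lieExtEquiv V n).symm.toLinearMap ∘ₗ (g.cyclesIncl n).eval V)
    fun y => (g.mem_cycles_iff n _).mpr ⟨y, by
      rw [LinearMap.comp_apply, LinearEquiv.coe_coe, LinearEquiv.apply_symm_apply]⟩

theorem lieExtEquiv_cyclesMap (n : ℕ) (y : (g.cyclesSpecies n).Eval V) :
    (g.cyclesIncl n).eval V y = g.lieExtEquiv V n (g.cyclesMap V n y).1 :=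
  ((g.lieExtEquiv V n).apply_symm_apply _).symm

variable (V) in
/-- The map from the value of the cycles to the homology of `g(V)`. -/
def cyclesToHomology (n : ℕ) : (g.cyclesSpecies n).Eval V →ₗ[k] LieHomology k (g.LieEval V) n :=
  Submodule.mkQ _ ∘ₗ g.cyclesMap V n

theorem cyclesToHomology_surjective (n : ℕ) : Function.Surjective (g.cyclesToHomology V n) := by
  intro z
  obtain ⟨⟨x, hx⟩, rfl⟩ := Submodule.mkQ_surjective _ z
  obtain ⟨y, hy⟩ := (g.mem_cycles_iff n x).mp hx
  refine ⟨y, congrArg (Submodule.mkQ _) (Subtype.ext ?_)⟩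
  apply (g.lieExtEquiv V n).injective
  rw [← lieExtEquiv_cyclesMap, hy]

/-- The homology of `g(V)` and the value of the homology of `g` are both quotients of the value of
the cycles; equality of the two kernels identifies them. -/
theorem ker_cyclesToHomology (n : ℕ) : LinearMap.ker (g.cyclesToHomology V n) =
    LinearMap.ker ((g.cyclesProj n).eval V) := by
  ext y
  refine (Submodule.Quotient.mk_eq_zero _).trans ?_
  exact g.mem_range_iff n _ y (g.lieExtEquiv_cyclesMap n y)

variable (V) in
/-- The homology of `g(V)` is the value on `V` of the homology of `g`. -/
def homologyEquiv (n : ℕ) : LieHomology k (g.LieEval V) n ≃ₗ[k] (g.homology n).Eval V :=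
  ((g.cyclesToHomology V n).quotKerEquivOfSurjective (g.cyclesToHomology_surjective n)).symm ≪≫ₗ
    Submodule.quotEquivOfEq _ _ (g.ker_cyclesToHomology n) ≪≫ₗ
    ((g.cyclesProj n).eval V).quotKerEquivOfSurjective (g.cyclesProj_surjective n)

/-- This computes the isomorphism on representing cycles; naturality and compatibility with
derivations are reduced to it. -/
theorem homologyEquiv_cyclesToHomology (n : ℕ) (y : (g.cyclesSpecies n).Eval V) :
    g.homologyEquiv V n (g.cyclesToHomology V n y) = (g.cyclesProj n).eval V y := by
  have h : ((g.cyclesToHomology V n).quotKerEquivOfSurjective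
      (g.cyclesToHomology_surjective n)).symm (g.cyclesToHomology V n y) =
      Submodule.Quotient.mk y := by
    rw [LinearEquiv.symm_apply_eq]
    rfl
  rw [homologyEquiv, LinearEquiv.trans_apply, LinearEquiv.trans_apply, h]
  rfl

theorem homologyEquiv_map {W : Type v} [AddCommGroup W] [Module k W] (f : V →ₗ[k] W) (n : ℕ)
    (x : LieHomology k (g.LieEval V) n) :
    g.homologyEquiv W n (LieHomology.map k (g.lieEvalMap f) n x) =
      (g.homology n).evalMap f (g.homologyEquiv V n x) := by
  obtain ⟨y, rfl⟩ := g.cyclesToHomology_surjective n x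
  have h : LieHomology.map k (g.lieEvalMap f) n (g.cyclesToHomology V n y) =
      g.cyclesToHomology W n ((g.cyclesSpecies n).evalMap f y) := by
    refine congrArg (Submodule.mkQ _) (Subtype.ext ?_)
    apply (g.lieExtEquiv W n).injective
    rw [← lieExtEquiv_cyclesMap, Hom.eval_evalMap, lieExtEquiv_cyclesMap, ← lieExtEquiv_map]
    rfl
  rw [h, homologyEquiv_cyclesToHomology, homologyEquiv_cyclesToHomology, Hom.eval_evalMap]

/-- The action of a derivation on the cycles. -/
def Derivation.cycles {g : TwistedLieAlgebra.{u, w} k} (δ : g.Derivation) (n : ℕ) :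
    Hom (g.cyclesSpecies n) (g.cyclesSpecies n) where
  app I _ := (δ.ext n I).restrict (by
      rcases n with _ | n
      · intro x _; trivial
      · intro x hx
        change g.d n I _ = 0
        rw [Derivation.d_ext, LinearMap.mem_ker.mp hx, map_zero])
  naturality e x := Subtype.ext (δ.ext_extMap e x.1)

theorem homologyEquiv_der {g : TwistedLieAlgebra.{u, w} k} (δ : g.Derivation) (n : ℕ)
    (x : LieHomology k (g.LieEval V) n) :
    g.homologyEquiv V n (LieHomology.der k (δ.lieEval V) n x) =
      (δ.homology n).eval V (g.homologyEquiv V n x) := by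
  obtain ⟨y, rfl⟩ := g.cyclesToHomology_surjective n x
  have h : LieHomology.der k (δ.lieEval V) n (g.cyclesToHomology V n y) =
      g.cyclesToHomology V n ((δ.cycles n).eval V y) := by
    refine congrArg (Submodule.mkQ _) (Subtype.ext ?_)
    apply (g.lieExtEquiv V n).injective
    rw [← lieExtEquiv_cyclesMap, ← Hom.eval_comp]
    refine (δ.extHom_eval _).trans ?_
    rw [Submodule.subtype_apply, ← lieExtEquiv_cyclesMap, ← Hom.eval_comp]
    rfl
  rw [h, homologyEquiv_cyclesToHomology, homologyEquiv_cyclesToHomology, ← Hom.eval_comp,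
    ← Hom.eval_comp]
  rfl

end homology

end TwistedLieAlgebra

/-! ### Eigenspaces, prime factorization and multilinear expansion -/

/-- Over a field there is a projection to an eigenspace which vanishes on the other eigenspaces. -/
theorem Module.End.exists_eigenProjection {K : Type u} {M : Type v} [Field K] [AddCommGroup M]
    [Module K M] (f : Module.End K M) (μ : K) : ∃ π : M →ₗ[K] M,
      (∀ x, f x = μ • x → π x = x) ∧ (∀ x ν, ν ≠ μ → f x = ν • x → π x = 0) := by
  set R : Submodule K M := ⨆ (ν) (_ : ν ≠ μ), f.eigenspace ν with hR
  have hd : Disjoint (f.eigenspace μ) R := f.eigenspaces_iSupIndep μ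
  -- Eigenspaces are independent, so the one for `μ` embeds in the quotient by the sum `R` of all
  -- the others. A left inverse of this embedding gives the projection; `f` need not be
  -- diagonalizable.
  have hinj : LinearMap.ker (R.mkQ ∘ₗ (f.eigenspace μ).subtype) = ⊥ := by
    rw [LinearMap.ker_eq_bot']
    intro x hx
    have h : x.1 ∈ R := (Submodule.Quotient.mk_eq_zero R).mp hx
    exact Subtype.ext ((Submodule.disjoint_def.mp hd) x.1 x.2 h)
  obtain ⟨g, hg⟩ := LinearMap.exists_leftInverse_of_injective _ hinj
  refine ⟨(f.eigenspace μ).subtype ∘ₗ g ∘ₗ R.mkQ, fun x hx => ?_, fun x ν hν hx => ?_⟩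
  · exact congrArg Subtype.val
      (DFunLike.congr_fun hg ⟨x, Module.End.mem_eigenspace_iff.mpr hx⟩)
  · have h : x ∈ R := (le_iSup₂_of_le ν hν le_rfl : f.eigenspace ν ≤ R)
      (Module.End.mem_eigenspace_iff.mpr hx)
    have h2 : R.mkQ x = 0 := (Submodule.Quotient.mk_eq_zero R).mpr h
    rw [LinearMap.comp_apply, LinearMap.comp_apply, h2, map_zero, map_zero]

/-- A map of finite sets is bijective if it preserves the product of pairwise different primes. -/
theorem bijective_of_prod_primes {I J : Type*} [Fintype I] [Fintype J] (p : I → ℕ)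
    (hp : ∀ i, (p i).Prime) (hinj : Function.Injective p) (u : J → I)
    (h : ∏ j, p (u j) = ∏ i, p i) : Function.Bijective u := by
  classical
  -- Comparing the exponents of the prime `p i`: on the left it is the number of preimages of `i`,
  -- on the right it is one.
  have key : ∀ i, ∑ j, (if u j = i then 1 else 0) = 1 := by
    intro i
    have h1 := DFunLike.congr_fun (congrArg Nat.factorization h) (p i)
    rw [Nat.factorization_prod fun j _ => (hp (u j)).ne_zero,
      Nat.factorization_prod fun j _ => (hp j).ne_zero, Finsupp.finsetSum_apply,
      Finsupp.finsetSum_apply] at h1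
    simp only [(hp _).factorization, Finsupp.single_apply, hinj.eq_iff] at h1
    rw [h1]
    simp
  have key2 : ∀ i, ∃! j, u j = i := by
    intro i
    have h2 := key i
    rw [Finset.sum_boole, Nat.cast_id, Finset.card_eq_one] at h2
    obtain ⟨j, hj⟩ := h2
    refine ⟨j, ?_, fun j' hj' => ?_⟩
    · have : j ∈ ({j} : Finset J) := Finset.mem_singleton_self j
      rw [← hj] at this
      simpa using this
    · have : j' ∈ (Finset.univ.filter fun j => u j = i) := by simpa using hj'
      rw [hj] at this
      simpa using this
  exact Function.bijective_iff_existsUnique u |>.mpr key2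

/-- Modulo the span, `m` vanishes on all tuples of basis vectors, hence everywhere. -/
theorem MultilinearMap.apply_mem_span {K : Type u} [Field K] {I J : Type*} [Finite J] [Finite I]
    {N : Type*} [AddCommGroup N] [Module K N] (m : MultilinearMap K (fun _ : J => I →₀ K) N)
    (v : J → I →₀ K) :
    m v ∈ Submodule.span K (Set.range fun u : J → I => m fun j => Finsupp.single (u j) 1) := by
  set S := Submodule.span K (Set.range fun u : J → I => m fun j => Finsupp.single (u j) 1) with hS
  have h : S.mkQ.compMultilinearMap m = 0 := by
    refine MultilinearMap.ext_of_span_eq_top (γ := fun _ => I)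
      (g := fun ⦃_⦄ i => Finsupp.single i (1 : K)) (fun _ => ?_) fun u => ?_
    · rw [← (Finsupp.basisSingleOne (R := K) (ι := I)).span_eq, Finsupp.coe_basisSingleOne]
    · exact (Submodule.Quotient.mk_eq_zero S).mpr (Submodule.subset_span ⟨u, rfl⟩)
  exact (Submodule.Quotient.mk_eq_zero S).mp (DFunLike.congr_fun h v)

/-! ### Monomials of the free Jordan algebra -/

namespace FreeJordan

variable {k : Type u} [Field k] {V : Type v} [AddCommGroup V] [Module k V]

/-- An element is represented by a linear combination of words in the free magma on `V`, and words
are treated by induction on their structure. -/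
theorem induction_on {p : FreeJordan k V → Prop} (hof : ∀ v, p (of v))
    (hadd : ∀ a b, p a → p b → p (a + b)) (hmul : ∀ a b, p a → p b → p (a * b))
    (hsmul : ∀ (t : k) a, p a → p (t • a)) (a : FreeJordan k V) : p a := by
  obtain ⟨a, rfl⟩ := Quot.exists_rep a
  induction a using MonoidAlgebra.induction_linear with
  | zero => have := hsmul 0 _ (hof 0); rwa [zero_smul] at this
  | add a b ha hb => exact hadd _ _ ha hb
  | single m t =>
    have h1 : p (Quot.mk _ (MonoidAlgebra.single m 1)) := by
      induction m with
      | ih1 v => exact hof v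
      | ih2 a b ha hb =>
        have h2 : (MonoidAlgebra.single (a * b) 1 : FreeNonUnitalNonAssocAlgebra k V) =
          MonoidAlgebra.single a 1 * MonoidAlgebra.single b 1 := by
          rw [MonoidAlgebra.single_mul_single, one_mul]
        rw [h2]
        exact hmul _ _ ha hb
    have h2 : (MonoidAlgebra.single m t : FreeNonUnitalNonAssocAlgebra k V) =
        t • MonoidAlgebra.single m 1 := by
      simp
    rw [h2]
    exact hsmul t _ h1

/-- The substitution of vectors for the generators. -/
def subst {I : Type} (v : I → V) : FreeJordan k (I →₀ k) →ₙₐ[k] FreeJordan k V :=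
  map (Finsupp.linearCombination k v)

theorem subst_subst {I J : Type} (u : J → I) (v : I → V) (a : FreeJordan k (J →₀ k)) :
    subst v (subst (fun j => Finsupp.single (u j) 1) a) = subst (v ∘ u) a := by
  rw [subst, subst, map_map, subst]
  congr 2
  refine Finsupp.lhom_ext' fun j => LinearMap.ext_ring ?_
  simp

variable (k) in
/-- The nonassociative monomials which contain every generator exactly once. -/
inductive Monomial : (I : Type) → FreeJordan k (I →₀ k) → Prop
  | var : Monomial Unit (of (Finsupp.single () 1))
  | mul {I J : Type} {a : FreeJordan k (I →₀ k)} {b : FreeJordan k (J →₀ k)} : Monomial I a →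
      Monomial J b → Monomial (I ⊕ J) (subst (fun i => Finsupp.single (Sum.inl i) 1) a *
        subst (fun j => Finsupp.single (Sum.inr j) 1) b)

theorem Monomial.finite {I : Type} {a : FreeJordan k (I →₀ k)} (h : Monomial k I a) :
    Finite I := by
  induction h with
  | var => infer_instance
  | mul _ _ _ _ => infer_instance

/-- The two factors of a product involve disjoint sets of variables, so their multilinear maps
combine to one map on the union of the variables, followed by the multiplication. -/
theorem Monomial.exists_multilinearMap {I : Type} {a : FreeJordan k (I →₀ k)}
    (h : Monomial k I a) : ∃ m : MultilinearMap k (fun _ : I => V) (FreeJordan k V),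
      ∀ v, m v = subst v a := by
  induction h with
  | var =>
    refine ⟨MultilinearMap.ofSubsingleton k V _ () of, fun v => ?_⟩
    rw [subst, map_of]
    simp
  | @mul I J a b _ _ ha hb =>
    obtain ⟨m, hm⟩ := ha
    obtain ⟨m', hm'⟩ := hb
    refine ⟨(TensorProduct.lift (LinearMap.mul k (FreeJordan k V))).compMultilinearMap
      (m.domCoprod m'), fun v => ?_⟩
    rw [LinearMap.compMultilinearMap_apply, MultilinearMap.domCoprod_apply,
      TensorProduct.lift.tmul, hm, hm', map_mul, subst_subst, subst_subst]
    rfl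

/-- A monomial in vectors of `V` comes from one in distinct variables, with a variable for each
occurrence of a vector. Repetitions are accounted for by the substitution `v`, which need not be
injective. -/
theorem span_monomial (a : FreeJordan k V) : a ∈ Submodule.span k
    {b | ∃ (I : Type) (a : FreeJordan k (I →₀ k)) (v : I → V), Monomial k I a ∧ subst v a = b} := by
  induction a using induction_on with
  | hof v => exact Submodule.subset_span ⟨Unit, _, fun _ => v, Monomial.var, by simp [subst]⟩
  | hadd a b ha hb => exact add_mem ha hb
  | hsmul t a ha => exact Submodule.smul_mem _ t ha
  | hmul a b ha hb =>
    have h := Submodule.apply_mem_map₂ (LinearMap.mul k (FreeJordan k V)) ha hb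
    rw [Submodule.map₂_span_span] at h
    refine Submodule.span_mono ?_ h
    rintro _ ⟨_, ⟨I, a, v, hI, rfl⟩, _, ⟨J, b, w, hJ, rfl⟩, rfl⟩
    refine ⟨I ⊕ J, _, Sum.elim v w, hI.mul hJ, ?_⟩
    rw [map_mul, subst_subst, subst_subst]
    rfl

end FreeJordan

open JordanAlg

/-! ### The multilinear part of `TAG` of a free Jordan algebra -/

namespace TAG

variable (k : Type u) [Field k] (J : Type v) [NonUnitalNonAssocCommRing J] [Module k J]

/-- The inclusion of `𝔰𝔩₂ ⊗ J` in `TAG(J)`. -/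
def inl : Sl2 k ⊗[k] J →ₗ[k] TAG k J := LinearMap.inl k (Sl2 k ⊗[k] J) (B k J)

/-- The inclusion of `B(J)` in `TAG(J)`. -/
def inr : B k J →ₗ[k] TAG k J := LinearMap.inr k (Sl2 k ⊗[k] J) (B k J)

variable {k J}

theorem inl_add_inr (p : TAG k J) : inl k J p.1 + inr k J p.2 = p :=
  Prod.ext (add_zero _) (zero_add _)

end TAG

namespace FreeTAG

variable {k : Type u} [Field k] [CharZero k] {V : Type v} [AddCommGroup V] [Module k V]
  {W : Type w} [AddCommGroup W] [Module k W] {I J : Type}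

/-- The substitution of vectors for the generators. -/
def subst (v : I → V) : TAG k (FreeJordan k (I →₀ k)) →ₗ⁅k⁆ TAG k (FreeJordan k V) :=
  map (Finsupp.linearCombination k v)

theorem rename_eq_subst (f : I → J) (p : TAG k (FreeJordan k (I →₀ k))) :
    rename k f p = subst (fun i => Finsupp.single (f i) 1) p := by
  rw [rename, subst]
  congr 2
  refine Finsupp.lhom_ext' fun i => LinearMap.ext_ring ?_
  simp

theorem map_subst (f : V →ₗ[k] W) (v : I → V) (p : TAG k (FreeJordan k (I →₀ k))) :
    map f (subst v p) = subst (f ∘ v) p := by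
  rw [subst, map_map, subst]
  congr 2
  refine Finsupp.lhom_ext' fun i => LinearMap.ext_ring ?_
  simp

theorem subst_subst (v : J → V) (w : I → J →₀ k) (p : TAG k (FreeJordan k (I →₀ k))) :
    subst v (subst w p) = subst (fun i => Finsupp.linearCombination k v (w i)) p :=
  map_subst _ w p

theorem subst_rename (f : I → J) (v : J → V) (p : TAG k (FreeJordan k (I →₀ k))) :
    subst v (rename k f p) = subst (v ∘ f) p := by
  rw [rename_eq_subst, subst_subst]
  congr 2
  funext i
  simp

theorem subst_inl (v : I → V) (s : Sl2 k) (a : FreeJordan k (I →₀ k)) :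
    subst v (TAG.inl k _ (s ⊗ₜ a)) = TAG.inl k _ (s ⊗ₜ FreeJordan.subst v a) :=
  TAG.ext rfl (map_zero (BMap k _))

theorem subst_inr (v : I → V) (a b : FreeJordan k (I →₀ k)) :
    subst v (TAG.inr k _ (wedge k a b)) =
      TAG.inr k _ (wedge k (FreeJordan.subst v a) (FreeJordan.subst v b)) :=
  TAG.ext (map_zero (LinearMap.lTensor _ _)) (BMap_wedge k _ a b)

variable (k) in
/-- The elements of `TAG(Jord(x_i : i ∈ I))` given by monomials which contain every generator
exactly once. -/
inductive Monomial : (I : Type) → TAG k (FreeJordan k (I →₀ k)) → Prop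
  | tmul (s : Sl2 k) {I : Type} {a : FreeJordan k (I →₀ k)} : FreeJordan.Monomial k I a →
      Monomial I (TAG.inl k _ (s ⊗ₜ a))
  | wedge {I J : Type} {a : FreeJordan k (I →₀ k)} {b : FreeJordan k (J →₀ k)} :
      FreeJordan.Monomial k I a → FreeJordan.Monomial k J b → Monomial (I ⊕ J)
      (TAG.inr k _ (wedge k (FreeJordan.subst (fun i => Finsupp.single (Sum.inl i) 1) a)
        (FreeJordan.subst (fun j => Finsupp.single (Sum.inr j) 1) b)))

theorem Monomial.finite {p : TAG k (FreeJordan k (I →₀ k))} (h : Monomial k I p) : Finite I := by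
  induction h with
  | tmul s h => exact h.finite
  | wedge h h' =>
    have := h.finite
    have := h'.finite
    infer_instance

theorem Monomial.exists_multilinearMap {p : TAG k (FreeJordan k (I →₀ k))} (h : Monomial k I p) :
    ∃ m : MultilinearMap k (fun _ : I => V) (TAG k (FreeJordan k V)), ∀ v, m v = subst v p := by
  induction h with
  | tmul s h =>
    obtain ⟨m, hm⟩ := h.exists_multilinearMap (V := V)
    refine ⟨(TAG.inl k _ ∘ₗ TensorProduct.mk k _ _ s).compMultilinearMap m, fun v => ?_⟩
    rw [subst_inl, ← hm]
    rfl
  | wedge h h' =>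
    obtain ⟨m, hm⟩ := h.exists_multilinearMap (V := V)
    obtain ⟨m', hm'⟩ := h'.exists_multilinearMap (V := V)
    refine ⟨(TAG.inr k _ ∘ₗ TensorProduct.lift (JordanAlg.wedge k)).compMultilinearMap
      (m.domCoprod m'), fun v => ?_⟩
    rw [subst_inr, FreeJordan.subst_subst, FreeJordan.subst_subst,
      LinearMap.compMultilinearMap_apply, MultilinearMap.domCoprod_apply, LinearMap.comp_apply,
      TensorProduct.lift.tmul, hm, hm']
    rfl

theorem span_monomial (p : TAG k (FreeJordan k V)) : p ∈ Submodule.span k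
    {q | ∃ (I : Type) (p : TAG k (FreeJordan k (I →₀ k))) (v : I → V),
      Monomial k I p ∧ subst v p = q} := by
  rw [← TAG.inl_add_inr p]
  refine add_mem ?_ ?_
  · generalize p.1 = t
    induction t using TensorProduct.induction_on with
    | zero => rw [map_zero]; exact zero_mem _
    | add a b ha hb => rw [map_add]; exact add_mem ha hb
    | tmul s a =>
      have h := Submodule.mem_map_of_mem (f := TAG.inl k _ ∘ₗ TensorProduct.mk k _ _ s)
        (FreeJordan.span_monomial a)
      rw [Submodule.map_span] at h
      refine Submodule.span_mono ?_ h
      rintro _ ⟨_, ⟨I, a, v, hI, rfl⟩, rfl⟩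
      exact ⟨I, _, v, Monomial.tmul s hI, subst_inl v s a⟩
  · generalize p.2 = b
    induction b using B_induction with
    | hadd a b ha hb => rw [map_add]; exact add_mem ha hb
    | hsmul t a ha => rw [map_smul]; exact Submodule.smul_mem _ t ha
    | hw a b =>
      have h := Submodule.apply_mem_map₂ ((wedge k).compr₂ (TAG.inr k _))
        (FreeJordan.span_monomial a) (FreeJordan.span_monomial b)
      rw [Submodule.map₂_span_span] at h
      refine Submodule.span_mono ?_ h
      rintro _ ⟨_, ⟨I, a, v, hI, rfl⟩, _, ⟨J, b, w, hJ, rfl⟩, rfl⟩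
      refine ⟨I ⊕ J, _, Sum.elim v w, Monomial.wedge hI hJ, ?_⟩
      rw [subst_inr, FreeJordan.subst_subst, FreeJordan.subst_subst]
      rfl

theorem map_scale_eq_subst [DecidableEq I] (i : I) (t : k)
    (p : TAG k (FreeJordan k (I →₀ k))) : map (scale k i t) p =
      subst (Function.update (fun j => Finsupp.single j 1) i (t • Finsupp.single i 1)) p := by
  rw [scale, subst]
  congr 3
  funext j
  rcases eq_or_ne j i with rfl | h
  · simp
  · simp [h]

theorem subst_single (p : TAG k (FreeJordan k (I →₀ k))) :
    subst (fun i => Finsupp.single i 1) p = p := by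
  have := rename_eq_subst (k := k) (id : I → I) p
  rw [rename_id] at this
  exact this.symm

/-- Rescaling one generator rescales one argument of the multilinear substitution map. -/
theorem Monomial.mem_multilinear {p : TAG k (FreeJordan k (I →₀ k))} (h : Monomial k I p) :
    p ∈ multilinear k I := by
  classical
  obtain ⟨m, hm⟩ := h.exists_multilinearMap (V := I →₀ k)
  intro i t
  rw [map_scale_eq_subst, ← hm, MultilinearMap.map_update_smul, Function.update_eq_self, hm,
    subst_single]

/-- Rescaling of all the generators. -/
theorem map_rescale [Fintype I] (c : I → k) {p : TAG k (FreeJordan k (I →₀ k))}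
    (hp : p ∈ multilinear k I) :
    subst (fun i => c i • Finsupp.single i 1) p = (∏ i, c i) • p := by
  classical
  -- The generators are rescaled one at a time, each time by the condition defining `multilinear`.
  have key : ∀ s : Finset I, subst (fun i => (if i ∈ s then c i else 1) • Finsupp.single i 1) p =
      (∏ i ∈ s, c i) • p := by
    intro s
    induction s using Finset.induction_on with
    | empty => simp [subst_single]
    | insert i s hi ih =>
      rw [Finset.prod_insert hi, mul_smul, ← ih, ← map_smul, ← hp i (c i), map_scale_eq_subst,
        subst_subst]
      congr 2
      funext j
      rcases eq_or_ne j i with rfl | h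
      · simp [hi]
      · simp [h]
  have := key Finset.univ
  simpa using this

variable (k) in
/-- There is a projection to the multilinear part which vanishes on the elements obtained from
multilinear ones by a map of generators which is not bijective. -/
theorem exists_multilinear_projection (I : Type) [Finite I] :
    ∃ π : TAG k (FreeJordan k (I →₀ k)) →ₗ[k] TAG k (FreeJordan k (I →₀ k)),
      (∀ p ∈ multilinear k I, π p = p) ∧
      ∀ (J : Type) [Finite J] (u : J → I), ¬ Function.Bijective u →
        ∀ p ∈ multilinear k J, π (rename k u p) = 0 := by
  have := Fintype.ofFinite I
  -- Rescaling by distinct primes separates multidegrees: by unique factorization the eigenvalue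
  -- records how often each generator occurs, and in characteristic zero distinct natural numbers
  -- stay distinct in `k`.
  let c : I → ℕ := fun i => Nat.nth Nat.Prime (Finite.equivFin I i)
  have hc : ∀ i, (c i).Prime := fun i => Nat.prime_nth_prime _
  have hinj : Function.Injective c := fun i j h => by
    have := Nat.nth_injective Nat.infinite_setOfPred_prime h
    exact (Finite.equivFin I).injective (Fin.val_injective this)
  let f : Module.End k (TAG k (FreeJordan k (I →₀ k))) :=
    ((subst fun i => (c i : k) • Finsupp.single i (1 : k) :
      TAG k (FreeJordan k (I →₀ k)) →ₗ⁅k⁆ TAG k (FreeJordan k (I →₀ k))) :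
        TAG k (FreeJordan k (I →₀ k)) →ₗ[k] TAG k (FreeJordan k (I →₀ k)))
  obtain ⟨π, h1, h2⟩ := f.exists_eigenProjection (∏ i, (c i : k))
  refine ⟨π, fun p hp => h1 p (map_rescale _ hp), fun J _ u hu p hp => ?_⟩
  have := Fintype.ofFinite J
  -- The renamed element is again an eigenvector. Its eigenvalue equals that of the multilinear part
  -- only if every prime occurs exactly once, that is, only if `u` is bijective.
  refine h2 _ (∏ j, (c (u j) : k)) (fun h => hu ?_) ?_
  · refine bijective_of_prod_primes c hc hinj u ?_
    exact_mod_cast h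
  · change subst (fun i => (c i : k) • Finsupp.single i (1 : k)) (rename k u p) = _
    rw [← map_smul, ← map_rescale _ hp, subst_rename, rename, map_subst]
    congr 2
    funext j
    simp

/-- Expanding in monomials and then in basis vectors writes `p` through renamings of monomials along
arbitrary maps `u`. The projection to the multilinear part fixes `p`, keeps the terms with `u`
bijective and removes the others. -/
theorem multilinear_le_span [Finite I] {p : TAG k (FreeJordan k (I →₀ k))}
    (hp : p ∈ multilinear k I) : p ∈ Submodule.span k
      {q | ∃ (J : Type) (p : TAG k (FreeJordan k (J →₀ k))) (e : J ≃ I),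
        Monomial k J p ∧ rename k e p = q} := by
  obtain ⟨π, h1, h2⟩ := exists_multilinear_projection k I
  have hs : p ∈ Submodule.span k {q | ∃ (J : Type) (p : TAG k (FreeJordan k (J →₀ k))) (u : J → I),
      Monomial k J p ∧ rename k u p = q} := by
    refine Submodule.span_le.mpr ?_ (span_monomial p)
    rintro _ ⟨J, q, v, hq, rfl⟩
    obtain ⟨m, hm⟩ := hq.exists_multilinearMap (V := I →₀ k)
    have := hq.finite
    rw [← hm]
    refine Submodule.span_mono ?_ (m.apply_mem_span v)
    rintro _ ⟨u, rfl⟩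
    exact ⟨J, q, u, hq, by rw [rename_eq_subst]; exact (hm _).symm⟩
  have h3 := Submodule.mem_map_of_mem (f := π) hs
  rw [h1 p hp, Submodule.map_span] at h3
  refine Submodule.span_le.mpr ?_ h3
  rintro _ ⟨_, ⟨J, q, u, hq, rfl⟩, rfl⟩
  have := hq.finite
  by_cases hu : Function.Bijective u
  · let e := Equiv.ofBijective u hu
    have he : rename k u q ∈ multilinear k I := rename_mem e q hq.mem_multilinear
    rw [h1 _ he]
    exact Submodule.subset_span ⟨J, q, e, hq, rfl⟩
  · rw [h2 J u hu q hq.mem_multilinear]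
    exact zero_mem _

/-- The definition of `multilinear` says nothing about additivity in a generator. It is inherited
from the monomials that span, for which multilinearity is visible. -/
theorem exists_multilinearMap [Finite I] {p : TAG k (FreeJordan k (I →₀ k))}
    (hp : p ∈ multilinear k I) :
    ∃ m : MultilinearMap k (fun _ : I => V) (TAG k (FreeJordan k V)), ∀ v, m v = subst v p := by
  have h := multilinear_le_span hp
  clear hp
  induction h using Submodule.span_induction with
  | mem p h =>
    obtain ⟨J, q, e, hq, rfl⟩ := h
    obtain ⟨m, hm⟩ := hq.exists_multilinearMap (V := V)
    exact ⟨m.domDomCongr e, fun v => by rw [subst_rename, ← hm]; rfl⟩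
  | zero => exact ⟨0, fun v => (map_zero (subst v)).symm⟩
  | add p q _ _ h h' =>
    obtain ⟨m, hm⟩ := h
    obtain ⟨m', hm'⟩ := h'
    exact ⟨m + m', fun v => by rw [map_add, ← hm, ← hm']; rfl⟩
  | smul t p _ h =>
    obtain ⟨m, hm⟩ := h
    exact ⟨t • m, fun v => by rw [map_smul, ← hm]; rfl⟩

end FreeTAG

/-! ### Contraction with linear forms -/

namespace Species

variable {k : Type u} [Field k] (F : Species.{u, w} k) {V : Type v} [AddCommGroup V] [Module k V]

/-- Contraction of `F(n) ⊗ V^{⊗ n}` with linear forms. -/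
def contract {n : ℕ} (ℓ : Fin n → V →ₗ[k] k) :
    F.obj (Fin n) ⊗[k] (⨂[k] _ : Fin n, V) →ₗ[k] F.obj (Fin n) :=
  (TensorProduct.rid k (F.obj (Fin n))).toLinearMap ∘ₗ
    (PiTensorProduct.lift ((MultilinearMap.mkPiRing k (Fin n) (1 : k)).compLinearMap ℓ)).lTensor _

theorem contract_tmul {n : ℕ} (ℓ : Fin n → V →ₗ[k] k) (x : F.obj (Fin n)) (v : Fin n → V) :
    F.contract ℓ (x ⊗ₜ PiTensorProduct.tprod k v) = (∏ i, ℓ i (v i)) • x := by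
  simp [contract]

/-- For a basis of `V`, the coordinates of `a` with respect to the induced basis of `V^{⊗ n}` are
its contractions with coordinate forms. -/
theorem eq_zero_of_contract {n : ℕ} (a : F.obj (Fin n) ⊗[k] (⨂[k] _ : Fin n, V))
    (h : ∀ ℓ : Fin n → V →ₗ[k] k, F.contract ℓ a = 0) : a = 0 := by
  classical
  let b := Module.Basis.ofVectorSpace k V
  let B := Basis.piTensorProduct fun _ : Fin n => b
  have key : ∀ (a : F.obj (Fin n) ⊗[k] (⨂[k] _ : Fin n, V)) (r),
      TensorProduct.equivFinsuppOfBasisRight (M := F.obj (Fin n)) B a r =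
        F.contract (fun i => b.coord (r i)) a := by
    intro a r
    induction a using TensorProduct.induction_on with
    | zero => simp
    | add a c ha hc => rw [map_add, map_add, Finsupp.add_apply, ha, hc]
    | tmul x t =>
      induction t using PiTensorProduct.induction_on with
      | add s t hs ht =>
        rw [TensorProduct.tmul_add, map_add, map_add, Finsupp.add_apply, hs, ht]
      | smul_tprod c v =>
        rw [TensorProduct.tmul_smul, map_smul, map_smul, Finsupp.smul_apply, contract_tmul,
          TensorProduct.equivFinsuppOfBasisRight_apply_tmul_apply,
          Basis.piTensorProduct_repr_tprod_apply]
        rfl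
  apply (TensorProduct.equivFinsuppOfBasisRight (M := F.obj (Fin n)) B).injective
  rw [map_zero]
  ext r
  rw [key, h, Finsupp.zero_apply]

end Species
open JordanAlg Species

/-! ### The value of `twistedTAG` on `V` is `TAG(Jord(V))` -/

namespace FreeTAG

variable {k : Type u} [Field k] [CharZero k] {V W : Type v} [AddCommGroup V] [Module k V]
  [AddCommGroup W] [Module k W]

variable (V) in
/-- The map `(p, v) ↦ p(v)`, linear in `p` and multilinear in `v`. -/
def substMulti (I : Type) [Finite I] : multilinear k I →ₗ[k]
    MultilinearMap k (fun _ : I => V) (TAG k (FreeJordan k V)) where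
  toFun p :=
    { toFun := fun v => subst v p.1
      map_update_add' := by
        intro _ v i a b
        -- The map `m` is not canonical, but its values are, and additivity concerns only the
        -- values.
        obtain ⟨m, hm⟩ := exists_multilinearMap (V := V) p.2
        simp only [← hm, MultilinearMap.map_update_add]
      map_update_smul' := by
        intro _ v i t a
        obtain ⟨m, hm⟩ := exists_multilinearMap (V := V) p.2
        simp only [← hm, MultilinearMap.map_update_smul] }
  map_add' p q := by
    ext1 v
    exact map_add (subst v) p.1 q.1
  map_smul' t p := by
    ext1 v
    exact map_smul (subst v) t p.1

variable (k V) in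
/-- The map from the value of `twistedTAG` on `V` to `TAG(Jord(V))`. -/
def evalHom : (twistedTAG k).toSpecies.Eval V →ₗ[k] TAG k (FreeJordan k V) :=
  evLift (F := (twistedTAG k).toSpecies) (fun I _ => substMulti V I) (by
    intro I J _ _ e x v
    exact subst_rename e v x.1)

theorem evalHom_ev {I : Type} [Finite I] (x : multilinear k I) (v : I → V) :
    evalHom k V ((twistedTAG k).toSpecies.ev (I := I) x v) = subst v x.1 :=
  evLift_ev (F := (twistedTAG k).toSpecies) _ _ (I := I) x v

theorem evalHom_surjective : Function.Surjective (evalHom k V) := by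
  rw [← LinearMap.range_eq_top, eq_top_iff]
  rintro p -
  refine Submodule.span_le.mpr ?_ (span_monomial p)
  rintro _ ⟨I, q, v, hq, rfl⟩
  have := hq.finite
  exact ⟨_, evalHom_ev ⟨q, hq.mem_multilinear⟩ v⟩

theorem map_evalHom (f : V →ₗ[k] W) (z : (twistedTAG k).toSpecies.Eval V) :
    map f (evalHom k V z) = evalHom k W ((twistedTAG k).toSpecies.evalMap f z) := by
  induction z using eval_induction with
  | hev n x v =>
    rw [evalMap_ev]
    refine (congrArg (map f) (evalHom_ev x v)).trans ?_
    rw [map_subst]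
    exact (evalHom_ev x _).symm
  | hadd a b ha hb => simp only [map_add, ha, hb]

theorem slMap_evalHom (s : Sl2 k) (z : (twistedTAG k).toSpecies.Eval V) :
    TAG.slMap s (evalHom k V z) = evalHom k V ((twistedSlAction s).toHom.eval V z) := by
  induction z using eval_induction with
  | hev n x v =>
    rw [Hom.eval_ev]
    refine (congrArg (TAG.slMap s) (evalHom_ev x v)).trans ?_
    rw [subst, ← map_slMap]
    exact (evalHom_ev ((twistedSlAction s).app (Fin n) x) _).symm
  | hadd a b ha hb => simp only [map_add, ha, hb]

theorem subst_mlBracket {I J : Type} (x : multilinear k I) (y : multilinear k J) (v : I → V)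
    (w : J → V) : subst (Sum.elim v w) (mlBracket k I J x y).1 = ⁅subst v x.1, subst w y.1⁆ := by
  rw [coe_mlBracket, LieHom.map_lie, subst_rename, subst_rename]
  rfl

theorem evalHom_evalBracket (a b : (twistedTAG k).toSpecies.Eval V) :
    evalHom k V ((twistedTAG k).evalBracket V a b) = ⁅evalHom k V a, evalHom k V b⁆ := by
  induction a using eval_induction with
  | hadd a b ha hb => simp only [map_add, LinearMap.add_apply, ha, hb, add_lie]
  | hev n x v =>
    induction b using eval_induction with
    | hadd a b ha hb => simp only [map_add, ha, hb, lie_add]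
    | hev m y w =>
      rw [TwistedLieAlgebra.evalBracket_ev]
      refine (evalHom_ev (mlBracket k (Fin n) (Fin m) x y) (Sum.elim v w)).trans ?_
      exact (subst_mlBracket x y v w).trans
        (congrArg₂ (⁅·, ·⁆) (evalHom_ev x v) (evalHom_ev y w)).symm

/-- The linear map to the space with basis indexed by `Fin n` given by linear forms. -/
def formsMap {n : ℕ} (ℓ : Fin n → V →ₗ[k] k) : V →ₗ[k] (Fin n →₀ k) :=
  (Finsupp.linearEquivFunOnFinite k k (Fin n)).symm.toLinearMap ∘ₗ LinearMap.pi ℓ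

theorem formsMap_apply {n : ℕ} (ℓ : Fin n → V →ₗ[k] k) (v : V) :
    formsMap ℓ v = ∑ i, ℓ i v • Finsupp.single i 1 := by
  ext j
  simp [formsMap, Finsupp.finsetSum_apply, Finsupp.single_apply]

/-- Each argument is expanded in the basis of the target of `formsMap`; a choice of one basis vector
per argument is a map `u`, and substituting the chosen vectors is a renaming. -/
theorem subst_formsMap {n : ℕ} (ℓ : Fin n → V →ₗ[k] k) {I : Type} [Fintype I] [DecidableEq I]
    (x : multilinear k I) (v : I → V) : subst (formsMap ℓ ∘ v) x.1 =
      ∑ u : I → Fin n, (∏ i, ℓ (u i) (v i)) • rename k u x.1 := by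
  obtain ⟨m, hm⟩ := exists_multilinearMap (V := Fin n →₀ k) x.2
  have h : formsMap ℓ ∘ v = fun i => ∑ j, ℓ j (v i) • Finsupp.single j 1 := by
    funext i
    exact formsMap_apply ℓ (v i)
  rw [h, ← hm, m.map_sum]
  refine Finset.sum_congr rfl fun u _ => ?_
  rw [rename_eq_subst, ← hm, ← m.map_smul_univ]

variable (k) in
/-- The inclusion of the multilinear part. -/
def twistedVal (I : Type) [Finite I] :
    (twistedTAG k).toSpecies.obj I →ₗ[k] TAG k (FreeJordan k (I →₀ k)) :=
  (multilinear k I).subtype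

theorem twistedVal_mem {I : Type} [Finite I] (x : (twistedTAG k).toSpecies.obj I) :
    twistedVal k I x ∈ multilinear k I :=
  Subtype.property (p := (· ∈ multilinear k I)) x

theorem twistedVal_injective (I : Type) [Finite I] : Function.Injective (twistedVal k I) :=
  (multilinear k I).injective_subtype

/-- Polarization: in the expansion `subst_formsMap` the projection leaves only the bijective `u`.
These exist only in degree `n`, where they are the permutations, and the sum over them is the
contraction of the norm. Hence the norm of each component can be read off from the image under
`evalHom`. -/
theorem projection_map_evalHom {n : ℕ} (ℓ : Fin n → V →ₗ[k] k)
    (π : TAG k (FreeJordan k (Fin n →₀ k)) →ₗ[k] TAG k (FreeJordan k (Fin n →₀ k)))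
    (h1 : ∀ p ∈ multilinear k (Fin n), π p = p)
    (h2 : ∀ (J : Type) [Finite J] (u : J → Fin n), ¬ Function.Bijective u →
        ∀ p ∈ multilinear k J, π (rename k u p) = 0) (z : (twistedTAG k).toSpecies.Eval V) :
    π (map (formsMap ℓ) (evalHom k V z)) =
      twistedVal k (Fin n) ((twistedTAG k).toSpecies.contract ℓ
        ((twistedTAG k).toSpecies.normBar V n ((twistedTAG k).toSpecies.evalProj V n z))) := by
  let G := (twistedTAG k).toSpecies
  suffices h : π ∘ₗ (map (formsMap ℓ) : TAG k (FreeJordan k V) →ₗ[k] _) ∘ₗ evalHom k V =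
      twistedVal k (Fin n) ∘ₗ G.contract ℓ ∘ₗ G.normBar V n ∘ₗ G.evalProj V n from
    DFunLike.congr_fun h z
  refine eval_hom_ext fun m x v => ?_
  have hl : π (map (formsMap ℓ) (evalHom k V (G.ev x v))) =
      ∑ u : Fin m → Fin n, (∏ i, ℓ (u i) (v i)) • π (rename k u (twistedVal k (Fin m) x)) := by
    have h3 : map (formsMap ℓ) (evalHom k V (G.ev x v)) =
        subst (formsMap ℓ ∘ v) (twistedVal k (Fin m) x) :=
      (congrArg (map (formsMap ℓ)) (evalHom_ev x v)).trans (map_subst _ _ _)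
    rw [h3]
    refine (congrArg π (subst_formsMap ℓ x v)).trans ?_
    rw [map_sum]
    exact Finset.sum_congr rfl fun u _ => map_smul π _ _
  refine hl.trans ?_
  change _ = twistedVal k (Fin n) (G.contract ℓ (G.normBar V n (G.evalProj V n (G.ev x v))))
  rw [ev, evT_fin]
  rcases ne_or_eq n m with h | rfl
  · rw [evalProj_in_of_ne h, map_zero, map_zero, map_zero]
    -- For `m ≠ n` no map from `Fin m` to `Fin n` is bijective, so every term is killed by `π`.
    refine Finset.sum_eq_zero fun u _ => ?_
    rw [h2 _ u (fun hu => h ?_) _ (twistedVal_mem x),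
      smul_zero]
    have := Fintype.card_of_bijective hu
    simpa using this.symm
  · rw [evalProj_in_self, normBar_mk, norm_apply, map_sum, map_sum]
    have hσ : ∀ σ : Equiv.Perm (Fin n), twistedVal k (Fin n) (G.contract ℓ (G.diag V σ
        (x ⊗ₜ PiTensorProduct.tprod k v))) =
        (∏ i, ℓ (σ i) (v i)) • π (rename k σ (twistedVal k (Fin n) x)) := by
      intro σ
      rw [h1 _ (rename_mem σ _ (twistedVal_mem x)), diag,
        TensorProduct.map_tmul, LinearEquiv.coe_coe, PiTensorProduct.reindex_tprod, contract_tmul,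
        map_smul, ← Equiv.prod_comp σ]
      simp only [Equiv.symm_apply_apply]
      rfl
    simp only [hσ]
    symm
    -- The permutations are embedded among all the maps `u`; the terms outside the image vanish.
    refine Finset.sum_of_injOn (fun σ : Equiv.Perm (Fin n) => (σ : Fin n → Fin n))
      (fun σ _ τ _ h => Equiv.coe_fn_injective h) (fun _ _ => Finset.mem_coe.mpr (Finset.mem_univ _))
      (fun u _ hu => ?_) (fun σ _ => rfl)
    rw [h2 _ u (fun hb => hu ⟨Equiv.ofBijective u hb, Finset.mem_coe.mpr (Finset.mem_univ _), rfl⟩)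
      _ (twistedVal_mem x), smul_zero]

/-- If the image vanishes, then by `projection_map_evalHom` all contractions of the norm of each
component vanish, hence the norm, hence the component. -/
theorem evalHom_injective : Function.Injective (evalHom k V) := by
  rw [injective_iff_map_eq_zero]
  intro z hz
  refine evalProj_ext fun n => ?_
  rw [map_zero]
  obtain ⟨a, ha⟩ := (twistedTAG k).toSpecies.evalMk_surjective V n
    ((twistedTAG k).toSpecies.evalProj V n z)
  obtain ⟨π, h1, h2⟩ := exists_multilinear_projection k (Fin n)
  rw [← ha]
  refine eq_zero_of_norm_eq_zero (eq_zero_of_contract _ _ fun ℓ => ?_)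
  apply twistedVal_injective (Fin n)
  rw [← normBar_mk, ha, ← projection_map_evalHom ℓ π h1 h2 z, hz, map_zero, map_zero, map_zero]

variable (k V) in
/-- The value of `twistedTAG` on `V` is `TAG(Jord(V))`. -/
def evalLieEquiv : (twistedTAG k).LieEval V ≃ₗ⁅k⁆ TAG k (FreeJordan k V) :=
  { LinearEquiv.ofBijective (evalHom k V) ⟨evalHom_injective, evalHom_surjective⟩ with
    map_lie' := fun {a b} => evalHom_evalBracket a b }

end FreeTAG

/-! ### Functoriality of Lie algebra homology -/

namespace ChevalleyEilenberg

variable (k : Type u) [Field k] [CharZero k] {L : Type v} [LieRing L] [LieAlgebra k L]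
  {L' : Type w} [LieRing L'] [LieAlgebra k L']
  {L'' : Type w₁} [LieRing L''] [LieAlgebra k L'']

theorem LieHomology.map_congr {φ ψ : L →ₗ⁅k⁆ L'} (h : ∀ x, φ x = ψ x) (n : ℕ)
    (x : LieHomology k L n) : LieHomology.map k φ n x = LieHomology.map k ψ n x := by
  rw [LieHom.ext h]

theorem LieHomology.map_id (n : ℕ) (x : LieHomology k L n) :
    LieHomology.map k (LieHom.id : L →ₗ⁅k⁆ L) n x = x := by
  obtain ⟨⟨a, ha⟩, rfl⟩ := Submodule.mkQ_surjective _ x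
  refine congrArg (Submodule.mkQ _) (Subtype.ext ?_)
  change exteriorPower.map n LinearMap.id a = a
  rw [exteriorPower.map_id]
  rfl

theorem LieHomology.map_map (φ : L →ₗ⁅k⁆ L') (ψ : L' →ₗ⁅k⁆ L'') (n : ℕ) (x : LieHomology k L n) :
    LieHomology.map k ψ n (LieHomology.map k φ n x) = LieHomology.map k (ψ.comp φ) n x := by
  obtain ⟨⟨a, ha⟩, rfl⟩ := Submodule.mkQ_surjective _ x
  refine congrArg (Submodule.mkQ _) (Subtype.ext ?_)
  change exteriorPower.map n (ψ : L' →ₗ[k] L'') (exteriorPower.map n (φ : L →ₗ[k] L') a) =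
    exteriorPower.map n ((ψ : L' →ₗ[k] L'') ∘ₗ (φ : L →ₗ[k] L')) a
  rw [exteriorPower.map_comp]
  rfl

theorem map_derExt (φ : L →ₗ[k] L') (D : L →ₗ[k] L) (D' : L' →ₗ[k] L')
    (h : ∀ x, φ (D x) = D' (φ x)) (n : ℕ) (x : ⋀[k]^n L) :
    exteriorPower.map n φ (derExt k D n x) = derExt k D' n (exteriorPower.map n φ x) := by
  suffices h : exteriorPower.map n φ ∘ₗ derExt k D n = derExt k D' n ∘ₗ exteriorPower.map n φ from
    DFunLike.congr_fun h x
  refine exteriorPower.linearMap_ext ?_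
  ext1 x
  simp only [LinearMap.compAlternatingMap_apply, LinearMap.comp_apply, derExt_ιMulti, map_sum,
    exteriorPower.map_apply_ιMulti]
  refine Finset.sum_congr rfl fun i _ => ?_
  rw [Function.comp_update, h]
  rfl

theorem LieHomology.map_der (φ : L →ₗ⁅k⁆ L') (D : LieDerivation k L L)
    (D' : LieDerivation k L' L') (h : ∀ x, φ (D x) = D' (φ x)) (n : ℕ) (x : LieHomology k L n) :
    LieHomology.map k φ n (LieHomology.der k D n x) =
      LieHomology.der k D' n (LieHomology.map k φ n x) := by
  obtain ⟨⟨a, ha⟩, rfl⟩ := Submodule.mkQ_surjective _ x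
  refine congrArg (Submodule.mkQ _) (Subtype.ext ?_)
  exact map_derExt k (φ : L →ₗ[k] L') D D' h n a

/-- An isomorphism of Lie algebras induces an isomorphism on homology. -/
def LieHomology.congr (e : L ≃ₗ⁅k⁆ L') (n : ℕ) : LieHomology k L n ≃ₗ[k] LieHomology k L' n :=
  LinearEquiv.ofLinearMap (LieHomology.map k e.toLieHom n) (LieHomology.map k e.symm.toLieHom n)
    (by
      refine LinearMap.ext fun x => ?_
      rw [LinearMap.comp_apply, LieHomology.map_map]
      refine (LieHomology.map_congr k (fun y => ?_) n x).trans (LieHomology.map_id k n x)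
      exact e.apply_symm_apply y)
    (by
      refine LinearMap.ext fun x => ?_
      rw [LinearMap.comp_apply, LieHomology.map_map]
      refine (LieHomology.map_congr k (fun y => ?_) n x).trans (LieHomology.map_id k n x)
      exact e.symm_apply_apply y)

theorem LieHomology.congr_apply (e : L ≃ₗ⁅k⁆ L') (n : ℕ) (x : LieHomology k L n) :
    LieHomology.congr k e n x = LieHomology.map k e.toLieHom n x := rfl

end ChevalleyEilenberg

/-! ### Homology of `TAG(Jord(V))` -/

namespace FreeTAG

open ChevalleyEilenberg

variable (k : Type u) [Field k] [CharZero k] (V : Type v) [AddCommGroup V] [Module k V]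

/-- The homology of `TAG(Jord(V))` is the value on `V` of the homology of `twistedTAG`. -/
def homologyEquiv (n : ℕ) :
    LieHomology k (TAG k (FreeJordan k V)) n ≃ₗ[k] ((twistedTAG k).homology n).Eval V :=
  (LieHomology.congr k (evalLieEquiv k V).symm n).trans ((twistedTAG k).homologyEquiv V n)

variable {V}

theorem homologyEquiv_map {W : Type v} [AddCommGroup W] [Module k W] (f : V →ₗ[k] W) (n : ℕ)
    (x : LieHomology k (TAG k (FreeJordan k V)) n) :
    homologyEquiv k W n (LieHomology.map k (TAG.map (FreeJordan.map f)) n x) =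
      ((twistedTAG k).homology n).evalMap f (homologyEquiv k V n x) := by
  rw [homologyEquiv, homologyEquiv, LinearEquiv.trans_apply, LinearEquiv.trans_apply,
    ← TwistedLieAlgebra.homologyEquiv_map]
  congr 1
  simp only [LieHomology.congr_apply, LieHomology.map_map]
  refine LieHomology.map_congr k (fun p => ?_) n x
  change (evalLieEquiv k W).symm (map f p) =
    (twistedTAG k).lieEvalMap f ((evalLieEquiv k V).symm p)
  -- Naturality is known for `evalLieEquiv`, not for its inverse; applying it removes the inverses
  -- and leaves `map_evalHom`.
  apply (evalLieEquiv k W).injective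
  refine ((evalLieEquiv k W).apply_symm_apply _).trans ?_
  refine (congrArg (map f) ((evalLieEquiv k V).apply_symm_apply p).symm).trans ?_
  exact map_evalHom f _

theorem homologyEquiv_der (s : Sl2 k) (n : ℕ) (x : LieHomology k (TAG k (FreeJordan k V)) n) :
    homologyEquiv k V n (LieHomology.der k (TAG.slAction s) n x) =
      ((twistedSlAction s).homology n).eval V (homologyEquiv k V n x) := by
  rw [homologyEquiv, LinearEquiv.trans_apply, LinearEquiv.trans_apply,
    ← TwistedLieAlgebra.homologyEquiv_der]
  congr 1
  simp only [LieHomology.congr_apply]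
  refine LieHomology.map_der k _ _ _ (fun p => ?_) n x
  change (evalLieEquiv k V).symm (TAG.slMap s p) =
    (twistedSlAction s).toHom.eval V ((evalLieEquiv k V).symm p)
  apply (evalLieEquiv k V).injective
  refine ((evalLieEquiv k V).apply_symm_apply _).trans ?_
  refine (congrArg (TAG.slMap s) ((evalLieEquiv k V).apply_symm_apply p).symm).trans ?_
  exact slMap_evalHom s _

end FreeTAG

end

theorem mainTheorem8 (k : Type u) [Field k] [CharZero k] :
    -- The Lie algebra homology of `TAG(Jord(V))` is the value on `V` of the homology of the twisted
    -- Lie algebra `twistedTAG k`, naturally in `V` and compatibly with the action of `𝔰𝔩₂`.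
    (∃ φ : ∀ (n : ℕ) (V : Type v) [AddCommGroup V] [Module k V],
        ChevalleyEilenberg.LieHomology k (TAG k (FreeJordan k V)) n ≃ₗ[k]
          ((twistedTAG k).homology n).Eval V,
      (∀ (n : ℕ) (V W : Type v) [AddCommGroup V] [Module k V] [AddCommGroup W] [Module k W]
        (f : V →ₗ[k] W) (x : ChevalleyEilenberg.LieHomology k (TAG k (FreeJordan k V)) n),
        φ n W (ChevalleyEilenberg.LieHomology.map k (TAG.map (FreeJordan.map f)) n x) =
          ((twistedTAG k).homology n).evalMap f (φ n V x)) ∧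
      (∀ (n : ℕ) (V : Type v) [AddCommGroup V] [Module k V] (s : Sl2 k)
        (x : ChevalleyEilenberg.LieHomology k (TAG k (FreeJordan k V)) n),
        φ n V (ChevalleyEilenberg.LieHomology.der k (TAG.slAction s) n x) =
          ((twistedSlAction s).homology n).eval V (φ n V x))) ∧
    -- For every twisted Lie algebra `g`, the homology of the Lie algebra `g(V)` is the value on `V`
    -- of the homology of `g`, naturally in `V`.
    (∀ g : TwistedLieAlgebra.{u, w} k,
      ∃ φ : ∀ (n : ℕ) (V : Type v) [AddCommGroup V] [Module k V],
        ChevalleyEilenberg.LieHomology k (g.LieEval V) n ≃ₗ[k] (g.homology n).Eval V,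
      ∀ (n : ℕ) (V W : Type v) [AddCommGroup V] [Module k V] [AddCommGroup W] [Module k W]
        (f : V →ₗ[k] W) (x : ChevalleyEilenberg.LieHomology k (g.LieEval V) n),
        φ n W (ChevalleyEilenberg.LieHomology.map k (g.lieEvalMap f) n x) =
          (g.homology n).evalMap f (φ n V x)) := by
  refine ⟨⟨fun n V _ _ => FreeTAG.homologyEquiv k V n,
    fun n V W _ _ _ _ f x => FreeTAG.homologyEquiv_map k f n x,
    fun n V _ _ s x => FreeTAG.homologyEquiv_der k s n x⟩, fun g => ?_⟩
  exact ⟨fun n V _ _ => g.homologyEquiv V n, fun n V W _ _ _ _ f x => g.homologyEquiv_map f n x⟩
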